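/- **Setting.** Let $G$ be a (second countable) real Lie group, $\Gamma\subset G$ a torsion-free discrete subgroup with $\Gamma\backslash G$ compact, and $K\subset G$ a compact subgroup with Lie algebra $\mathfrak k$ such that $\mathfrak g=\mathfrak k\oplus\mathfrak p$ is a Cartan decomposition (for instance $G$ connected semisimple with finite centre and $K$ a maximal compact subgroup); put $M=\Gamma\backslash G/K$. Let $X_1,\dots,X_N$ be a basis of $\mathfrak p$, orthonormal for the Killing form, completed to a basis of $\mathfrak g$ by a basis of $\mathfrak k$ that is orthonormal for the negative of the Killing form; $X_k$ also denotes the left-invariant vector field. Fix Haar measures $dvol_G$ on $G$ and $dvol_K$ on $K$, let $c^{-1}=dvol_K(K)$, let $D\subset G$ be a fundamental domain for left multiplication by $\Gamma$, and let $dvol_M$ be the corresponding quotient measure on $M$, i.e. $\int_G f\,dvol_G=\int_M\big(\sum_{\gamma\in\Gamma}\int_K f(\gamma yk)\,dvol_K(k)\big)\,dvol_M(\Gamma yK)$ for all measurable $f\ge0$ (for the Riemannian volumes of the left-invariant metric on $G$ with orthonormal frame $X_1,\dots,X_{\dim G}$ and of its restriction to $K$, this is the volume of the metric on $M$ for which $G\to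 M$ is a Riemannian submersion). Let $\pi_1:G\to GL(F)$ be a smooth finite-dimensional real representation, with differential also denoted $\pi_1$, and let $(\cdot,\cdot)_F$ be an inner product on $F$ that is invariant under $\pi_1(K)$ and for which $\pi_1(X)$ is skew for $X\in\mathfrak k$ and symmetric for $X\in\mathfrak p$. Let $\pi_2$ be a unitary (orthogonal) representation of $\Gamma$ on a separable real Hilbert space $\mathcal H$ with a countable orthonormal basis $(v_\alpha)_{\alpha\in A}$. Put $E=F\otimes\mathcal H$ with the tensor product inner product, $\sigma(\gamma,k)=\pi_1(\gamma)\otimes\pi_2(\gamma)$ and $\sigma'(\gamma,k)=\pi_1(k)\otimes\pi_2(\gamma)$. The principal $\Gamma\times K$-bundle $G\to M$, $g\cdot(\gamma,k)=\gamma^{-1}gk$, carries the connection with horizontal spaces $dL_g(\mathfrak p)$. Let $\mathcal E(\pi)=E(\sigma)$ and $E(\sigma')$ be the associated bundles, with the induced connections $\nabla$ (flat) and $\nabla'$. They are identified through $(g,v)\mapsto(g,(\pi_1(g)^{-1}\otimes\mathrm{Id})v)$, and carry the metric induced by $(\cdot,\cdot)_E$ on $E(\sigma')$. Forms on $M$ with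 values in such a bundle are identified with their lifts to $G$, the smooth horizontal $E$-valued forms whose pull-back by $g\mapsto\gamma^{-1}gk$ is $\sigma(\gamma,k)^{-1}$, respectively $\sigma'(\gamma,k)^{-1}$, times the form. For each of the two connections let $d$ be the exterior (covariant) derivative, $\delta=(-1)^p*^{-1}\#^{-1}d\,\#*$ on $p$-forms, where $\#$ is the isomorphism onto the dual bundle given by the metric, and $d\delta+\delta d$ the Laplacian: $\triangle$ for $\nabla$ and $\triangle'$ for $\nabla'$. Let $(\cdot,\cdot)$ be the $L^2$ inner product of forms on $M$. **Proposition.** Let $p\ge1$ and let $\eta$ be a smooth $\mathcal E(\pi)$-valued $p$-form on $M$, with $E(\sigma')$-lift $\eta^*$ and $\eta^*(X_{i_1},\dots,X_{i_p})=\sum_{\alpha\in A}\eta^\alpha_{i_1,\dots,i_p}\otimes v_\alpha$, $\eta^\alpha_{i_1,\dots,i_p}:G\to F$. Then $$(\triangle\eta,\eta)-(\triangle'\eta,\eta)=\frac{c}{p!}\sum_{\alpha\in A}\sum_{i_1,\dots,i_p=1}^N\int_D\Big(\sum_{k=1}^N\pi_1(X_k)^2\eta^\alpha_{i_1,\dots,i_p},\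 \eta^\alpha_{i_1,\dots,i_p}\Big)_F dvol_G$$ $$\qquad+\frac{c}{(p-1)!}\sum_{\alpha\in A}\sum_{h,i_1,\dots,i_{p-1}=1}^N\int_D\Big(\sum_{k=1}^N\pi_1([X_h,X_k])\,\eta^\alpha_{k,i_1,\dots,i_{p-1}},\ \eta^\alpha_{h,i_1,\dots,i_{p-1}}\Big)_F dvol_G,$$ where all the integrals on both sides exist and both series over $\alpha$ converge absolutely. -/

import Mathlib

open MeasureTheory Module
open scoped Manifold ContDiff TensorProduct Nat ENNReal

noncomputable section

namespace BochnerFormula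

section LieGroup

variable {n : ℕ} {G : Type*} [TopologicalSpace G] [ChartedSpace (EuclideanSpace ℝ (Fin n)) G]
  [Group G]

/-- The Lie algebra `𝔤 = T₁G` of an `n`-dimensional Lie group, with the bracket of left-invariant
vector fields. -/
abbrev Lie (n : ℕ) (G : Type*) [TopologicalSpace G] [ChartedSpace (EuclideanSpace ℝ (Fin n)) G]
    [Group G] : Type :=
  GroupLieAlgebra (𝓡 n) G

instance instLieGroupMinSmoothness [h : LieGroup (𝓡 n) ∞ G] :
    LieGroup (𝓡 n) (minSmoothness ℝ 3) G := by
  rw [minSmoothness_of_isRCLikeNormedField]; infer_instance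

/-- The differential at `1` of the conjugation `g ↦ k g k⁻¹`. -/
def Ad (k : G) (Y : Lie n G) : Lie n G :=
  mfderiv (𝓡 n) (𝓡 n) (fun g : G => k * g * k⁻¹) 1 Y

/-- `𝔨` is the Lie algebra of the subgroup `K`: the initial velocities of the smooth
one-parameter subgroups of `G` that stay in `K`. -/
def IsLieAlgebraOf (𝔨 : Submodule ℝ (Lie n G)) (K : Subgroup G) : Prop :=
  ∀ Y : Lie n G, Y ∈ 𝔨 ↔ ∃ c : ℝ → G, ContMDiff 𝓘(ℝ, ℝ) (𝓡 n) ∞ c ∧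
    (∀ s t, c (s + t) = c s * c t) ∧ (∀ t, c t ∈ K) ∧
    (mfderiv 𝓘(ℝ, ℝ) (𝓡 n) c 0 (1 : ℝ) : EuclideanSpace ℝ (Fin n)) = Y

/-- `𝔤 = 𝔨 ⊕ 𝔭` is a Cartan decomposition. -/
structure IsCartanDecomposition [LieGroup (𝓡 n) ∞ G] (𝔨 𝔭 : Submodule ℝ (Lie n G)) : Prop where
  isCompl : IsCompl 𝔨 𝔭
  lie_kk : ∀ Y ∈ 𝔨, ∀ Z ∈ 𝔨, ⁅Y, Z⁆ ∈ 𝔨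
  lie_kp : ∀ Y ∈ 𝔨, ∀ Z ∈ 𝔭, ⁅Y, Z⁆ ∈ 𝔭
  lie_pp : ∀ Y ∈ 𝔭, ∀ Z ∈ 𝔭, ⁅Y, Z⁆ ∈ 𝔨
  neg_def : ∀ Y ∈ 𝔨, Y ≠ 0 → killingForm ℝ (Lie n G) Y Y < 0
  pos_def : ∀ Y ∈ 𝔭, Y ≠ 0 → 0 < killingForm ℝ (Lie n G) Y Y

/-- `X` consists of a basis `X (inl 1), …, X (inl N)` of `𝔭`, orthonormal for the Killing form, and
of a basis `X (inr 1), …, X (inr m)` of `𝔨`, orthonormal for the negative of the Killing form. -/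
structure IsCartanBasis [LieGroup (𝓡 n) ∞ G] {N m : ℕ} (𝔨 𝔭 : Submodule ℝ (Lie n G))
    (X : Basis (Fin N ⊕ Fin m) ℝ (Lie n G)) : Prop where
  mem_p : ∀ i, X (Sum.inl i) ∈ 𝔭
  mem_k : ∀ a, X (Sum.inr a) ∈ 𝔨
  orthonormal_p : ∀ i j, killingForm ℝ (Lie n G) (X (Sum.inl i)) (X (Sum.inl j))
    = if i = j then 1 else 0
  orthonormal_k : ∀ a b, -killingForm ℝ (Lie n G) (X (Sum.inr a)) (X (Sum.inr b))
    = if a = b then 1 else 0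

/-- The derivative of `f : G → V` along the left-invariant vector field determined by `Y`. -/
def lieDeriv {V : Type*} [NormedAddCommGroup V] [NormedSpace ℝ V] (Y : Lie n G) (f : G → V)
    (g : G) : V :=
  mfderiv (𝓡 n) 𝓘(ℝ, V) f g (mulInvariantVectorField (I := 𝓡 n) Y g)

/-- The differential at `1` of a representation of `G`: the induced action of `Y ∈ 𝔤`. -/
def dRep {F : Type*} [NormedAddCommGroup F] [NormedSpace ℝ F] (π₁ : Representation ℝ G F)
    (Y : Lie n G) (u : F) : F :=
  mfderiv (𝓡 n) 𝓘(ℝ, F) (fun g : G => π₁ g u) 1 Y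

/-- The inner product of `F` is admissible: `π₁(K)` preserves it, `π₁(𝔨)` is skew, `π₁(𝔭)` is
symmetric. -/
structure IsAdmissible {F : Type*} [NormedAddCommGroup F] [InnerProductSpace ℝ F]
    (π₁ : Representation ℝ G F) (K : Subgroup G) (𝔨 𝔭 : Submodule ℝ (Lie n G)) : Prop where
  invariant : ∀ k ∈ K, ∀ u v, inner ℝ (π₁ k u) (π₁ k v) = inner ℝ u v
  skew : ∀ Y ∈ 𝔨, ∀ u v, inner ℝ (dRep π₁ Y u) v = -inner ℝ u (dRep π₁ Y v)
  symm : ∀ Y ∈ 𝔭, ∀ u v, inner ℝ (dRep π₁ Y u) v = inner ℝ u (dRep π₁ Y v)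

end LieGroup

section Quotient

/-- The double coset space `M = Γ \ G / K`, with the quotient σ-algebra. -/
abbrev DoubleQuotient {G : Type*} [Group G] (Γ K : Subgroup G) : Type _ :=
  Quotient (DoubleCoset.setoid (Γ : Set G) (K : Set G))

/-- `ν` is the volume measure of `M = Γ \ G / K` as the base of the principal `Γ × K`-bundle
`q : G → M`: integrating over `G` is integrating first over the fibres `Γ y K` of `q`, with
respect to counting measure on `Γ` times `μK`, and then over `M`. The inner integral does not
depend on the representative of `x`. -/
def IsQuotientVolume {G : Type*} [Group G] [MeasurableSpace G] (Γ K : Subgroup G) (μG : Measure G)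
    (μK : Measure K) (ν : Measure (DoubleQuotient Γ K)) : Prop :=
  ∀ f : G → ℝ≥0∞, Measurable f →
    ∫⁻ g, f g ∂μG = ∫⁻ x, ∑' γ : Γ, ∫⁻ k : K, f (γ * x.out * k) ∂μK ∂ν

end Quotient

section Forms

variable {n : ℕ} {G : Type*} [TopologicalSpace G] [ChartedSpace (EuclideanSpace ℝ (Fin n)) G]
  [Group G] {E : Type*} [NormedAddCommGroup E] [InnerProductSpace ℝ E] {N m p : ℕ}

/-- An `E`-valued `p`-form on `G` in the left trivialization of `TG`: `β g (Y₁, …, Y_p)` is the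
value at `g` on the left-invariant vector fields determined by `Y₁, …, Y_p ∈ 𝔤`. (Alternation and
multilinearity are not part of the type; the forms of interest have them.) -/
abbrev LForm (n : ℕ) (G : Type*) [TopologicalSpace G] [ChartedSpace (EuclideanSpace ℝ (Fin n)) G]
    [Group G] (E : Type*) (p : ℕ) : Type _ :=
  G → (Fin p → Lie n G) → E

/-- `β` is the lift to `G` of a smooth `p`-form on `M = Γ \ G / K` with values in the bundle
associated with the principal `Γ × K`-bundle `G → M`, `g · (γ, k) = γ⁻¹ g k`, and the
representation `τ` of `Γ × K` on `E` (a tensorial form of type `τ`): `β` is smooth, horizontal,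
and its pull-back by `g ↦ γ⁻¹ g k` is `τ (γ, k)⁻¹ β`. In the left trivialization the differential
of this map sends `Y` to `Ad k⁻¹ Y`. -/
structure IsLift {Γ K : Subgroup G} (𝔨 : Submodule ℝ (Lie n G)) (τ : Representation ℝ (Γ × K) E)
    (β : G → (Lie n G) [⋀^Fin p]→ₗ[ℝ] E) : Prop where
  smooth : ∀ Y : Fin p → Lie n G, ContMDiff (𝓡 n) 𝓘(ℝ, E) ∞ (fun g => β g Y)
  horizontal : ∀ g (Y : Fin p → Lie n G), (∃ i, Y i ∈ 𝔨) → β g Y = 0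
  equivariant : ∀ (γ : Γ) (k : K) (g : G) (Y : Fin p → Lie n G),
    β ((γ : G)⁻¹ * g * k) (fun i => Ad (k : G)⁻¹ (Y i)) = τ (γ, k)⁻¹ (β g Y)

/-- The exterior derivative of a form on `G`, evaluated on left-invariant vector fields. -/
def extDerivG : {p : ℕ} → LForm n G E p → LForm n G E (p + 1)
  | 0, β => fun g Y => lieDeriv (Y 0) (fun x => β x Fin.elim0) g
  | q + 1, β => fun g Y =>
      (∑ i : Fin (q + 2), (-1 : ℝ) ^ (i : ℕ) • lieDeriv (Y i) (fun x => β x (i.removeNth Y)) g)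
      + ∑ i : Fin (q + 2), ∑ j : Fin (q + 1),
          if i ≤ j.castSucc then
            (-1 : ℝ) ^ ((i : ℕ) + (j.succ : ℕ)) •
              β g (Fin.cons ⁅Y i, Y j.succ⁆ (j.removeNth (i.removeNth Y)))
          else 0

/-- The projection of `𝔤` onto `𝔭` along `𝔨`. -/
def horProj (X : Basis (Fin N ⊕ Fin m) ℝ (Lie n G)) (Y : Lie n G) : Lie n G :=
  ∑ i : Fin N, X.repr Y (Sum.inl i) • X (Sum.inl i)

/-- The exterior covariant derivative for the principal connection in `G → M` with horizontal
spaces `dL_g(𝔭)`. On lifts it is the exterior derivative `d` of bundle-valued forms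
on `M` for the connection in the associated bundle induced by the principal connection. -/
def covDeriv (X : Basis (Fin N ⊕ Fin m) ℝ (Lie n G)) (β : LForm n G E p) : LForm n G E (p + 1) :=
  fun g Y => extDerivG β g (fun i => horProj X (Y i))

/-- The Riemannian volume form `ξ¹ ∧ ⋯ ∧ ξ^N` (`ξ^j` dual to `X_j`) of `M`, lifted to `G`. -/
def horVol (X : Basis (Fin N ⊕ Fin m) ℝ (Lie n G)) (Z : Fin N → Lie n G) : ℝ :=
  (Matrix.of fun i j : Fin N => X.repr (Z i) (Sum.inl j)).det

/-- The (lifted) Hodge star operator from `p`-forms to `q`-forms, `p + q = N`. -/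
def hodge (X : Basis (Fin N ⊕ Fin m) ℝ (Lie n G)) {p q : ℕ} (h : p + q = N)
    (β : LForm n G E p) : LForm n G E q :=
  fun g Y => (1 / (p ! : ℝ)) • ∑ I : Fin p → Fin N,
    horVol X (fun a => Fin.append (fun b => X (Sum.inl (I b))) Y (Fin.cast h.symm a)) •
      β g (fun b => X (Sum.inl (I b)))

/-- The inverse of the Hodge star operator `hodge X h`, from `q`-forms to `p`-forms;
`** = (-1)^{pq}` on `p`-forms. -/
def hodgeInv (X : Basis (Fin N ⊕ Fin m) ℝ (Lie n G)) {p q : ℕ} (h : p + q = N)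
    (β : LForm n G E q) : LForm n G E p :=
  fun g Y => (-1 : ℝ) ^ (p * q) • hodge X (by rw [← h, add_comm]) β g Y

/-- The codifferential `δθ = (-1)^p *⁻¹ #⁻¹ d # * θ` on `p`-forms (here of degree `p + 1`). The
bundle isomorphism `#` from `V` to `V*` given by the metric lifts to `S : G → (E → E*)`, where `E*`
is identified with `E` by the inner product of `E`; `T g` is the inverse of `S g`. Forms of degree
greater than `N` vanish. -/
def codiff (X : Basis (Fin N ⊕ Fin m) ℝ (Lie n G)) (S T : G → E →ₗ[ℝ] E)
    (β : LForm n G E (p + 1)) : LForm n G E p :=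
  if h : p + 1 ≤ N then
    have h₁ : (p + 1) + (N - (p + 1)) = N := Nat.add_sub_of_le h
    have h₂ : p + ((N - (p + 1)) + 1) = N := by omega
    fun g Y => (-1 : ℝ) ^ (p + 1) •
      hodgeInv X h₂ (fun g' Y' => T g' (covDeriv X
        (fun g'' Y'' => S g'' (hodge X h₁ β g'' Y'')) g' Y')) g Y
  else 0

/-- The Laplacian `dδ + δd` in positive degree. -/
def laplacian (X : Basis (Fin N ⊕ Fin m) ℝ (Lie n G)) (S T : G → E →ₗ[ℝ] E)
    (β : LForm n G E (p + 1)) : LForm n G E (p + 1) :=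
  covDeriv X (codiff X S T β) + codiff X S T (covDeriv X β)

/-- The pointwise inner product `∑_{i₁ < ⋯ < i_p} (β(X_{i₁}, …), θ(X_{i₁}, …))_E` of lifted forms,
with respect to the canonical metric of the bundle. -/
def pointwiseInner (X : Basis (Fin N ⊕ Fin m) ℝ (Lie n G)) (β θ : LForm n G E p) (g : G) : ℝ :=
  ∑ I : Fin p ↪o Fin N,
    inner ℝ (β g fun a => X (Sum.inl (I a))) (θ g fun a => X (Sum.inl (I a)))

/-- The integrand of `(β, θ)` as a function on `M`. For lifts `β`, `θ` of forms on `M` it does not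
depend on the representative. -/
def innerOnM {Γ K : Subgroup G} (X : Basis (Fin N ⊕ Fin m) ℝ (Lie n G)) (β θ : LForm n G E p)
    (x : DoubleQuotient Γ K) : ℝ :=
  pointwiseInner X β θ x.out

end Forms

section TensorBundle

variable {n : ℕ} {G : Type*} [TopologicalSpace G] [ChartedSpace (EuclideanSpace ℝ (Fin n)) G]
  [Group G] {F : Type*} [NormedAddCommGroup F] [InnerProductSpace ℝ F] [FiniteDimensional ℝ F]
  {H : Type*} [NormedAddCommGroup H] [InnerProductSpace ℝ H] {N m p : ℕ}

/-- `σ(γ, k) = π₁(γ) ⊗ π₂(γ)`; the associated bundle `E(σ)` is `ℰ(π)`. -/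
def sigma {Γ : Subgroup G} (K : Subgroup G) (π₁ : Representation ℝ G F)
    (π₂ : Representation ℝ Γ H) : Representation ℝ (Γ × K) (F ⊗[ℝ] H) :=
  Representation.tprod (π₁.comp (Γ.subtype.comp (MonoidHom.fst Γ K)))
    (π₂.comp (MonoidHom.fst Γ K))

/-- `σ'(γ, k) = π₁(k) ⊗ π₂(γ)`. -/
def sigma' {Γ : Subgroup G} (K : Subgroup G) (π₁ : Representation ℝ G F)
    (π₂ : Representation ℝ Γ H) : Representation ℝ (Γ × K) (F ⊗[ℝ] H) :=
  Representation.tprod (π₁.comp (K.subtype.comp (MonoidHom.snd Γ K)))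
    (π₂.comp (MonoidHom.fst Γ K))

/-- The operator `A(g) = π₁(g)⁻¹ ⊗ Id` that carries lifts to `E(σ)` to lifts to `E(σ')`. -/
def toK (H : Type*) [NormedAddCommGroup H] [InnerProductSpace ℝ H] (π₁ : Representation ℝ G F)
    (g : G) : F ⊗[ℝ] H →ₗ[ℝ] F ⊗[ℝ] H :=
  LinearMap.rTensor H (π₁ g⁻¹)

/-- The inverse `A(g)⁻¹ = π₁(g) ⊗ Id`. -/
def toFlat (H : Type*) [NormedAddCommGroup H] [InnerProductSpace ℝ H] (π₁ : Representation ℝ G F)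
    (g : G) : F ⊗[ℝ] H →ₗ[ℝ] F ⊗[ℝ] H :=
  LinearMap.rTensor H (π₁ g)

/-- The lift to `E(σ)` of the isomorphism `# : E(σ) → E(σ)*` given by the canonical metric, which
at `g` is `(u, v) ↦ (A(g) u, A(g) v)_E`; see `inner_flatSharp`. -/
def flatSharp (H : Type*) [NormedAddCommGroup H] [InnerProductSpace ℝ H]
    (π₁ : Representation ℝ G F) (g : G) : F ⊗[ℝ] H →ₗ[ℝ] F ⊗[ℝ] H :=
  LinearMap.rTensor H (LinearMap.adjoint (π₁ g⁻¹) ∘ₗ π₁ g⁻¹)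

/-- The inverse of `flatSharp`. -/
def flatSharpInv (H : Type*) [NormedAddCommGroup H] [InnerProductSpace ℝ H]
    (π₁ : Representation ℝ G F) (g : G) : F ⊗[ℝ] H →ₗ[ℝ] F ⊗[ℝ] H :=
  LinearMap.rTensor H (π₁ g ∘ₗ LinearMap.adjoint (π₁ g))

set_option linter.unusedSectionVars false in
theorem inner_flatSharp (π₁ : Representation ℝ G F) (g : G) (u v : F ⊗[ℝ] H) :
    inner ℝ u (flatSharp H π₁ g v) = inner ℝ (toK H π₁ g u) (toK H π₁ g v) := by
  induction u with
  | zero => simp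
  | add x y hx hy => simp only [map_add, inner_add_left, hx, hy]
  | tmul a b =>
    induction v with
    | zero => simp
    | add x y hx hy => simp only [map_add, inner_add_right, hx, hy]
    | tmul c d => simp [flatSharp, toK, LinearMap.adjoint_inner_right]

set_option linter.unusedSectionVars false in
theorem flatSharp_flatSharpInv (π₁ : Representation ℝ G F) (g : G) :
    flatSharp H π₁ g ∘ₗ flatSharpInv H π₁ g = LinearMap.id := by
  have h : π₁ g⁻¹ ∘ₗ π₁ g = LinearMap.id := by
    rw [← Module.End.mul_eq_comp, ← map_mul]; simp [Module.End.one_eq_id]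
  have h' : LinearMap.adjoint (π₁ g⁻¹) ∘ₗ LinearMap.adjoint (π₁ g) = LinearMap.id := by
    have h₀ : π₁ g ∘ₗ π₁ g⁻¹ = LinearMap.id := by
      rw [← Module.End.mul_eq_comp, ← map_mul]; simp [Module.End.one_eq_id]
    rw [← LinearMap.adjoint_comp, h₀, LinearMap.adjoint_id]
  rw [flatSharp, flatSharpInv, ← LinearMap.rTensor_comp]
  rw [LinearMap.comp_assoc, ← LinearMap.comp_assoc _ (π₁ g), h, LinearMap.id_comp, h']
  exact LinearMap.rTensor_id _ _

/-- The Laplacian `Δ` of the connection `∇` of `E(σ) = ℰ(π)`, on lifts to `E(σ')`: pass to the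
lift to `E(σ)`, apply the Laplacian of the connection induced there, and come back. -/
def flatLaplacian (π₁ : Representation ℝ G F) (X : Basis (Fin N ⊕ Fin m) ℝ (Lie n G))
    (η : LForm n G (F ⊗[ℝ] H) (p + 1)) : LForm n G (F ⊗[ℝ] H) (p + 1) :=
  fun g Y => toK H π₁ g (laplacian X (flatSharp H π₁) (flatSharpInv H π₁)
    (fun g' Y' => toFlat H π₁ g' (η g' Y')) g Y)

/-- The Laplacian `Δ'` of the connection `∇'` of `E(σ')`, on lifts to `E(σ')`; there the canonical
metric is the constant one, so that `#` becomes the identity. -/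
def kLaplacian (X : Basis (Fin N ⊕ Fin m) ℝ (Lie n G))
    (η : LForm n G (F ⊗[ℝ] H) (p + 1)) : LForm n G (F ⊗[ℝ] H) (p + 1) :=
  laplacian X (fun _ => LinearMap.id) (fun _ => LinearMap.id) η

/-- The coefficient `e^w ∈ F` of `e ∈ F ⊗ H` along the unit vector `w ∈ H`: `(u ⊗ v)^w = (w, v) u`.
-/
def coeff (w : H) (e : F ⊗[ℝ] H) : F :=
  TensorProduct.rid ℝ F (LinearMap.lTensor F (innerₗ H w) e)

end TensorBundle

end BochnerFormula

end

/-! Work in the frame of left-invariant fields and in the trivialization of `E(σ')`. Let L_k be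
differentiation along X_k and R_k = π₁(X_k) ⊗ Id. Conjugation by A(g) = π₁(g)⁻¹ ⊗ Id turns the flat
derivative along X_k into L_k + R_k (`toFlat_lieDeriv`), whereas ∇' is L_k alone. The metric dual of
the flat connection becomes L_k - R_k, because π₁(𝔭) is symmetric (`flatSharpInv_lieDeriv`).
Brackets of fields in 𝔭 lie in 𝔨 and are killed by horizontal forms, so d is ∑ ξ^k ∧ D_k;
contracting Levi-Civita symbols collapses the Hodge-star formula for δ to -∑ D'_k ι_k
(`codiff_contraction`). Both Laplacians are thus instances of `lapForm` (`laplacian_apply`).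

For arbitrary operators D and D', dδ + δd equals -∑ D'_k D_k plus terms in the commutators [D'_k,
D_i] (`lapForm_apply`). Since L and R commute, all mixed terms cancel for D = L + R, D' = L - R;
subtracting the case R = 0 leaves ∑ R_k² and [R_i, R_k] = π₁([X_i, X_k]) ⊗ Id (`lapForm_sub`). The
formula is therefore a pointwise identity of order zero in η (`pointwiseInner_flatLaplacian_sub`),
and no integration by parts occurs.

It remains to integrate it. Ad(K) preserves the Killing form, hence acts orthogonally on 𝔭
(`IsCartanBasis.exists_orthogonal`), so the pointwise products are continuous Γ × K-invariant
functions, bounded by cocompactness. A measurable function whose Γ-translates sum to 1 compares the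
integral over D with the one over M, the ratio being the volume of K (`integral_fundamentalDomain`).
Parseval in the Hilbert space, integrated by dominated convergence, gives the series over α
(`hasSum_integral_inner_coeff`). -/

noncomputable section

namespace BochnerFormula
set_option linter.unusedSectionVars false

/-! ### Calculus of derivatives along left-invariant fields. -/

section LieDerivative

variable {n : ℕ} {G : Type*} [TopologicalSpace G] [ChartedSpace (EuclideanSpace ℝ (Fin n)) G]
  [Group G] {V W U : Type*} [NormedAddCommGroup V] [NormedSpace ℝ V] [NormedAddCommGroup W]
  [NormedSpace ℝ W] [NormedAddCommGroup U] [NormedSpace ℝ U]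

/-- Tangent spaces at equal points are distinct types, both unfolding to the model space; this moves
the base point without rewriting under the dependency. -/
theorem mfderiv_congr_apply (f : G → V) {a b : G} (h : a = b) (w : EuclideanSpace ℝ (Fin n)) :
    (mfderiv (𝓡 n) 𝓘(ℝ, V) f a : EuclideanSpace ℝ (Fin n) →L[ℝ] V) w
      = (mfderiv (𝓡 n) 𝓘(ℝ, V) f b : EuclideanSpace ℝ (Fin n) →L[ℝ] V) w := by
  subst h; rfl

theorem lieDeriv_const (Y : Lie n G) (u : V) (g : G) : lieDeriv Y (fun _ => u) g = 0 := by
  unfold lieDeriv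
  rw [mfderiv_const]; rfl

theorem lieDeriv_add (Y : Lie n G) {f h : G → V} {g : G}
    (hf : MDifferentiableAt (𝓡 n) 𝓘(ℝ, V) f g) (hh : MDifferentiableAt (𝓡 n) 𝓘(ℝ, V) h g) :
    lieDeriv Y (fun x => f x + h x) g = lieDeriv Y f g + lieDeriv Y h g := by
  have := (hf.hasMFDerivAt.add hh.hasMFDerivAt).mfderiv
  change mfderiv (𝓡 n) 𝓘(ℝ, V) (f + h) g _ = _
  rw [this]; rfl

theorem lieDeriv_clm_comp (Y : Lie n G) (T : V →L[ℝ] W) {f : G → V} {g : G}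
    (hf : MDifferentiableAt (𝓡 n) 𝓘(ℝ, V) f g) :
    lieDeriv Y (fun x => T (f x)) g = T (lieDeriv Y f g) := by
  have := (T.hasFDerivAt (x := f g)).hasMFDerivAt.comp g hf.hasMFDerivAt
  have := this.mfderiv
  change mfderiv (𝓡 n) 𝓘(ℝ, W) (T ∘ f) g _ = _
  rw [this]; rfl

theorem lieDeriv_smul_const (Y : Lie n G) (c : ℝ) {f : G → V} {g : G}
    (hf : MDifferentiableAt (𝓡 n) 𝓘(ℝ, V) f g) :
    lieDeriv Y (fun x => c • f x) g = c • lieDeriv Y f g :=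
  lieDeriv_clm_comp Y (c • ContinuousLinearMap.id ℝ V) hf

theorem lieDeriv_sum {ι : Type*} (s : Finset ι) (Y : Lie n G) {f : ι → G → V} {g : G}
    (hf : ∀ i, MDifferentiableAt (𝓡 n) 𝓘(ℝ, V) (f i) g) :
    lieDeriv Y (fun x => ∑ i ∈ s, f i x) g = ∑ i ∈ s, lieDeriv Y (f i) g := by
  classical
  -- Differentiability of the partial sums travels with the formula, since each induction step needs
  -- it.
  have key : MDifferentiableAt (𝓡 n) 𝓘(ℝ, V) (fun x => ∑ i ∈ s, f i x) g ∧
    lieDeriv Y (fun x => ∑ i ∈ s, f i x) g = ∑ i ∈ s, lieDeriv Y (f i) g := by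
    induction s using Finset.induction_on with
    | empty => simpa using ⟨mdifferentiableAt_const, lieDeriv_const Y (0 : V) g⟩
    | insert a s ha ih =>
      simp only [Finset.sum_insert ha]
      exact ⟨(hf a).add ih.1, by rw [lieDeriv_add Y (hf a) ih.1, ih.2]⟩
  exact key.2

theorem lieDeriv_bilin (Y : Lie n G) (b : V →L[ℝ] W →L[ℝ] U) {f : G → V} {h : G → W} {g : G}
    (hf : MDifferentiableAt (𝓡 n) 𝓘(ℝ, V) f g) (hh : MDifferentiableAt (𝓡 n) 𝓘(ℝ, W) h g) :
    lieDeriv Y (fun x => b (f x) (h x)) g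
      = b (lieDeriv Y f g) (h g) + b (f g) (lieDeriv Y h g) := by
  have h0 : HasMFDerivAt 𝓘(ℝ, V × W) 𝓘(ℝ, U) (fun p : V × W => b p.1 p.2)
      ((fun x => (f x, h x)) g) (b.isBoundedBilinearMap.deriv (f g, h g)) :=
    (b.isBoundedBilinearMap.hasFDerivAt (f g, h g)).hasMFDerivAt
  have h1 : HasMFDerivAt (𝓡 n) 𝓘(ℝ, V × W) (fun x => (f x, h x)) g
      (ContinuousLinearMap.prod (mfderiv (𝓡 n) 𝓘(ℝ, V) f g : EuclideanSpace ℝ (Fin n) →L[ℝ] V)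
        (mfderiv (𝓡 n) 𝓘(ℝ, W) h g : EuclideanSpace ℝ (Fin n) →L[ℝ] W)) :=
    ⟨hf.hasMFDerivAt.1.prodMk hh.hasMFDerivAt.1, hf.hasMFDerivAt.2.prodMk hh.hasMFDerivAt.2⟩
  have := (HasMFDerivAt.comp g h0 h1).mfderiv
  change mfderiv (𝓡 n) 𝓘(ℝ, U) ((fun p : V × W => b p.1 p.2) ∘ fun x => (f x, h x)) g _ = _
  rw [this]
  exact add_comm _ _

theorem lieDeriv_add_left (Y Z : Lie n G) (f : G → V) (g : G) :
    lieDeriv (Y + Z) f g = lieDeriv Y f g + lieDeriv Z f g := by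
  unfold lieDeriv
  rw [mulInvariantVectorField_add]
  exact map_add _ _ _

theorem lieDeriv_smul_left (c : ℝ) (Y : Lie n G) (f : G → V) (g : G) :
    lieDeriv (c • Y) f g = c • lieDeriv Y f g := by
  unfold lieDeriv
  rw [mulInvariantVectorField_smul]
  exact map_smul (mfderiv (𝓡 n) 𝓘(ℝ, V) f g) _ _

variable [LieGroup (𝓡 n) ∞ G]

theorem lieDeriv_eq_mfderiv_one (Y : Lie n G) {f : G → V} {g : G}
    (hf : MDifferentiableAt (𝓡 n) 𝓘(ℝ, V) f g) :
    lieDeriv Y f g = mfderiv (𝓡 n) 𝓘(ℝ, V) (fun x => f (g * x)) 1 Y := by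
  have h1 : MDifferentiableAt (𝓡 n) (𝓡 n) (fun x : G => g * x) 1 :=
    (contMDiff_mul_left (n := ∞)).mdifferentiable (by simp) 1
  have hf' : MDifferentiableAt (𝓡 n) 𝓘(ℝ, V) f (g * 1) := by rwa [mul_one]
  have := mfderiv_comp (I' := 𝓡 n) (1 : G) hf' h1
  change _ = mfderiv (𝓡 n) 𝓘(ℝ, V) (f ∘ fun x => g * x) 1 Y
  rw [this]
  exact (mfderiv_congr_apply f (mul_one g) _).symm

/-- The derivative at g is the tangent map of (x, y) ↦ f(xy) at (g, 1) applied to (0, Y), so it is a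
composite of smooth maps: zero section, constant section, tangent map, projection to the fibre. -/
theorem contMDiff_lieDeriv (Y : Lie n G) {f : G → V} (hf : ContMDiff (𝓡 n) 𝓘(ℝ, V) ∞ f) :
    ContMDiff (𝓡 n) 𝓘(ℝ, V) ∞ (lieDeriv Y f) := by
  let I := 𝓡 n
  let fg : G → TangentBundle I G := fun g ↦ Bundle.TotalSpace.mk' _ g 0
  have sfg : ContMDiff I I.tangent ∞ fg := Bundle.contMDiff_zeroSection ℝ _
  let fv : G → TangentBundle I G := fun _ ↦ Bundle.TotalSpace.mk' _ 1 Y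
  have sfv : ContMDiff I I.tangent ∞ fv := contMDiff_const
  let F₁ : G → (TangentBundle I G × TangentBundle I G) := fun g ↦ (fg g, fv g)
  have S₁ : ContMDiff I (I.tangent.prod I.tangent) ∞ F₁ := sfg.prodMk sfv
  let F₂ : (TangentBundle I G × TangentBundle I G) → TangentBundle (I.prod I) (G × G) :=
    (equivTangentBundleProd I G I G).symm
  have S₂ : ContMDiff (I.tangent.prod I.tangent) (I.prod I).tangent ∞ F₂ :=
    contMDiff_equivTangentBundleProd_symm
  let m : G × G → V := fun p => f (p.1 * p.2)
  have hm : ContMDiff (I.prod I) 𝓘(ℝ, V) ∞ m := hf.comp (contMDiff_mul I ∞)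
  have S₃ : ContMDiff (I.prod I).tangent 𝓘(ℝ, V).tangent ∞ (tangentMap (I.prod I) 𝓘(ℝ, V) m) :=
    hm.contMDiff_tangentMap (m := ∞) (by simp)
  have S := (contMDiff_snd_tangentBundle_modelSpace V 𝓘(ℝ, V) (n := ∞)).comp
    ((S₃.comp S₂).comp S₁)
  refine S.congr fun g => ?_
  have h2 := mfderiv_prod_eq_add_apply (I := I) (I' := I) (p := ((g, 1) : G × G)) (f := m)
    (v := ((0 : EuclideanSpace ℝ (Fin n)), (Y : EuclideanSpace ℝ (Fin n))))
    (hm.mdifferentiable (by simp) _)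
  rw [lieDeriv_eq_mfderiv_one Y (hf.mdifferentiable (by simp) g)]
  change _ = mfderiv (I.prod I) 𝓘(ℝ, V) m (g, 1) (0, Y)
  refine Eq.trans ?_ h2.symm
  erw [map_zero, zero_add]

/-- Comes from a g k · (k⁻¹ x k) = a (g x) k and the chain rule at x = 1: right translation rotates
left-invariant fields by Ad. -/
theorem lieDeriv_comp_mul (Y : Lie n G) (a k g : G) {f : G → V}
    (hf : MDifferentiable (𝓡 n) 𝓘(ℝ, V) f) :
    lieDeriv (Ad k⁻¹ Y) f (a * g * k) = lieDeriv Y (fun x => f (a * x * k)) g := by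
  have hR : ∀ b : G, MDifferentiable (𝓡 n) (𝓡 n) (fun x : G => x * b) := fun b =>
    (contMDiff_mul_right (n := ∞)).mdifferentiable (by simp)
  have hL : ∀ b : G, MDifferentiable (𝓡 n) (𝓡 n) (fun x : G => b * x) := fun b =>
    (contMDiff_mul_left (n := ∞)).mdifferentiable (by simp)
  have hm : MDifferentiable (𝓡 n) 𝓘(ℝ, V) (fun x => f (a * x * k)) :=
    hf.comp ((hR k).comp (hL a))
  have hc : MDifferentiable (𝓡 n) (𝓡 n) (fun x : G => k⁻¹ * x * k⁻¹⁻¹) :=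
    (hR _).comp (hL _)
  have h2 : MDifferentiable (𝓡 n) 𝓘(ℝ, V) (fun x => f (a * g * k * x)) := hf.comp (hL _)
  rw [lieDeriv_eq_mfderiv_one _ (hf _), lieDeriv_eq_mfderiv_one _ (hm g)]
  have := mfderiv_comp (I' := 𝓡 n) (1 : G) (h2 (k⁻¹ * 1 * k⁻¹⁻¹)) (hc 1)
  have e : (fun x => f (a * g * k * x)) ∘ (fun x : G => k⁻¹ * x * k⁻¹⁻¹)
      = fun x => f (a * (g * x) * k) := by
    ext x; simp only [Function.comp]; congr 1; group
  rw [e] at this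
  rw [this]
  exact (mfderiv_congr_apply (n := n) (fun x => f (a * g * k * x))
    (show k⁻¹ * 1 * k⁻¹⁻¹ = 1 by simp) _).symm

end LieDerivative

/-! ### The Lie bracket of vector fields as a commutator of derivations. -/

section Bracket

variable {n : ℕ} {G : Type*} [TopologicalSpace G] [ChartedSpace (EuclideanSpace ℝ (Fin n)) G]
  {V : Type*} [NormedAddCommGroup V] [NormedSpace ℝ V]

/-- The derivative of `f` along the vector field `W`. -/
def derivAlong (W : ∀ x : G, TangentSpace (𝓡 n) x) (f : G → V) (x : G) : V :=
  mfderiv (𝓡 n) 𝓘(ℝ, V) f x (W x)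

/-- The inverse chart has invertible differential, so pushing the pulled-back field forward again
recovers the field; the rest is the chain rule. -/
theorem fderiv_comp_extChartAt_symm [IsManifold (𝓡 n) 1 G] (x : G) {f : G → V}
    (W : ∀ x : G, TangentSpace (𝓡 n) x) {y : EuclideanSpace ℝ (Fin n)}
    (hy : y ∈ (extChartAt (𝓡 n) x).target)
    (hf : MDifferentiableAt (𝓡 n) 𝓘(ℝ, V) f ((extChartAt (𝓡 n) x).symm y)) :
    fderiv ℝ (f ∘ (extChartAt (𝓡 n) x).symm) y
      (VectorField.mpullbackWithin 𝓘(ℝ, EuclideanSpace ℝ (Fin n)) (𝓡 n)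
        (extChartAt (𝓡 n) x).symm W (Set.range (𝓡 n)) y)
      = mfderiv (𝓡 n) 𝓘(ℝ, V) f ((extChartAt (𝓡 n) x).symm y)
        (W ((extChartAt (𝓡 n) x).symm y)) := by
  have h1 := (contMDiffWithinAt_extChartAt_symm_range (n := 1) (I := 𝓡 n) x hy).mdifferentiableWithinAt
    (by simp)
  have h2 := isInvertible_mfderivWithin_extChartAt_symm (I := 𝓡 n) hy
  have hr : Set.range (𝓡 n) = Set.univ := by simp
  rw [VectorField.mpullbackWithin_apply]
  rw [hr] at h1 h2 ⊢
  rw [mfderivWithin_univ] at h2 ⊢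
  rw [mdifferentiableWithinAt_univ] at h1
  rw [← mfderiv_eq_fderiv]
  rw [mfderiv_comp (I' := 𝓡 n) y hf h1]
  obtain ⟨e, he⟩ := h2
  rw [← he, ContinuousLinearMap.inverse_equiv]
  exact congrArg (mfderiv (𝓡 n) 𝓘(ℝ, V) f _) (e.apply_symm_apply _)

/-- The manifold bracket is defined by transport from a chart, so the identity reduces to its vector
space version (symmetry of the second derivative of f in the chart). -/
theorem mfderiv_mlieBracket [IsManifold (𝓡 n) ∞ G] (x : G) {f : G → V}
    (hf : ContMDiff (𝓡 n) 𝓘(ℝ, V) ∞ f) {Y Z : ∀ x : G, TangentSpace (𝓡 n) x}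
    (hY : MDifferentiableAt (𝓡 n) (𝓡 n).tangent (fun x => (Y x : TangentBundle (𝓡 n) G)) x)
    (hZ : MDifferentiableAt (𝓡 n) (𝓡 n).tangent (fun x => (Z x : TangentBundle (𝓡 n) G)) x)
    (hYf : MDifferentiableAt (𝓡 n) 𝓘(ℝ, V) (derivAlong Y f) x)
    (hZf : MDifferentiableAt (𝓡 n) 𝓘(ℝ, V) (derivAlong Z f) x) :
    derivAlong (VectorField.mlieBracket (𝓡 n) Y Z) f x
      = derivAlong Y (derivAlong Z f) x - derivAlong Z (derivAlong Y f) x := by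
  have : IsManifold (𝓡 n) 2 G := IsManifold.of_le (n := ∞) (by norm_cast)
  have : IsManifold (𝓡 n) 1 G := IsManifold.of_le (n := ∞) (by norm_cast)
  let ch := extChartAt (𝓡 n) x
  let Y' : EuclideanSpace ℝ (Fin n) → EuclideanSpace ℝ (Fin n) := VectorField.mpullbackWithin 𝓘(ℝ, EuclideanSpace ℝ (Fin n)) (𝓡 n)
        ch.symm Y (Set.range (𝓡 n))
  let Z' : EuclideanSpace ℝ (Fin n) → EuclideanSpace ℝ (Fin n) := VectorField.mpullbackWithin 𝓘(ℝ, EuclideanSpace ℝ (Fin n)) (𝓡 n)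
        ch.symm Z (Set.range (𝓡 n))
  have hr : Set.range (𝓡 n) = Set.univ := by simp
  have hx : ch x ∈ ch.target := mem_extChartAt_target x
  have hxs : ch.symm (ch x) = x := extChartAt_to_inv x
  have hfd : MDifferentiable (𝓡 n) 𝓘(ℝ, V) f := hf.mdifferentiable (by simp)
  have hfs : ContDiffAt ℝ ∞ (f ∘ ch.symm) (ch x) := by
    rw [← contMDiffAt_iff_contDiffAt]
    have h0 := contMDiffWithinAt_extChartAt_symm_range (n := ∞) (I := 𝓡 n) x hx
    rw [hr, contMDiffWithinAt_univ] at h0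
    exact hf.contMDiffAt.comp _ h0
  have dY : DifferentiableAt ℝ Y' (ch x) := by
    have := MDifferentiableWithinAt.differentiableWithinAt_mpullbackWithin_vectorField
      (s := Set.univ) hY.mdifferentiableWithinAt
    rw [Set.preimage_univ, Set.univ_inter] at this
    exact this.differentiableAt (by simp)
  have dZ : DifferentiableAt ℝ Z' (ch x) := by
    have := MDifferentiableWithinAt.differentiableWithinAt_mpullbackWithin_vectorField
      (s := Set.univ) hZ.mdifferentiableWithinAt
    rw [Set.preimage_univ, Set.univ_inter] at this
    exact this.differentiableAt (by simp)
  have key := VectorField.fderiv_apply_lieBracket hfs (n := ∞)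
    (by rw [minSmoothness_of_isRCLikeNormedField]; norm_cast) dZ dY
  -- The inner derivatives are differentiated once more, so they must be identified near the point;
  -- for the outer ones the value at the point suffices.
  have ev : ∀ {h : G → V} (W : ∀ x : G, TangentSpace (𝓡 n) x),
      MDifferentiable (𝓡 n) 𝓘(ℝ, V) h →
      (fun y => fderiv ℝ (h ∘ ch.symm) y (VectorField.mpullbackWithin
        𝓘(ℝ, EuclideanSpace ℝ (Fin n)) (𝓡 n) ch.symm W (Set.range (𝓡 n)) y)) =ᶠ[nhds (ch x)]
      derivAlong W h ∘ ch.symm := by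
    intro h W hh
    filter_upwards [extChartAt_target_mem_nhds (I := 𝓡 n) x] with y hy
    exact fderiv_comp_extChartAt_symm x W hy (hh _)
  have at_x : ∀ {h : G → V} (W : ∀ x : G, TangentSpace (𝓡 n) x),
      MDifferentiableAt (𝓡 n) 𝓘(ℝ, V) h x →
      fderiv ℝ (h ∘ ch.symm) (ch x) (VectorField.mpullbackWithin
        𝓘(ℝ, EuclideanSpace ℝ (Fin n)) (𝓡 n) ch.symm W (Set.range (𝓡 n)) (ch x))
      = derivAlong W h x := by
    intro h W hh
    have := fderiv_comp_extChartAt_symm x W hx (f := h) (by rwa [hxs])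
    exact this.trans (congrArg (derivAlong W h) hxs)
  rw [(ev Z hfd).fderiv_eq, (ev Y hfd).fderiv_eq, at_x Y hZf, at_x Z hYf] at key
  rw [← key]
  let A : EuclideanSpace ℝ (Fin n) →L[ℝ] EuclideanSpace ℝ (Fin n) :=
    mfderiv (𝓡 n) 𝓘(ℝ, EuclideanSpace ℝ (Fin n)) ch x
  have e1 : (VectorField.mlieBracket (𝓡 n) Y Z x : EuclideanSpace ℝ (Fin n))
      = A.inverse (VectorField.lieBracket ℝ Y' Z' (ch x)) := by
    have : VectorField.lieBracketWithin ℝ Y' Z' (ch.symm ⁻¹' Set.univ ∩ Set.range (𝓡 n)) (ch x)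
        = VectorField.lieBracket ℝ Y' Z' (ch x) := by
      rw [Set.preimage_univ, Set.univ_inter, hr, VectorField.lieBracketWithin_univ]
    rw [← this]
    rfl
  have e2 : (fun z => (f ∘ ch.symm) (ch z)) =ᶠ[nhds x] f := by
    filter_upwards [extChartAt_source_mem_nhds (I := 𝓡 n) x] with z hz
    simp only [Function.comp]
    rw [ch.left_inv hz]
  have e3 : MDifferentiableAt (𝓡 n) 𝓘(ℝ, EuclideanSpace ℝ (Fin n)) ch x :=
    mdifferentiableAt_extChartAt (mem_chart_source _ x)
  let B : EuclideanSpace ℝ (Fin n) →L[ℝ] V := mfderiv (𝓡 n) 𝓘(ℝ, V) f x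
  have e4 : B      = (fderiv ℝ (f ∘ ch.symm) (ch x)).comp A := by
    have := mfderiv_comp (I' := 𝓘(ℝ, EuclideanSpace ℝ (Fin n))) x
      (hfs.differentiableAt (by simp)).mdifferentiableAt e3
    rw [mfderiv_eq_fderiv] at this
    exact (e2.mfderiv_eq (I := 𝓡 n) (I' := 𝓘(ℝ, V))).symm.trans this
  obtain ⟨e, he⟩ : A.IsInvertible :=
    isInvertible_mfderiv_extChartAt (I := 𝓡 n) (mem_extChartAt_source (I := 𝓡 n) x)
  change B (VectorField.mlieBracket (𝓡 n) Y Z x : EuclideanSpace ℝ (Fin n)) = _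
  rw [e4, e1, ← he, ContinuousLinearMap.inverse_equiv]
  exact congrArg _ (e.apply_symm_apply _)

end Bracket

/-! ### The bracket of 𝔤 and the adjoint action. -/

section Adjoint

variable {n : ℕ} {G : Type*} [TopologicalSpace G] [ChartedSpace (EuclideanSpace ℝ (Fin n)) G]
  [Group G] [LieGroup (𝓡 n) ∞ G] {V : Type*} [NormedAddCommGroup V] [NormedSpace ℝ V]

/-- The bracket of left-invariant fields is again left-invariant, so the general commutator formula
applies at every g. -/
theorem lieDeriv_lie (Y Z : Lie n G) {f : G → V} (hf : ContMDiff (𝓡 n) 𝓘(ℝ, V) ∞ f) (g : G) :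
    lieDeriv ⁅Y, Z⁆ f g = lieDeriv Y (lieDeriv Z f) g - lieDeriv Z (lieDeriv Y f) g := by
  have := mfderiv_mlieBracket g hf (Y := mulInvariantVectorField Y)
    (Z := mulInvariantVectorField Z) (mdifferentiableAt_mulInvariantVectorField Y)
    (mdifferentiableAt_mulInvariantVectorField Z)
    ((contMDiff_lieDeriv Y hf).mdifferentiable (by simp) g)
    ((contMDiff_lieDeriv Z hf).mdifferentiable (by simp) g)
  refine Eq.trans ?_ this
  unfold lieDeriv
  rw [GroupLieAlgebra.bracket_def, mulInvariantVector_mlieBracket]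
  rfl

theorem mdifferentiable_conj (k : G) :
    MDifferentiable (𝓡 n) (𝓡 n) (fun x : G => k * x * k⁻¹) :=
  ((contMDiff_mul_right (n := ∞)).mdifferentiable (by simp)).comp
    ((contMDiff_mul_left (n := ∞)).mdifferentiable (by simp))

theorem Ad_add (k : G) (Y Z : Lie n G) : Ad k (Y + Z) = Ad k Y + Ad k Z :=
  map_add (mfderiv (𝓡 n) (𝓡 n) (fun g : G => k * g * k⁻¹) 1) Y Z

theorem Ad_smul (k : G) (c : ℝ) (Y : Lie n G) : Ad k (c • Y) = c • Ad k Y :=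
  map_smul (mfderiv (𝓡 n) (𝓡 n) (fun g : G => k * g * k⁻¹) 1) c Y

theorem mfderiv_congr_point {f : G → G} {a b : G} (h : a = b) (w : EuclideanSpace ℝ (Fin n)) :
    (mfderiv (𝓡 n) (𝓡 n) f a w : EuclideanSpace ℝ (Fin n))
      = (mfderiv (𝓡 n) (𝓡 n) f b w : EuclideanSpace ℝ (Fin n)) := by
  subst h; rfl

theorem Ad_mul (a b : G) (Y : Lie n G) : Ad (a * b) Y = Ad a (Ad b Y) := by
  have := mfderiv_comp (I' := 𝓡 n) (1 : G) (mdifferentiable_conj (n := n) a (b * 1 * b⁻¹))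
    (mdifferentiable_conj (n := n) b 1)
  have e : (fun x => a * x * a⁻¹) ∘ (fun x : G => b * x * b⁻¹)
      = fun x => (a * b) * x * (a * b)⁻¹ := by
    ext x; simp only [Function.comp]; group
  rw [e] at this
  unfold Ad
  rw [this]
  exact (mfderiv_congr_point (n := n) (f := fun x : G => a * x * a⁻¹)
    (show b * 1 * b⁻¹ = 1 by simp) _)

theorem Ad_one (Y : Lie n G) : Ad (1 : G) Y = Y := by
  unfold Ad
  have : (fun g : G => 1 * g * 1⁻¹) = id := by ext; simp
  rw [this, mfderiv_id]
  rfl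

/-- The adjoint action of `k` as a linear automorphism of `𝔤`. -/
def AdEquiv (k : G) : Lie n G ≃ₗ[ℝ] Lie n G where
  toFun := Ad k
  invFun := Ad k⁻¹
  map_add' := Ad_add k
  map_smul' := Ad_smul k
  left_inv Y := by rw [← Ad_mul, inv_mul_cancel, Ad_one]
  right_inv Y := by rw [← Ad_mul, mul_inv_cancel, Ad_one]

theorem mulInvariantVectorField_at_one (Y : Lie n G) :
    (mulInvariantVectorField Y (1 : G) : EuclideanSpace ℝ (Fin n)) = Y := by
  unfold mulInvariantVectorField
  have : (fun g : G => 1 * g) = id := by ext; simp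
  rw [this, mfderiv_id]
  rfl

/-- Conjugation is a group automorphism: its inverse carries left translation by k⁻¹gk to left
translation by g, up to its own action at 1, so pull-back preserves left invariance and acts by Ad
on the value at 1. -/
theorem mpullback_conj (k : G) (Y : Lie n G) :
    VectorField.mpullback (𝓡 n) (𝓡 n) (fun x : G => k⁻¹ * x * k⁻¹⁻¹) (mulInvariantVectorField Y)
      = mulInvariantVectorField (Ad k Y) := by
  have hL : ∀ b : G, MDifferentiable (𝓡 n) (𝓡 n) (fun x : G => b * x) := fun b =>
    (contMDiff_mul_left (n := ∞)).mdifferentiable (by simp)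
  ext1 g
  let C : G → G := fun x => k⁻¹ * x * k⁻¹⁻¹
  let D : G → G := fun x => k * x * k⁻¹
  have hC : MDifferentiable (𝓡 n) (𝓡 n) C := mdifferentiable_conj k⁻¹
  have hD : MDifferentiable (𝓡 n) (𝓡 n) D := mdifferentiable_conj k
  have hDC : D ∘ C = id := by ext x; simp only [C, D, Function.comp, id]; group
  have hCD : C ∘ D = id := by ext x; simp only [C, D, Function.comp, id]; group
  let A : EuclideanSpace ℝ (Fin n) →L[ℝ] EuclideanSpace ℝ (Fin n) := mfderiv (𝓡 n) (𝓡 n) C g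
  let B : EuclideanSpace ℝ (Fin n) →L[ℝ] EuclideanSpace ℝ (Fin n) :=
    mfderiv (𝓡 n) (𝓡 n) D (C g)
  have hBA : B.comp A = ContinuousLinearMap.id ℝ _ := by
    have := mfderiv_comp (I' := 𝓡 n) g (hD (C g)) (hC g)
    rw [hDC, mfderiv_id] at this
    exact this.symm
  have hAB : A.comp B = ContinuousLinearMap.id ℝ _ := by
    have := mfderiv_comp (I' := 𝓡 n) (C g) (hC (D (C g))) (hD (C g))
    rw [hCD, mfderiv_id] at this
    ext1 w
    have h1 := mfderiv_congr_point (n := n) (f := C) (congrFun hDC g).symm (B w)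
    exact h1.trans (congrArg (fun T : EuclideanSpace ℝ (Fin n) →L[ℝ] EuclideanSpace ℝ (Fin n) =>
      T w) this.symm)
  have hinv : A.inverse = B := ContinuousLinearMap.inverse_eq hAB hBA
  have h1 := mfderiv_comp (I' := 𝓡 n) (1 : G) (hD (C g * 1)) (hL (C g) 1)
  have h2 := mfderiv_comp (I' := 𝓡 n) (1 : G) (hL g (D 1)) (hD 1)
  have e : D ∘ (fun x => C g * x) = (fun x => g * x) ∘ D := by
    ext x; simp only [C, D, Function.comp]; group
  have h3 : B (mulInvariantVectorField Y (C g)) = (mulInvariantVectorField (Ad k Y) g :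
      EuclideanSpace ℝ (Fin n)) := by
    have h4 := mfderiv_congr_point (n := n) (f := D) (mul_one (C g)).symm
      (mulInvariantVectorField Y (C g))
    have h5 := mfderiv_congr_point (n := n) (f := fun x => g * x)
      (show D 1 = 1 by simp [D]) (Ad k Y)
    refine h4.trans (Eq.trans ?_ h5)
    rw [e] at h1
    exact congrArg (fun T : EuclideanSpace ℝ (Fin n) →L[ℝ] EuclideanSpace ℝ (Fin n) =>
      T Y) (h1.symm.trans h2)
  exact (congrArg (fun T : EuclideanSpace ℝ (Fin n) →L[ℝ] EuclideanSpace ℝ (Fin n) =>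
      T (mulInvariantVectorField Y (C g))) hinv).trans h3

/-- Pull-back by a diffeomorphism commutes with brackets of fields; evaluate at 1 for conjugation.
-/
theorem Ad_lie (k : G) (Y Z : Lie n G) : Ad k ⁅Y, Z⁆ = ⁅Ad k Y, Ad k Z⁆ := by
  have hc : ContMDiff (𝓡 n) (𝓡 n) ∞ (fun x : G => k⁻¹ * x * k⁻¹⁻¹) :=
    (contMDiff_mul_right (n := ∞)).comp (contMDiff_mul_left (n := ∞))
  have : IsManifold (𝓡 n) (minSmoothness ℝ 3) G := inferInstance
  have := VectorField.mpullback_mlieBracket (x₀ := (1 : G)) (n := ∞)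
    (mdifferentiableAt_mulInvariantVectorField Y) (mdifferentiableAt_mulInvariantVectorField Z)
    hc.contMDiffAt (by rw [minSmoothness_of_isRCLikeNormedField]; norm_cast)
  rw [mpullback_conj, mpullback_conj,
    ← mulInvariantVector_mlieBracket, mpullback_conj] at this
  rw [GroupLieAlgebra.bracket_def, GroupLieAlgebra.bracket_def, ← this]
  exact (mulInvariantVectorField_at_one _).symm

theorem lieDeriv_one (Y : Lie n G) (f : G → V) :
    lieDeriv Y f 1 = mfderiv (𝓡 n) 𝓘(ℝ, V) f 1 Y :=
  congrArg (mfderiv (𝓡 n) 𝓘(ℝ, V) f 1 : EuclideanSpace ℝ (Fin n) →L[ℝ] V)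
    (mulInvariantVectorField_at_one Y)

end Adjoint

/-! ### The differential of a smooth representation. -/

section Rep

variable {n : ℕ} {G : Type*} [TopologicalSpace G] [ChartedSpace (EuclideanSpace ℝ (Fin n)) G]
  [Group G] [LieGroup (𝓡 n) ∞ G] {F : Type*} [NormedAddCommGroup F] [InnerProductSpace ℝ F]
  [FiniteDimensional ℝ F] {π₁ : Representation ℝ G F}
  (hπ₁ : ∀ u : F, ContMDiff (𝓡 n) 𝓘(ℝ, F) ∞ (fun g => π₁ g u))
include hπ₁

theorem lieDeriv_rep (Y : Lie n G) (u : F) (g : G) :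
    lieDeriv Y (fun x => π₁ x u) g = π₁ g (dRep π₁ Y u) := by
  have h := lieDeriv_comp_mul Y g 1 1 ((hπ₁ u).mdifferentiable (by simp))
  have e : (fun x => π₁ (g * x * 1) u) = fun x => (π₁ g).toContinuousLinearMap (π₁ x u) := by
    ext x; simp
  rw [e, lieDeriv_clm_comp Y _ ((hπ₁ u).mdifferentiable (by simp) 1), lieDeriv_one] at h
  simp only [mul_one, inv_one, Ad_one] at h
  exact h

theorem lieDeriv_rep_one (Y : Lie n G) (u : F) :
    lieDeriv Y (fun x => π₁ x u) 1 = dRep π₁ Y u :=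
  lieDeriv_one Y _

theorem dRep_add_right (Y : Lie n G) (u w : F) :
    dRep π₁ Y (u + w) = dRep π₁ Y u + dRep π₁ Y w := by
  simp only [← lieDeriv_rep_one hπ₁, map_add]
  exact lieDeriv_add Y ((hπ₁ u).mdifferentiable (by simp) 1) ((hπ₁ w).mdifferentiable (by simp) 1)

theorem dRep_smul_right (Y : Lie n G) (c : ℝ) (u : F) :
    dRep π₁ Y (c • u) = c • dRep π₁ Y u := by
  simp only [← lieDeriv_rep_one hπ₁, map_smul]
  exact lieDeriv_smul_const Y c ((hπ₁ u).mdifferentiable (by simp) 1)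

/-- Apply the commutator formula to x ↦ π₁(x)u at 1: a left-invariant derivative of this orbit map
is the orbit map of the differentiated vector. -/
theorem dRep_lie (Y Z : Lie n G) (u : F) :
    dRep π₁ ⁅Y, Z⁆ u = dRep π₁ Y (dRep π₁ Z u) - dRep π₁ Z (dRep π₁ Y u) := by
  rw [← lieDeriv_rep_one hπ₁, lieDeriv_lie Y Z (hπ₁ u)]
  have : ∀ Y, lieDeriv Y (fun x => π₁ x u) = fun x => π₁ x (dRep π₁ Y u) := fun Y => by
    ext x; exact lieDeriv_rep hπ₁ Y u x
  rw [this, this, lieDeriv_rep_one hπ₁, lieDeriv_rep_one hπ₁]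

/-- Differentiate π₁(k⁻¹xk) π₁(k⁻¹)u = π₁(k⁻¹) π₁(x)u at x = 1. -/
theorem dRep_Ad (k : G) (Y : Lie n G) (u : F) :
    dRep π₁ (Ad k⁻¹ Y) (π₁ k⁻¹ u) = π₁ k⁻¹ (dRep π₁ Y u) := by
  have h := lieDeriv_comp_mul Y k⁻¹ k 1 ((hπ₁ (π₁ k⁻¹ u)).mdifferentiable (by simp))
  have e : (fun x => π₁ (k⁻¹ * x * k) (π₁ k⁻¹ u)) = fun x => (π₁ k⁻¹).toContinuousLinearMap
      (π₁ x u) := by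
    ext x
    simp only [LinearMap.coe_toContinuousLinearMap', ← Module.End.mul_apply, ← map_mul]
    congr 2; group
  rw [e, lieDeriv_clm_comp Y _ ((hπ₁ u).mdifferentiable (by simp) 1), lieDeriv_rep_one hπ₁] at h
  have e1 : k⁻¹ * 1 * k = 1 := by simp
  rw [e1, lieDeriv_rep_one hπ₁] at h
  exact h

theorem dRep_add_left (Y Z : Lie n G) (u : F) :
    dRep π₁ (Y + Z) u = dRep π₁ Y u + dRep π₁ Z u := by
  simp only [← lieDeriv_rep_one hπ₁]; exact lieDeriv_add_left Y Z _ _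

theorem dRep_smul_left (c : ℝ) (Y : Lie n G) (u : F) :
    dRep π₁ (c • Y) u = c • dRep π₁ Y u := by
  simp only [← lieDeriv_rep_one hπ₁]; exact lieDeriv_smul_left c Y _ _

end Rep

/-! ### Ad(K) acts orthogonally on 𝔭. -/

section Cartan

variable {n N m : ℕ} {G : Type*} [TopologicalSpace G] [ChartedSpace (EuclideanSpace ℝ (Fin n)) G]
  [Group G] [LieGroup (𝓡 n) ∞ G] {K : Subgroup G} {𝔨 𝔭 : Submodule ℝ (Lie n G)}
  {X : Basis (Fin N ⊕ Fin m) ℝ (Lie n G)}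

theorem IsCartanBasis.eq_sum (Y : Lie n G) :
    Y = ∑ i, X.repr Y (Sum.inl i) • X (Sum.inl i) + ∑ a, X.repr Y (Sum.inr a) • X (Sum.inr a) := by
  conv_lhs => rw [← X.sum_repr Y, Fintype.sum_sum_type]

theorem IsCartanBasis.repr_inl_of_mem_k (hkp : IsCartanDecomposition 𝔨 𝔭)
    (hX : IsCartanBasis 𝔨 𝔭 X) {Y : Lie n G} (hY : Y ∈ 𝔨) (i : Fin N) :
    X.repr Y (Sum.inl i) = 0 := by
  have h1 : ∑ i, X.repr Y (Sum.inl i) • X (Sum.inl i) ∈ 𝔭 :=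
    Submodule.sum_mem _ fun i _ => Submodule.smul_mem _ _ (hX.mem_p i)
  have h2 : ∑ i, X.repr Y (Sum.inl i) • X (Sum.inl i) ∈ 𝔨 := by
    rw [eq_sub_of_add_eq (IsCartanBasis.eq_sum (X := X) Y).symm]
    exact Submodule.sub_mem _ hY
      (Submodule.sum_mem _ fun i _ => Submodule.smul_mem _ _ (hX.mem_k i))
  have h3 := Submodule.disjoint_def.mp hkp.isCompl.disjoint _ h2 h1
  have h4 := (Fintype.linearIndependent_iff.mp (X.linearIndependent.comp _ Sum.inl_injective))
    (fun i => X.repr Y (Sum.inl i)) h3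
  exact h4 i

theorem IsCartanBasis.repr_inr_of_mem_p (hkp : IsCartanDecomposition 𝔨 𝔭)
    (hX : IsCartanBasis 𝔨 𝔭 X) {Y : Lie n G} (hY : Y ∈ 𝔭) (a : Fin m) :
    X.repr Y (Sum.inr a) = 0 := by
  have h1 : ∑ i, X.repr Y (Sum.inr i) • X (Sum.inr i) ∈ 𝔨 :=
    Submodule.sum_mem _ fun i _ => Submodule.smul_mem _ _ (hX.mem_k i)
  have h2 : ∑ i, X.repr Y (Sum.inr i) • X (Sum.inr i) ∈ 𝔭 := by
    rw [eq_sub_of_add_eq' (IsCartanBasis.eq_sum (X := X) Y).symm]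
    exact Submodule.sub_mem _ hY
      (Submodule.sum_mem _ fun i _ => Submodule.smul_mem _ _ (hX.mem_p i))
  have h3 := Submodule.disjoint_def.mp hkp.isCompl.disjoint _ h1 h2
  have h4 := (Fintype.linearIndependent_iff.mp (X.linearIndependent.comp _ Sum.inr_injective))
    (fun i => X.repr Y (Sum.inr i)) h3
  exact h4 a

theorem IsCartanBasis.eq_sum_of_mem_p (hkp : IsCartanDecomposition 𝔨 𝔭)
    (hX : IsCartanBasis 𝔨 𝔭 X) {Y : Lie n G} (hY : Y ∈ 𝔭) :
    Y = ∑ i, X.repr Y (Sum.inl i) • X (Sum.inl i) := by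
  conv_lhs => rw [IsCartanBasis.eq_sum (X := X) Y]
  simp [hX.repr_inr_of_mem_p hkp hY]

theorem IsCartanBasis.horProj_inl (i : Fin N) : horProj X (X (Sum.inl i)) = X (Sum.inl i) := by
  simp [horProj, Finsupp.single_apply]

/-- For Y in 𝔨 and Z in 𝔭, ad Y ∘ ad Z exchanges 𝔨 and 𝔭, so its diagonal in an adapted basis
vanishes, and with it the trace. -/
theorem IsCartanBasis.killingForm_eq_zero (hkp : IsCartanDecomposition 𝔨 𝔭)
    (hX : IsCartanBasis 𝔨 𝔭 X) {Y Z : Lie n G} (hY : Y ∈ 𝔨) (hZ : Z ∈ 𝔭) :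
    killingForm ℝ (Lie n G) Y Z = 0 := by
  rw [killingForm_apply_apply, LinearMap.trace_eq_matrix_trace ℝ X, Matrix.trace]
  refine Finset.sum_eq_zero fun j _ => ?_
  rw [Matrix.diag_apply, LinearMap.toMatrix_apply]
  simp only [LinearMap.comp_apply, LieAlgebra.ad_apply]
  have hsk : ∀ W ∈ 𝔨, ⁅Z, W⁆ ∈ 𝔭 := fun W hW => by
    rw [← lie_skew]; exact Submodule.neg_mem _ (hkp.lie_kp _ hW _ hZ)
  rcases j with i | a
  · exact hX.repr_inl_of_mem_k hkp (hkp.lie_kk _ hY _ (hkp.lie_pp _ hZ _ (hX.mem_p i))) i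
  · exact hX.repr_inr_of_mem_p hkp (hkp.lie_kp _ hY _ (hsk _ (hX.mem_k a))) a

/-- The adjoint action of `k` as a Lie algebra automorphism of `𝔤`. -/
def AdLieEquiv (k : G) : Lie n G ≃ₗ⁅ℝ⁆ Lie n G :=
  { AdEquiv (n := n) k with map_lie' := fun {Y Z} => Ad_lie k Y Z }

theorem killingForm_Ad (k : G) (Y Z : Lie n G) :
    killingForm ℝ (Lie n G) (Ad k Y) (Ad k Z) = killingForm ℝ (Lie n G) Y Z :=
  LieAlgebra.killingForm_of_equiv_apply (AdLieEquiv (n := n) k) Y Z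

/-- Conjugating a one-parameter subgroup of K by k gives another one, with rotated initial velocity.
-/
theorem IsLieAlgebraOf.Ad_mem (hK : IsLieAlgebraOf 𝔨 K) {k : G} (hk : k ∈ K) {Y : Lie n G}
    (hY : Y ∈ 𝔨) : Ad k Y ∈ 𝔨 := by
  obtain ⟨c, hc, hadd, hmem, hd⟩ := (hK Y).mp hY
  have c0 : c 0 = 1 := by simpa using hadd 0 0
  have hconj : ContMDiff (𝓡 n) (𝓡 n) ∞ (fun x : G => k * x * k⁻¹) :=
    (contMDiff_mul_right (n := ∞)).comp (contMDiff_mul_left (n := ∞))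
  refine (hK _).mpr ⟨fun t => k * c t * k⁻¹, hconj.comp hc, fun s t => ?_, fun t => ?_, ?_⟩
  · simp only [hadd]; group
  · exact K.mul_mem (K.mul_mem hk (hmem t)) (K.inv_mem hk)
  · have := mfderiv_comp (I' := 𝓡 n) (0 : ℝ) (mdifferentiable_conj (n := n) k (c 0))
      (hc.mdifferentiable (by simp) 0)
    have h1 := mfderiv_congr_point (n := n) (f := fun x : G => k * x * k⁻¹) c0 Y
    refine (congrArg (fun T : ℝ →L[ℝ] EuclideanSpace ℝ (Fin n) => T 1) this).trans ?_
    refine Eq.trans ?_ h1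
    exact congrArg (mfderiv (𝓡 n) (𝓡 n) (fun x : G => k * x * k⁻¹) (c 0) :
      EuclideanSpace ℝ (Fin n) →L[ℝ] EuclideanSpace ℝ (Fin n)) hd

/-- Ad k preserves the Killing form and 𝔨, so Ad k Z is orthogonal to 𝔨. Its 𝔨-component is then
orthogonal to itself, hence zero by negative definiteness. -/
theorem IsCartanBasis.Ad_mem_p (hK : IsLieAlgebraOf 𝔨 K) (hkp : IsCartanDecomposition 𝔨 𝔭)
    (hX : IsCartanBasis 𝔨 𝔭 X) {k : G} (hk : k ∈ K) {Z : Lie n G} (hZ : Z ∈ 𝔭) :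
    Ad k Z ∈ 𝔭 := by
  obtain ⟨A, hA, B, hB, hAB⟩ := Submodule.mem_sup.mp
    (show Ad k Z ∈ 𝔨 ⊔ 𝔭 by rw [hkp.isCompl.sup_eq_top]; trivial)
  have h1 : killingForm ℝ (Lie n G) A (Ad k Z) = 0 := by
    rw [← killingForm_Ad k⁻¹, ← Ad_mul, inv_mul_cancel, Ad_one]
    exact hX.killingForm_eq_zero hkp (hK.Ad_mem (K.inv_mem hk) hA) hZ
  have h2 : killingForm ℝ (Lie n G) A A = 0 := by
    rw [← hAB, map_add, hX.killingForm_eq_zero hkp hA hB, add_zero] at h1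
    exact h1
  have h3 : A = 0 := by
    by_contra h
    exact absurd h2 (hkp.neg_def A hA h).ne
  rw [← hAB, h3, zero_add]; exact hB

theorem IsCartanBasis.exists_orthogonal (hK : IsLieAlgebraOf 𝔨 K)
    (hkp : IsCartanDecomposition 𝔨 𝔭) (hX : IsCartanBasis 𝔨 𝔭 X) {k : G} (hk : k ∈ K) :
    ∃ O : Matrix (Fin N) (Fin N) ℝ, O.transpose * O = 1 ∧
      ∀ i, Ad k (X (Sum.inl i)) = ∑ j, O i j • X (Sum.inl j) := by
  let O : Matrix (Fin N) (Fin N) ℝ := Matrix.of fun i j =>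
    X.repr (Ad k (X (Sum.inl i))) (Sum.inl j)
  have hO : ∀ i, Ad k (X (Sum.inl i)) = ∑ j, O i j • X (Sum.inl j) := fun i =>
    hX.eq_sum_of_mem_p hkp (hX.Ad_mem_p hK hkp hk (hX.mem_p i))
  refine ⟨O, mul_eq_one_comm.mp ?_, hO⟩
  ext i i'
  have h := killingForm_Ad k (X (Sum.inl i)) (X (Sum.inl i'))
  rw [hO, hO, hX.orthonormal_p] at h
  simp only [map_sum, map_smul, LinearMap.sum_apply, LinearMap.smul_apply, hX.orthonormal_p,
    smul_eq_mul, mul_ite, mul_one, mul_zero] at h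
  rw [Matrix.one_apply, ← h, Matrix.mul_apply]
  simp [Matrix.transpose_apply, mul_comm]

end Cartan

/-! ### Levi-Civita symbols: the basic contraction. -/

section LeviCivita

open Equiv

variable {N : ℕ} {E : Type*} [AddCommGroup E] [Module ℝ E]

/-- The Levi-Civita symbol of a map of `{1, …, N}` to itself. -/
def leviCivita (V : Fin N → Fin N) : ℝ :=
  (Matrix.of fun i j : Fin N => if V i = j then (1 : ℝ) else 0).det

theorem leviCivita_comp_perm (V : Fin N → Fin N) (σ : Perm (Fin N)) :
    leviCivita (V ∘ σ) = (Perm.sign σ : ℤ) * leviCivita V :=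
  Matrix.det_permute σ (Matrix.of fun i j : Fin N => if V i = j then (1 : ℝ) else 0)

theorem leviCivita_eq_zero {V : Fin N → Fin N} (h : ¬ Function.Injective V) :
    leviCivita V = 0 := by
  simp only [Function.Injective, not_forall] at h
  obtain ⟨i, j, hij, hne⟩ := h
  exact Matrix.det_zero_of_row_eq hne (by ext; simp [hij])

theorem leviCivita_perm (σ : Perm (Fin N)) : leviCivita σ = (Perm.sign σ : ℤ) := by
  have h : leviCivita (id : Fin N → Fin N) = 1 := by
    rw [leviCivita, ← Matrix.det_one (n := Fin N)]
    congr 1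
    ext i j; simp [Matrix.one_apply]
  have := leviCivita_comp_perm id σ
  rwa [h, mul_one] at this

/-- Alternating families indexed by tuples. -/
structure IsAlt {r : ℕ} {ι : Type*} (w : (Fin r → ι) → E) : Prop where
  perm : ∀ I (σ : Perm (Fin r)), w (I ∘ σ) = (Perm.sign σ : ℤ) • w I
  zero : ∀ I, ¬ Function.Injective I → w I = 0

theorem sign_mul_self (σ : Perm (Fin N)) : ((Perm.sign σ : ℤ) : ℝ) * (Perm.sign σ : ℤ) = 1 := by
  norm_cast; simp

/-- If P is a permutation whose first block is K, the nonzero terms are exactly V = P ∘ (σ ⊕ τ).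
Each equals w K because the signs of P, σ and τ all occur squared, and there are r! q! of them. -/
theorem leviCivita_contraction {r q : ℕ} {w : (Fin r → Fin (r + q)) → E} (hw : IsAlt w)
    (K : Fin r → Fin (r + q)) :
    ∑ V : Fin (r + q) → Fin (r + q), (leviCivita V *
      leviCivita (Fin.append K (V ∘ Fin.natAdd r))) • w (V ∘ Fin.castAdd q)
      = ((r ! * q ! : ℕ) : ℝ) • w K := by
  by_cases hK : Function.Injective K
  swap
  · rw [hw.zero K hK, smul_zero]
    refine Finset.sum_eq_zero fun V _ => ?_
    rw [leviCivita_eq_zero (V := Fin.append _ _), mul_zero, zero_smul]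
    intro h
    apply hK
    intro a b hab
    have := @h (Fin.castAdd q a) (Fin.castAdd q b) (by simpa using hab)
    simpa using this
  obtain ⟨P, hP⟩ : ∃ P : Perm (Fin (r + q)), P ∘ Fin.castAdd q = K := by
    let e : Set.range (Fin.castAdd (n := r) q) ≃ Set.range K :=
      (Equiv.ofInjective _ (Fin.castAdd_injective r q)).symm.trans (Equiv.ofInjective K hK)
    refine ⟨e.extendSubtype, funext fun a => ?_⟩
    rw [Function.comp_apply, Equiv.extendSubtype_apply_of_mem e _ ⟨a, rfl⟩]
    simp only [e, Equiv.trans_apply]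
    rw [show (⟨Fin.castAdd q a, ⟨a, rfl⟩⟩ : Set.range (Fin.castAdd (n := r) q))
      = Equiv.ofInjective _ (Fin.castAdd_injective r q) a from rfl, Equiv.symm_apply_apply]
    rfl
  let e : Perm (Fin r) × Perm (Fin q) → (Fin (r + q) → Fin (r + q)) := fun s =>
    P ∘ (finSumFinEquiv.permCongr (Perm.sumCongr s.1 s.2))
  have he : Function.Injective e := by
    intro s t hst
    have h1 : Perm.sumCongr s.1 s.2 = Perm.sumCongr t.1 t.2 := by
      apply (finSumFinEquiv (m := r) (n := q)).permCongr.injective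
      apply Equiv.coe_fn_injective
      exact P.injective.comp_left hst
    have := Perm.sumCongrHom_injective (a₁ := s) (a₂ := t) h1
    exact this
  have hsum := Fintype.sum_of_injective e he (fun _ => w K) (fun V => (leviCivita V *
      leviCivita (Fin.append K (V ∘ Fin.natAdd r))) • w (V ∘ Fin.castAdd q)) ?_ ?_
  · rw [← hsum]
    simp [Fintype.card_prod, Fintype.card_perm, ← Nat.cast_smul_eq_nsmul ℝ]
  -- Both symbols being nonzero makes V, and K joined with the second block of V, permutations; so
  -- P⁻¹V preserves the second block and splits as σ ⊕ τ.
  · intro V hV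
    by_contra hne
    apply hV
    have hVi : Function.Injective V := by
      by_contra h
      simp [leviCivita_eq_zero h] at hne
    have hKV : Function.Injective (Fin.append K (V ∘ Fin.natAdd r)) := by
      by_contra h
      simp [leviCivita_eq_zero h] at hne
    let Vp : Perm (Fin (r + q)) := Equiv.ofBijective V (Finite.injective_iff_bijective.mp hVi)
    let Q : Perm (Fin r ⊕ Fin q) := finSumFinEquiv.symm.permCongr (P⁻¹ * Vp)
    have hQ : Set.MapsTo Q (Set.range Sum.inr) (Set.range Sum.inr) := by
      rintro _ ⟨b, rfl⟩
      rcases hc : Q (Sum.inr b) with a | b'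
      · exfalso
        have h1 : (P⁻¹ * Vp) (Fin.natAdd r b) = Fin.castAdd q a := by
          have := congrArg finSumFinEquiv hc
          simpa [Q, Equiv.permCongr_apply] using this
        -- Otherwise a value of K reappears in the second block of V, which kills the second symbol.
        have h2 : V (Fin.natAdd r b) = K a := by
          rw [← hP]
          have := congrArg P h1
          simpa [Vp] using this
        have := @hKV (Fin.natAdd r b) (Fin.castAdd q a) (by simpa using h2)
        have := congrArg Fin.val this
        simp at this
        omega
      · exact ⟨b', rfl⟩
    obtain ⟨s, hs⟩ := Perm.mem_sumCongrHom_range_of_perm_mapsTo_inl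
      ((Perm.perm_mapsTo_inl_iff_mapsTo_inr Q).mpr hQ)
    refine ⟨s, ?_⟩
    have h3 : finSumFinEquiv.permCongr (Perm.sumCongr s.1 s.2) = P⁻¹ * Vp := by
      have : Perm.sumCongr s.1 s.2 = Q := hs
      rw [this]
      ext; simp [Q]
    simp only [e, h3]
    ext x; simp [Vp]
  · rintro ⟨σ, τ⟩
    let T : Perm (Fin (r + q)) := finSumFinEquiv.permCongr (Perm.sumCongr σ τ)
    let T' : Perm (Fin (r + q)) := finSumFinEquiv.permCongr (Perm.sumCongr 1 τ)
    have h1 : leviCivita (e (σ, τ)) = (Perm.sign P : ℤ) * ((Perm.sign σ : ℤ) * (Perm.sign τ : ℤ)) := by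
      have : e (σ, τ) = ((P * T : Perm (Fin (r + q))) : Fin (r + q) → Fin (r + q)) := rfl
      rw [this, leviCivita_perm]
      simp [T, Perm.sign_mul]
    have h2 : leviCivita (Fin.append K (e (σ, τ) ∘ Fin.natAdd r))
        = (Perm.sign P : ℤ) * (Perm.sign τ : ℤ) := by
      have : Fin.append K (e (σ, τ) ∘ Fin.natAdd r)
          = ((P * T' : Perm (Fin (r + q))) : Fin (r + q) → Fin (r + q)) := by
        rw [← hP]
        ext x
        refine Fin.addCases (fun a => ?_) (fun b => ?_) x
        · simp [T', Equiv.permCongr_apply]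
        · simp [T', e, Equiv.permCongr_apply]
      rw [this, leviCivita_perm]
      simp [T', Perm.sign_mul]
    have h3 : e (σ, τ) ∘ Fin.castAdd q = K ∘ σ := by
      rw [← hP]
      ext x
      simp [e, Equiv.permCongr_apply]
    rw [h1, h2, h3, hw.perm, ← Int.cast_smul_eq_zsmul ℝ, smul_smul]
    have e1 := sign_mul_self P
    have e2 := sign_mul_self σ
    have e3 := sign_mul_self τ
    have : ((Perm.sign P : ℤ) : ℝ) * (((Perm.sign σ : ℤ) : ℝ) * ((Perm.sign τ : ℤ) : ℝ)) *
        (((Perm.sign P : ℤ) : ℝ) * ((Perm.sign τ : ℤ) : ℝ)) * ((Perm.sign σ : ℤ) : ℝ) = 1 := by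
      linear_combination (((Perm.sign σ : ℤ) : ℝ) * (Perm.sign σ : ℤ)) *
        (((Perm.sign τ : ℤ) : ℝ) * (Perm.sign τ : ℤ)) * e1 +
        (((Perm.sign τ : ℤ) : ℝ) * (Perm.sign τ : ℤ)) * e2 + e3
    rw [this, one_smul]

end LeviCivita

/-! ### Symbols of concatenated tuples, and the contraction behind the codifferential. -/

section LeviCivita

open Equiv

variable {N : ℕ} {E : Type*} [AddCommGroup E] [Module ℝ E]

/-- The Levi-Civita symbol of the concatenation of `I` and `J`. -/
def leviCivita₂ {r q : ℕ} (h : r + q = N) (I : Fin r → Fin N) (J : Fin q → Fin N) : ℝ :=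
  leviCivita (fun a => Fin.append I J (Fin.cast h.symm a))

theorem leviCivita₂_comp_left {r q : ℕ} (h : r + q = N) (I : Fin r → Fin N) (J : Fin q → Fin N)
    (σ : Perm (Fin r)) : leviCivita₂ h (I ∘ σ) J = (Perm.sign σ : ℤ) * leviCivita₂ h I J := by
  subst h
  have := leviCivita_comp_perm (Fin.append I J) (finSumFinEquiv.permCongr (Perm.sumCongr σ 1))
  have e : Fin.append I J ∘ (finSumFinEquiv.permCongr (Perm.sumCongr σ 1))
      = Fin.append (I ∘ σ) J := by
    ext x
    refine Fin.addCases (fun a => ?_) (fun b => ?_) x <;> simp [Equiv.permCongr_apply]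
  rw [e] at this
  simpa [leviCivita₂] using this

theorem leviCivita₂_insertNth {r q : ℕ} (h : (r + 1) + q = N) (i : Fin (r + 1)) (j : Fin N)
    (I : Fin r → Fin N) (J : Fin q → Fin N) :
    leviCivita₂ h (i.insertNth j I) J = (-1) ^ (i : ℕ) * leviCivita₂ h (Fin.cons j I) J := by
  have := leviCivita₂_comp_left h (Fin.cons j I) J (Fin.cycleRange i)
  rw [Fin.cons_comp_cycleRange] at this
  rw [this]; simp

theorem finRotate_pow_val (n k : ℕ) (i : Fin (n + 1)) :
    (((finRotate (n + 1)) ^ k) i : ℕ) = (i + k) % (n + 1) := by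
  induction k with
  | zero => simp [Nat.mod_eq_of_lt i.2]
  | succ k ih =>
    rw [pow_succ', Perm.mul_apply, finRotate_apply, Fin.val_add, ih]
    simp [Nat.add_mod, ← add_assoc]

/-- Swapping the blocks is the r-th power of the N-cycle, of sign (-1)^((N-1)r). -/
theorem leviCivita₂_comm {r q : ℕ} (h : r + q = N) (h' : q + r = N) (I : Fin r → Fin N)
    (J : Fin q → Fin N) :
    leviCivita₂ h' J I = (-1) ^ (r * q) * leviCivita₂ h I J := by
  rcases N with _ | M
  · obtain rfl : r = 0 := by omega
    obtain rfl : q = 0 := by omega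
    simp only [leviCivita₂, zero_mul, pow_zero, one_mul]
    congr 1; ext a; exact a.elim0
  have e : (fun a => Fin.append J I (Fin.cast h'.symm a))
      = (fun a => Fin.append I J (Fin.cast h.symm a)) ∘ ((finRotate (M + 1)) ^ r : Perm _) := by
    funext a
    obtain ⟨b, rfl⟩ : ∃ b, Fin.cast h' b = a := ⟨Fin.cast h'.symm a, rfl⟩
    refine Fin.addCases (fun b => ?_) (fun b => ?_) b
    · have : ((finRotate (M + 1)) ^ r : Perm _) (Fin.cast h' (Fin.castAdd r b))
          = Fin.cast h (Fin.natAdd r b) := by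
        ext
        rw [finRotate_pow_val, Nat.mod_eq_of_lt] <;> simp <;> omega
      simp [this]
    · have : ((finRotate (M + 1)) ^ r : Perm _) (Fin.cast h' (Fin.natAdd q b))
          = Fin.cast h (Fin.castAdd q b) := by
        ext
        rw [finRotate_pow_val]
        simp only [Fin.val_cast, Fin.val_natAdd, Fin.val_castAdd]
        rw [show q + (b : ℕ) + r = b + (M + 1) by omega, Nat.add_mod_right, Nat.mod_eq_of_lt]
        omega
      simp [this]
  rw [leviCivita₂, e, leviCivita_comp_perm]
  congr 1
  rw [map_pow, sign_finRotate]
  push_cast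
  rw [← pow_mul]
  rcases r with _ | s
  · simp
  -- With r = s + 1 and N = M + 1, the exponents Mr and rq differ by s(s+1), which is even.
  · have h1 : M * (s + 1) = (s + 1) * q + s * (s + 1) := by
      rw [show M = s + q by omega]; ring
    rw [h1, pow_add, (Nat.even_mul_succ_self s).neg_one_pow, mul_one]

theorem leviCivita₂_contraction {r q : ℕ} (h : r + q = N) {w : (Fin r → Fin N) → E}
    (hw : IsAlt w) (K : Fin r → Fin N) :
    ∑ I : Fin r → Fin N, ∑ J : Fin q → Fin N,
      (leviCivita₂ h I J * leviCivita₂ h K J) • w I = ((r ! * q ! : ℕ) : ℝ) • w K := by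
  subst h
  rw [← leviCivita_contraction hw K, ← Fintype.sum_prod_type']
  refine Fintype.sum_equiv (Fin.appendEquiv r q) _ _ fun IJ => ?_
  simp only [leviCivita₂, Fin.appendEquiv, Equiv.coe_fn_mk]
  have e1 : Fin.append IJ.1 IJ.2 ∘ Fin.natAdd r = IJ.2 := by ext; simp
  have e2 : Fin.append IJ.1 IJ.2 ∘ Fin.castAdd q = IJ.1 := by ext; simp
  rw [e1, e2]
  rfl

/-- This is *⁻¹ d * in components. Moving the differentiated index j from slot i to the front costs
(-1)^i, cancelling the sign in d; passing it to the front of L costs (-1)^(pq). All q + 1 slots then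
contribute equally, which absorbs the factorials. -/
theorem codiff_contraction {p q : ℕ} (h : (p + 1) + q = N) (h' : p + (q + 1) = N)
    (h'' : (q + 1) + p = N)
    {W : Fin N → (Fin (p + 1) → Fin N) → E} (hW : ∀ j, IsAlt (W j)) (L : Fin p → Fin N) :
    (1 / ((q + 1)! : ℝ)) • ∑ J : Fin (q + 1) → Fin N, leviCivita₂ h'' J L •
      ∑ i : Fin (q + 1), (-1 : ℝ) ^ (i : ℕ) • ((1 / ((p + 1)! : ℝ)) •
        ∑ I : Fin (p + 1) → Fin N, leviCivita₂ h I (i.removeNth J) • W (J i) I)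
      = (-1 : ℝ) ^ (p * q) • ∑ j, W j (Fin.cons j L) := by
  have hcons : ∀ (j : Fin N) (J' : Fin q → Fin N), leviCivita₂ h'' (Fin.cons j J') L
      = (-1) ^ (p * q) * leviCivita₂ h (Fin.cons j L) J' := by
    intro j J'
    have e : leviCivita₂ h' L (Fin.cons j J') = (-1) ^ p * leviCivita₂ h (Fin.cons j L) J' := by
      have := leviCivita₂_insertNth h (Fin.last p) j L J'
      rw [Fin.val_last] at this
      rw [← this, Fin.insertNth_last', leviCivita₂, leviCivita₂]
      congr 1
      subst h
      funext a
      rw [Fin.append_right_cons]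
      rfl
    rw [leviCivita₂_comm h' h'', e, ← mul_assoc, ← pow_add,
      show p * (q + 1) + p = p * q + 2 * p by ring, pow_add, pow_mul]
    simp
  have key : ∀ i : Fin (q + 1), ∑ J : Fin (q + 1) → Fin N, leviCivita₂ h'' J L •
      ((-1 : ℝ) ^ (i : ℕ) • ((1 / ((p + 1)! : ℝ)) •
        ∑ I : Fin (p + 1) → Fin N, leviCivita₂ h I (i.removeNth J) • W (J i) I))
      = ((-1 : ℝ) ^ (p * q) * q !) • ∑ j, W j (Fin.cons j L) := by
    intro i
    rw [← (Fin.insertNthEquiv (fun _ => Fin N) i).sum_comp, Fintype.sum_prod_type, Finset.smul_sum]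
    refine Finset.sum_congr rfl fun j _ => ?_
    have hc := leviCivita₂_contraction h (hW j) (Fin.cons j L)
    have h1 : ((-1 : ℝ) ^ (i : ℕ)) * (-1) ^ (i : ℕ) = 1 := by
      rw [← mul_pow]; simp
    have h2 : (1 / ((p + 1)! : ℝ)) * (((p + 1)! * q ! : ℕ) : ℝ) = q ! := by
      push_cast; field_simp
    simp only [Fin.insertNthEquiv, Equiv.coe_fn_mk, Fin.removeNth_insertNth,
      Fin.insertNth_apply_same, leviCivita₂_insertNth, hcons]
    rw [← h2, ← smul_smul, ← smul_smul, ← hc]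
    simp only [Finset.smul_sum, smul_smul]
    rw [Finset.sum_comm]
    refine Finset.sum_congr rfl fun I _ => Finset.sum_congr rfl fun J _ => ?_
    congr 1
    linear_combination ((-1) ^ (p * q) * leviCivita₂ h (Fin.cons j L) J * (1 / ((p + 1)! : ℝ)) *
      leviCivita₂ h I J) * h1
  simp only [Finset.smul_sum (r := leviCivita₂ _ _ _)]
  rw [Finset.sum_comm]
  have key' : ∀ i : Fin (q + 1), ∑ J : Fin (q + 1) → Fin N, leviCivita₂ h'' J L •
      ((-1 : ℝ) ^ (i : ℕ) • ((1 / ((p + 1)! : ℝ)) •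
        ∑ I : Fin (p + 1) → Fin N, leviCivita₂ h I (i.removeNth J) • W (J i) I)) = _ := key
  rw [Finset.sum_congr rfl fun i _ => key' i, Finset.sum_const, Finset.card_univ, Fintype.card_fin,
    ← Nat.cast_smul_eq_nsmul ℝ, smul_smul, smul_smul]
  congr 1
  rw [Nat.factorial_succ]
  push_cast
  field_simp

end LeviCivita

/-! ### Sums over all tuples versus increasing ones; change of orthonormal frame. -/

section Tuples

open Equiv

variable {N p : ℕ}

/-- By sorting, an injective tuple is uniquely an increasing tuple composed with a permutation. -/
theorem sum_fun_eq_factorial_mul_sum_orderEmbedding {Φ : (Fin p → Fin N) → ℝ}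
    (hperm : ∀ I (σ : Perm (Fin p)), Φ (I ∘ σ) = Φ I)
    (hzero : ∀ I, ¬ Function.Injective I → Φ I = 0) :
    ∑ I, Φ I = (p ! : ℝ) * ∑ I : Fin p ↪o Fin N, Φ I := by
  let e : (Fin p ↪o Fin N) × Perm (Fin p) → (Fin p → Fin N) := fun s => s.1 ∘ s.2
  have he : Function.Injective e := by
    rintro ⟨f, σ⟩ ⟨f', σ'⟩ h
    have h' : (f : Fin p → Fin N) ∘ σ = f' ∘ σ' := h
    have hr : Set.range f = Set.range f' := by
      rw [← σ.surjective.range_comp f, h', σ'.surjective.range_comp f']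
    obtain rfl : f = f' := by
      exact OrderEmbedding.range_inj.mp hr
    have : σ = σ' := by
      ext x
      exact congrArg Fin.val (f.injective (congrFun h' x))
    rw [this]
  rw [← Fintype.sum_of_injective e he (fun s => Φ s.1) Φ ?_ ?_]
  · rw [Fintype.sum_prod_type, Finset.mul_sum]
    refine Finset.sum_congr rfl fun f _ => ?_
    simp [Fintype.card_perm]
  · intro I hI
    by_contra hne
    apply hI
    have hinj : Function.Injective I := by
      by_contra h; exact hne (hzero I h)
    have hm : StrictMono (I ∘ Tuple.sort I) :=
      (Tuple.monotone_sort I).strictMono_of_injective (hinj.comp (Tuple.sort I).injective)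
    refine ⟨(OrderEmbedding.ofStrictMono _ hm, (Tuple.sort I)⁻¹), ?_⟩
    ext x
    simp [e]
  · rintro ⟨f, σ⟩
    exact (hperm f σ).symm

variable {L E : Type*} [AddCommGroup L] [Module ℝ L] [NormedAddCommGroup E]
  [InnerProductSpace ℝ E]

/-- Tensor powers of an orthogonal matrix are orthogonal: after multilinear expansion, the sum over
I of products factors into one Kronecker delta per slot. -/
theorem sum_inner_orthogonal (α β : MultilinearMap ℝ (fun _ : Fin p => L) E) (x y : Fin N → L)
    (O : Matrix (Fin N) (Fin N) ℝ) (hO : O.transpose * O = 1) (hy : ∀ i, y i = ∑ j, O i j • x j) :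
    ∑ I : Fin p → Fin N, inner ℝ (α (y ∘ I)) (β (y ∘ I))
      = ∑ I : Fin p → Fin N, inner ℝ (α (x ∘ I)) (β (x ∘ I)) := by
  have hexp : ∀ (f : MultilinearMap ℝ (fun _ : Fin p => L) E) (I : Fin p → Fin N),
      f (y ∘ I) = ∑ J : Fin p → Fin N, (∏ a, O (I a) (J a)) • f (x ∘ J) := by
    intro f I
    have : y ∘ I = fun a => ∑ j, O (I a) j • x j := funext fun a => hy (I a)
    rw [this, f.map_sum]
    exact Finset.sum_congr rfl fun J _ => f.map_smul_univ _ _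
  have horth : ∀ J K : Fin p → Fin N, ∑ I : Fin p → Fin N,
      (∏ a, O (I a) (J a)) * (∏ a, O (I a) (K a)) = if J = K then 1 else 0 := by
    intro J K
    simp only [← Finset.prod_mul_distrib]
    have := Finset.prod_univ_sum (fun _ : Fin p => (Finset.univ : Finset (Fin N)))
      (fun a i => O i (J a) * O i (K a))
    rw [Fintype.piFinset_univ] at this
    rw [← this]
    have h2 : ∀ a, ∑ i, O i (J a) * O i (K a) = if J a = K a then 1 else 0 := fun a => by
      have := congrFun (congrFun hO (J a)) (K a)
      rwa [Matrix.mul_apply, Matrix.one_apply] at this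
    simp only [h2]
    split_ifs with h
    · simp [h]
    · obtain ⟨a, ha⟩ := Function.ne_iff.mp h
      exact Finset.prod_eq_zero (Finset.mem_univ a) (if_neg ha)
  simp only [hexp, sum_inner, inner_sum, inner_smul_left, inner_smul_right]
  rw [Finset.sum_comm]
  refine Finset.sum_congr rfl fun J _ => ?_
  simp only [Finset.mul_sum]
  rw [Finset.sum_comm]
  have : ∀ K : Fin p → Fin N, ∑ I : Fin p → Fin N, (∏ a, O (I a) (J a)) *
      ((starRingEnd ℝ) (∏ a, O (I a) (K a)) * inner ℝ (α (x ∘ K)) (β (x ∘ J)))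
      = (if J = K then 1 else 0) * inner ℝ (α (x ∘ K)) (β (x ∘ J)) := fun K => by
    rw [← horth, Finset.sum_mul]
    exact Finset.sum_congr rfl fun I _ => by simp only [starRingEnd_apply, star_trivial]; ring
  simp only [this]
  simp

end Tuples

/-! ### The algebraic Laplacian and its Weitzenböck-type formula. -/

section FormAlgebra

variable {L M : Type*} [AddCommGroup L] [Module ℝ L] [AddCommGroup M] [Module ℝ M] {N p : ℕ}

/-- Post-composition of an alternating map with the operators `D Y`, as a linear map in `Y`. -/
def compForm (D : L →ₗ[ℝ] Module.End ℝ M) (θ : L [⋀^Fin p]→ₗ[ℝ] M) :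
    L →ₗ[ℝ] L [⋀^Fin p]→ₗ[ℝ] M where
  toFun Y := (D Y).compAlternatingMap θ
  map_add' Y Z := by ext; simp
  map_smul' c Y := by ext; simp

/-- The exterior derivative `∑ ξ^k ∧ D_{X_k}` on horizontal forms. -/
def dForm (D : L →ₗ[ℝ] Module.End ℝ M) (θ : L [⋀^Fin p]→ₗ[ℝ] M) : L [⋀^Fin (p + 1)]→ₗ[ℝ] M :=
  AlternatingMap.alternatizeUncurryFin (compForm D θ)

/-- The codifferential `-∑ D_{X_k} ι_{X_k}` on horizontal forms. -/
def deltaForm (x : Fin N → L) (D : L →ₗ[ℝ] Module.End ℝ M) (θ : L [⋀^Fin (p + 1)]→ₗ[ℝ] M) :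
    L [⋀^Fin p]→ₗ[ℝ] M :=
  -∑ k, (D (x k)).compAlternatingMap (θ.curryLeft (x k))

/-- The Laplacian of `dForm D` and `deltaForm x D'`. -/
def lapForm (x : Fin N → L) (D D' : L →ₗ[ℝ] Module.End ℝ M) (θ : L [⋀^Fin (p + 1)]→ₗ[ℝ] M) :
    L [⋀^Fin (p + 1)]→ₗ[ℝ] M :=
  dForm D (deltaForm x D' θ) + deltaForm x D' (dForm D θ)

theorem dForm_apply (D : L →ₗ[ℝ] Module.End ℝ M) (θ : L [⋀^Fin p]→ₗ[ℝ] M) (Y : Fin (p + 1) → L) :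
    dForm D θ Y = ∑ i : Fin (p + 1), (-1 : ℝ) ^ (i : ℕ) • D (Y i) (θ (i.removeNth Y)) := by
  rw [dForm, AlternatingMap.alternatizeUncurryFin_apply]
  refine Finset.sum_congr rfl fun i _ => ?_
  rw [← Int.cast_smul_eq_zsmul ℝ]
  simp [compForm]

theorem deltaForm_apply (x : Fin N → L) (D : L →ₗ[ℝ] Module.End ℝ M)
    (θ : L [⋀^Fin (p + 1)]→ₗ[ℝ] M) (Y : Fin p → L) :
    deltaForm x D θ Y = -∑ k, D (x k) (θ (Fin.cons (x k) Y)) := by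
  let ev : (L [⋀^Fin p]→ₗ[ℝ] M) →+ M := ⟨⟨fun ψ => ψ Y, rfl⟩, fun _ _ => rfl⟩
  change ev (deltaForm x D θ) = _
  rw [deltaForm, map_neg, map_sum]
  rfl

theorem removeNth_succ_cons {α : Type*} (a : α) (Y : Fin (p + 1) → α) (i : Fin (p + 1)) :
    i.succ.removeNth (Fin.cons a Y : Fin (p + 2) → α) = Fin.cons a (i.removeNth Y) := by
  ext j
  refine Fin.cases ?_ (fun j => ?_) j <;> simp [Fin.removeNth]

/-- In δd, the slot holding x_k gives -D'_k D_k; each remaining slot pairs with the corresponding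
term of dδ into a commutator. Nothing is assumed about D and D'. -/
theorem lapForm_apply (x : Fin N → L) (D D' : L →ₗ[ℝ] Module.End ℝ M)
    (θ : L [⋀^Fin (p + 1)]→ₗ[ℝ] M) (Y : Fin (p + 1) → L) :
    lapForm x D D' θ Y = -∑ k, D' (x k) (D (x k) (θ Y))
      + ∑ i : Fin (p + 1), ∑ k, (-1 : ℝ) ^ (i : ℕ) •
        (D' (x k) (D (Y i) (θ (Fin.cons (x k) (i.removeNth Y))))
          - D (Y i) (D' (x k) (θ (Fin.cons (x k) (i.removeNth Y))))) := by
  rw [lapForm, AlternatingMap.add_apply, dForm_apply, deltaForm_apply]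
  simp only [deltaForm_apply, dForm_apply, Fin.sum_univ_succ (n := p + 1), Fin.cons_zero,
    Fin.cons_succ, Fin.removeNth_zero, Fin.tail_cons, removeNth_succ_cons, map_add, map_sum,
    map_smul, map_neg, Fin.val_zero, pow_zero, one_smul, Fin.val_succ, pow_succ]
  simp only [smul_sub, Finset.sum_sub_distrib, Finset.sum_add_distrib, mul_neg, mul_one, neg_smul,
    Finset.sum_neg_distrib, Finset.smul_sum, smul_neg, neg_add, neg_neg]
  rw [Finset.sum_comm (γ := Fin N) (α := Fin (p + 1))]
  abel

/-- As D and R commute, (D - R)_k (D + R)_k = D_k² - R_k² and [(D - R)_k, (D + R)_i] = [D_k, D_i] -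
[R_k, R_i]. The D-parts cancel in the difference. -/
theorem lapForm_sub (x : Fin N → L) (D R : L →ₗ[ℝ] Module.End ℝ M)
    (hDR : ∀ Y Z f, D Y (R Z f) = R Z (D Y f))
    (θ : L [⋀^Fin (p + 1)]→ₗ[ℝ] M) (Y : Fin (p + 1) → L) :
    lapForm x (D + R) (D + (-1 : ℝ) • R) θ Y - lapForm x D D θ Y = ∑ k, R (x k) (R (x k) (θ Y))
      + ∑ i : Fin (p + 1), ∑ k, (-1 : ℝ) ^ (i : ℕ) •
        (R (Y i) (R (x k) (θ (Fin.cons (x k) (i.removeNth Y))))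
          - R (x k) (R (Y i) (θ (Fin.cons (x k) (i.removeNth Y))))) := by
  rw [lapForm_apply, lapForm_apply]
  have hm : ∀ Z f, (D + (-1 : ℝ) • R) Z f = D Z f - R Z f := fun Z f => by
    rw [LinearMap.add_apply, LinearMap.smul_apply, neg_one_smul]
    exact (sub_eq_add_neg _ _).symm
  simp only [hm]
  simp only [LinearMap.add_apply, map_add, map_sub, hDR, smul_sub, smul_add,
    Finset.sum_sub_distrib, Finset.sum_add_distrib]
  abel

/-- Naturality of the Laplacian under automorphisms. -/
theorem lapForm_natural (x x' : Fin N → L) (D D' : L →ₗ[ℝ] Module.End ℝ M)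
    (θ : L [⋀^Fin (p + 1)]→ₗ[ℝ] M) (a : L → L) (Φ : Module.End ℝ M)
    (hx : ∀ k, a (x k) = x' k)
    (hD : ∀ Y f, Φ (D Y f) = D (a Y) (Φ f)) (hD' : ∀ Y f, Φ (D' Y f) = D' (a Y) (Φ f))
    (hθ : ∀ Y, Φ (θ Y) = θ (a ∘ Y)) (Y : Fin (p + 1) → L) :
    Φ (lapForm x D D' θ Y) = lapForm x' D D' θ (a ∘ Y) := by
  have h1 : ∀ (i : Fin (p + 1)) k, a ∘ (Fin.cons (x k) (i.removeNth Y) : Fin (p + 1) → L)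
      = Fin.cons (x' k) (i.removeNth (a ∘ Y)) := fun i k => by
    rw [← hx]
    ext j
    refine Fin.cases ?_ (fun j => ?_) j <;> simp [Fin.removeNth]
  simp only [lapForm_apply, map_add, map_neg, map_sum, map_smul, map_sub, hD, hD', hθ, hx, h1,
    Function.comp_apply]

/-- The frame enters only through the codifferential, which is a trace ∑ b(x_k, x_k) of a bilinear
map and hence unchanged by orthogonal matrices. -/
theorem lapForm_orthogonal (x x' : Fin N → L) (D D' : L →ₗ[ℝ] Module.End ℝ M)
    (θ : L [⋀^Fin (p + 1)]→ₗ[ℝ] M) (O : Matrix (Fin N) (Fin N) ℝ) (hO : O.transpose * O = 1)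
    (hx' : ∀ i, x' i = ∑ j, O i j • x j) :
    lapForm x' D D' θ = lapForm x D D' θ := by
  have key : ∀ (b : L →ₗ[ℝ] L →ₗ[ℝ] M), ∑ k, b (x' k) (x' k) = ∑ k, b (x k) (x k) := by
    intro b
    have h : ∀ j l, ∑ k, O k j * O k l = if j = l then 1 else 0 := fun j l => by
      have := congrFun (congrFun hO j) l
      rwa [Matrix.mul_apply, Matrix.one_apply] at this
    simp only [hx', map_sum, LinearMap.sum_apply, map_smul, LinearMap.smul_apply, Finset.smul_sum,
      smul_smul]
    rw [Finset.sum_comm]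
    refine Finset.sum_congr rfl fun j _ => ?_
    rw [Finset.sum_comm]
    simp only [← Finset.sum_smul]
    simp only [h]
    simp
  have hdelta : ∀ {q : ℕ} (ψ : L [⋀^Fin (q + 1)]→ₗ[ℝ] M), deltaForm x' D' ψ = deltaForm x D' ψ := by
    intro q ψ
    ext Y
    rw [deltaForm_apply, deltaForm_apply]
    congr 1
    let b : L →ₗ[ℝ] L →ₗ[ℝ] M := LinearMap.mk₂ ℝ (fun Z Z' => D' Z (ψ (Fin.cons Z' Y)))
      (by intros; simp) (by intros; simp)
      (by intro m a a'; rw [← map_add]; exact congrArg _ (ψ.toMultilinearMap.cons_add Y a a'))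
      (by intro c m a; rw [← map_smul]; exact congrArg _ (ψ.toMultilinearMap.cons_smul Y c a))
    exact key b
  simp only [lapForm, hdelta]

end FormAlgebra

/-! ### From the Hodge-star Laplacian to the algebraic one. -/

section Laplacian

variable {n N m p : ℕ} {G : Type*} [TopologicalSpace G]
  [ChartedSpace (EuclideanSpace ℝ (Fin n)) G] [Group G]
  {E : Type*} [NormedAddCommGroup E] [InnerProductSpace ℝ E]

variable (n G E) in
/-- The smooth `E`-valued functions on `G`. -/
def SmoothFun : Submodule ℝ (G → E) where
  carrier := {f | ContMDiff (𝓡 n) 𝓘(ℝ, E) ∞ f}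
  add_mem' hf hg := ContMDiff.add hf hg
  zero_mem' := contMDiff_const
  smul_mem' c _ hf := ((c • ContinuousLinearMap.id ℝ E).contMDiff).comp hf

theorem SmoothFun.contMDiff (f : SmoothFun n G E) : ContMDiff (𝓡 n) 𝓘(ℝ, E) ∞ (f : G → E) := f.2

theorem SmoothFun.mdiff (f : SmoothFun n G E) : MDifferentiable (𝓡 n) 𝓘(ℝ, E) (f : G → E) :=
  (SmoothFun.contMDiff f).mdifferentiable (by simp)

variable (n G E) in
/-- The derivatives of smooth functions along left-invariant vector fields. -/
def lieDerivₗ [LieGroup (𝓡 n) ∞ G] : Lie n G →ₗ[ℝ] Module.End ℝ (SmoothFun n G E) :=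
  LinearMap.mk₂ ℝ (fun Y f => ⟨lieDeriv Y f, contMDiff_lieDeriv Y f.2⟩)
    (fun Y Z f => Subtype.ext (funext fun g => lieDeriv_add_left Y Z (f : G → E) g))
    (fun c Y f => Subtype.ext (funext fun g => lieDeriv_smul_left c Y (f : G → E) g))
    (fun Y f h => Subtype.ext (funext fun g =>
      lieDeriv_add Y (SmoothFun.mdiff f g) (SmoothFun.mdiff h g)))
    (fun c Y f => Subtype.ext (funext fun g => lieDeriv_smul_const Y c (SmoothFun.mdiff f g)))

variable (n G) in
/-- Pointwise application of a continuous linear map to smooth functions. -/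
def postcomp : (E →L[ℝ] E) →ₗ[ℝ] Module.End ℝ (SmoothFun n G E) :=
  LinearMap.mk₂ ℝ (fun T f => ⟨fun g => T ((f : G → E) g), T.contMDiff.comp f.2⟩)
    (fun _ _ _ => rfl) (fun _ _ _ => rfl)
    (fun T _ _ => Subtype.ext (funext fun _ => map_add T _ _))
    (fun _ T _ => Subtype.ext (funext fun _ => map_smul T _ _))

variable [LieGroup (𝓡 n) ∞ G] {𝔨 𝔭 : Submodule ℝ (Lie n G)}
  {X : Basis (Fin N ⊕ Fin m) ℝ (Lie n G)}

/-- The bracket terms of the exterior derivative drop out, since [𝔭, 𝔭] ⊂ 𝔨 and θ is horizontal. -/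
theorem covDeriv_apply_of_horizontal (hkp : IsCartanDecomposition 𝔨 𝔭)
    (hX : IsCartanBasis 𝔨 𝔭 X) {θ : LForm n G E p}
    (hθ : ∀ g Y, (∃ i, Y i ∈ 𝔨) → θ g Y = 0) (I : Fin (p + 1) → Fin N) (g : G) :
    covDeriv X θ g (fun a => X (Sum.inl (I a)))
      = ∑ i : Fin (p + 1), (-1 : ℝ) ^ (i : ℕ) • lieDeriv (X (Sum.inl (I i)))
          (fun x => θ x (fun a => X (Sum.inl (i.removeNth I a)))) g := by
  unfold covDeriv
  simp only [IsCartanBasis.horProj_inl]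
  rcases p with _ | p
  · simp only [extDerivG, Fin.sum_univ_succ, Finset.univ_eq_empty, Finset.sum_empty, add_zero,
      Fin.val_zero, pow_zero, one_smul]
    congr 1
    funext x
    congr 1
    funext a; exact a.elim0
  · simp only [extDerivG]
    rw [add_eq_left.mpr]
    · rfl
    · refine Finset.sum_eq_zero fun i _ => Finset.sum_eq_zero fun j _ => ?_
      split_ifs
      · rw [hθ _ _ ⟨0, ?_⟩, smul_zero]
        rw [Fin.cons_zero]
        exact hkp.lie_pp _ (hX.mem_p _) _ (hX.mem_p _)
      · rfl

theorem horVol_append_inl {r q : ℕ} (h : r + q = N) (I : Fin r → Fin N) (J : Fin q → Fin N) :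
    horVol X (fun a => Fin.append (fun b => X (Sum.inl (I b))) (fun b => X (Sum.inl (J b)))
      (Fin.cast h.symm a)) = leviCivita₂ h I J := by
  unfold horVol leviCivita₂ leviCivita
  congr 1
  ext i j
  have : (Fin.append (fun b => X (Sum.inl (I b))) (fun b => X (Sum.inl (J b)))
      (Fin.cast h.symm i)) = X (Sum.inl (Fin.append I J (Fin.cast h.symm i))) := by
    refine Fin.addCases (fun a => ?_) (fun b => ?_) (Fin.cast h.symm i) <;> simp
  simp [this, Finsupp.single_apply]

theorem horVol_eq_zero (hkp : IsCartanDecomposition 𝔨 𝔭)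
    (hX : IsCartanBasis 𝔨 𝔭 X) {r q : ℕ} (h : r + q = N) (Z : Fin r → Lie n G)
    {Y : Fin q → Lie n G} (hY : ∃ i, Y i ∈ 𝔨) :
    horVol X (fun a => Fin.append Z Y (Fin.cast h.symm a)) = 0 := by
  obtain ⟨i, hi⟩ := hY
  refine Matrix.det_eq_zero_of_row_eq_zero (Fin.cast h (Fin.natAdd r i)) fun j => ?_
  simp [hX.repr_inl_of_mem_k hkp hi]

theorem hodge_eq_zero (hkp : IsCartanDecomposition 𝔨 𝔭) (hX : IsCartanBasis 𝔨 𝔭 X) {r q : ℕ}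
    (h : r + q = N) (θ : LForm n G E r) (g : G) {Y : Fin q → Lie n G} (hY : ∃ i, Y i ∈ 𝔨) :
    hodge X h θ g Y = 0 := by
  simp [hodge, horVol_eq_zero hkp hX h _ hY]

theorem codiff_eq_zero (hkp : IsCartanDecomposition 𝔨 𝔭) (hX : IsCartanBasis 𝔨 𝔭 X)
    (S T : G → E →ₗ[ℝ] E) (θ : LForm n G E (p + 1)) (g : G) {Y : Fin p → Lie n G}
    (hY : ∃ i, Y i ∈ 𝔨) : codiff X S T θ g Y = 0 := by
  unfold codiff
  split_ifs with h
  · simp [hodgeInv, hodge_eq_zero hkp hX _ _ _ hY]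
  · rfl

theorem AlternatingMap.isAlt {L M : Type*} [AddCommGroup L] [Module ℝ L] [AddCommGroup M]
    [Module ℝ M] (θ : L [⋀^Fin p]→ₗ[ℝ] M) (x : Fin N → L) :
    IsAlt (fun I : Fin p → Fin N => θ (fun a => x (I a))) where
  perm I σ := θ.map_perm (fun a => x (I a)) σ
  zero I hI := by
    simp only [Function.Injective, not_forall] at hI
    obtain ⟨i, j, hij, hne⟩ := hI
    exact θ.map_eq_zero_of_eq _ (by simp [hij]) hne

/-- `B` is a change of trivialization, and `D` is the dual derivative T X_k S seen through it.
Keeping them abstract lets one computation serve both connections. -/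
theorem codiff_core (hkp : IsCartanDecomposition 𝔨 𝔭) (hX : IsCartanBasis 𝔨 𝔭 X)
    {B S T : G → E →ₗ[ℝ] E} {D : Lie n G →ₗ[ℝ] Module.End ℝ (SmoothFun n G E)}
    (hsmooth : ∀ f : SmoothFun n G E,
      MDifferentiable (𝓡 n) 𝓘(ℝ, E) (fun x => S x (B x ((f : G → E) x))))
    (hD : ∀ (k : Fin N) (f : SmoothFun n G E) g,
      T g (lieDeriv (X (Sum.inl k)) (fun x => S x (B x ((f : G → E) x))) g)
        = B g ((D (X (Sum.inl k)) f : G → E) g))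
    {θ : LForm n G E (p + 1)} {θ' : (Lie n G) [⋀^Fin (p + 1)]→ₗ[ℝ] SmoothFun n G E}
    (hθ : ∀ g (I : Fin (p + 1) → Fin N), θ g (fun a => X (Sum.inl (I a)))
      = B g ((θ' (fun a => X (Sum.inl (I a))) : G → E) g)) (g : G) (L : Fin p → Fin N)
    {q : ℕ} (h₁ : (p + 1) + q = N) (h₂ : p + (q + 1) = N) :
    (-1 : ℝ) ^ (p + 1) • hodgeInv X h₂ (fun g' Y' => T g' (covDeriv X
        (fun g'' Y'' => S g'' (hodge X h₁ θ g'' Y'')) g' Y')) g (fun a => X (Sum.inl (L a)))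
      = -∑ j, B g ((D (X (Sum.inl j)) (θ' (fun a => X (Sum.inl ((Fin.cons j L :
        Fin (p + 1) → Fin N) a)))) : G → E) g) := by
  let W : Fin N → (Fin (p + 1) → Fin N) → E := fun j I =>
    B g ((D (X (Sum.inl j)) (θ' (fun a => X (Sum.inl (I a)))) : G → E) g)
  have hW : ∀ j, IsAlt (W j) := fun j =>
    let ψ : SmoothFun n G E →ₗ[ℝ] E := (B g) ∘ₗ (LinearMap.proj g) ∘ₗ
      (SmoothFun n G E).subtype ∘ₗ (D (X (Sum.inl j)))
    AlternatingMap.isAlt (ψ.compAlternatingMap θ') (fun k => X (Sum.inl k))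
  have hstar : ∀ x (J : Fin q → Fin N), S x (hodge X h₁ θ x (fun a => X (Sum.inl (J a))))
      = (1 / ((p + 1)! : ℝ)) • ∑ I : Fin (p + 1) → Fin N, leviCivita₂ h₁ I J •
        S x (B x ((θ' (fun a => X (Sum.inl (I a))) : G → E) x)) := by
    intro x J
    simp only [hodge, hθ, map_smul, map_sum]
    congr 1
    refine Finset.sum_congr rfl fun I _ => ?_
    exact congrArg (· • _) (horVol_append_inl h₁ I J)
  have hcov : ∀ J : Fin (q + 1) → Fin N, T g (covDeriv X
        (fun g'' Y'' => S g'' (hodge X h₁ θ g'' Y'')) g (fun a => X (Sum.inl (J a))))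
      = ∑ i : Fin (q + 1), (-1 : ℝ) ^ (i : ℕ) • ((1 / ((p + 1)! : ℝ)) •
        ∑ I : Fin (p + 1) → Fin N, leviCivita₂ h₁ I (i.removeNth J) • W (J i) I) := by
    intro J
    rw [covDeriv_apply_of_horizontal hkp hX, map_sum]
    · refine Finset.sum_congr rfl fun i _ => ?_
      rw [map_smul]
      congr 1
      simp only [hstar]
      have hd : ∀ I : Fin (p + 1) → Fin N, MDifferentiable (𝓡 n) 𝓘(ℝ, E)
          (fun x => leviCivita₂ h₁ I (i.removeNth J) •
            S x (B x ((θ' (fun a => X (Sum.inl (I a))) : G → E) x))) := fun I =>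
        (leviCivita₂ h₁ I (i.removeNth J) • ContinuousLinearMap.id ℝ E).mdifferentiable.comp
          (hsmooth _)
      have hd' : MDifferentiable (𝓡 n) 𝓘(ℝ, E)
          (fun x => ∑ I : Fin (p + 1) → Fin N, leviCivita₂ h₁ I (i.removeNth J) •
            S x (B x ((θ' (fun a => X (Sum.inl (I a))) : G → E) x))) := by
        simpa only [Finset.sum_fn] using MDifferentiable.sum fun I _ => hd I
      rw [lieDeriv_smul_const _ _ (hd' g), lieDeriv_sum _ _ (fun I => hd I g), map_smul, map_sum]
      congr 1
      refine Finset.sum_congr rfl fun I _ => ?_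
      rw [lieDeriv_smul_const _ _ (hsmooth _ g), map_smul, hD]
    · intro x Y hY
      rw [hodge_eq_zero hkp hX _ _ _ hY, map_zero]
  have key := codiff_contraction h₁ h₂ (by omega) hW L
  have houter : ∀ (h'' : q + 1 + p = N) (ψ : LForm n G E (q + 1)),
      hodge X h'' ψ g (fun a => X (Sum.inl (L a))) = (1 / ((q + 1)! : ℝ)) •
        ∑ J : Fin (q + 1) → Fin N, leviCivita₂ h'' J L • ψ g (fun a => X (Sum.inl (J a))) := by
    intro h'' ψ
    unfold hodge
    congr 1
    refine Finset.sum_congr rfl fun J _ => ?_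
    exact congrArg (· • _) (horVol_append_inl h'' J L)
  unfold hodgeInv
  rw [houter]
  simp only [hcov]
  rw [key, smul_smul, smul_smul, ← Finset.sum_neg_distrib, Finset.smul_sum]
  refine Finset.sum_congr rfl fun j _ => ?_
  -- The three signs come from the definition of δ, from *⁻¹ and from the contraction.
  have : (-1 : ℝ) ^ (p + 1) * ((-1) ^ (p * (q + 1)) * (-1) ^ (p * q)) = -1 := by
    rw [← pow_add, ← pow_add, show p + 1 + (p * (q + 1) + p * q) = 2 * (p * (q + 1)) + 1 by ring,
      pow_succ, pow_mul]
    simp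
  rw [← mul_assoc] at this
  rw [mul_assoc, ← mul_assoc, this, neg_one_smul]

theorem codiff_apply (hkp : IsCartanDecomposition 𝔨 𝔭) (hX : IsCartanBasis 𝔨 𝔭 X)
    {B S T : G → E →ₗ[ℝ] E} {D : Lie n G →ₗ[ℝ] Module.End ℝ (SmoothFun n G E)}
    (hsmooth : ∀ f : SmoothFun n G E, MDifferentiable (𝓡 n) 𝓘(ℝ, E) (fun x => S x (B x ((f : G → E) x))))
    (hD : ∀ (k : Fin N) (f : SmoothFun n G E) g,
      T g (lieDeriv (X (Sum.inl k)) (fun x => S x (B x ((f : G → E) x))) g)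
        = B g ((D (X (Sum.inl k)) f : G → E) g))
    {θ : LForm n G E (p + 1)} {θ' : (Lie n G) [⋀^Fin (p + 1)]→ₗ[ℝ] SmoothFun n G E}
    (hθ : ∀ g (I : Fin (p + 1) → Fin N), θ g (fun a => X (Sum.inl (I a)))
      = B g ((θ' (fun a => X (Sum.inl (I a))) : G → E) g)) (g : G) (L : Fin p → Fin N) :
    codiff X S T θ g (fun a => X (Sum.inl (L a)))
      = B g ((deltaForm (fun k => X (Sum.inl k)) D θ' (fun a => X (Sum.inl (L a))) : G → E) g) := by
  have hcons : ∀ k, (Fin.cons (X (Sum.inl k)) (fun a => X (Sum.inl (L a))) : Fin (p + 1) → Lie n G)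
      = fun a => X (Sum.inl ((Fin.cons k L : Fin (p + 1) → Fin N) a)) := fun k => by
    ext1 a; refine Fin.cases ?_ (fun a => ?_) a <;> simp
  have hrhs : B g ((deltaForm (fun k => X (Sum.inl k)) D θ' (fun a => X (Sum.inl (L a))) :
      G → E) g) = -∑ j, B g ((D (X (Sum.inl j)) (θ' (fun a => X (Sum.inl ((Fin.cons j L :
        Fin (p + 1) → Fin N) a)))) : G → E) g) := by
    rw [deltaForm_apply]
    simp only [hcons, Submodule.coe_neg, Submodule.coe_sum, Pi.neg_apply, Finset.sum_apply, map_neg,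
      map_sum]
  rw [hrhs]
  unfold codiff
  split_ifs with h
  · exact codiff_core hkp hX hsmooth hD hθ g L _ _
  -- Above the top degree no injective index tuple exists, so the right-hand side vanishes with the
  -- conventional zero on the left.
  · have : ∀ I : Fin (p + 1) → Fin N, ¬ Function.Injective I := fun I hI => h (by
      simpa using Fintype.card_le_of_injective I hI)
    have h0 : ∀ I : Fin (p + 1) → Fin N, θ' (fun a => X (Sum.inl (I a))) = 0 := fun I =>
      (AlternatingMap.isAlt θ' (fun k => X (Sum.inl k))).zero I (this I)
    simp [h0]

/-- Used twice: with `B` = π₁(g) ⊗ Id, D = L + R, D' = L - R for the flat connection, and with `B`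
the identity and D = D' = L for the other one. -/
theorem laplacian_apply (hkp : IsCartanDecomposition 𝔨 𝔭) (hX : IsCartanBasis 𝔨 𝔭 X)
    {B S T : G → E →ₗ[ℝ] E} {D D' : Lie n G →ₗ[ℝ] Module.End ℝ (SmoothFun n G E)}
    (hsmooth : ∀ f : SmoothFun n G E,
      MDifferentiable (𝓡 n) 𝓘(ℝ, E) (fun x => S x (B x ((f : G → E) x))))
    (hD : ∀ (k : Fin N) (f : SmoothFun n G E) g,
      lieDeriv (X (Sum.inl k)) (fun x => B x ((f : G → E) x)) g
        = B g ((D (X (Sum.inl k)) f : G → E) g))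
    (hD' : ∀ (k : Fin N) (f : SmoothFun n G E) g,
      T g (lieDeriv (X (Sum.inl k)) (fun x => S x (B x ((f : G → E) x))) g)
        = B g ((D' (X (Sum.inl k)) f : G → E) g))
    {θ : (Lie n G) [⋀^Fin (p + 1)]→ₗ[ℝ] SmoothFun n G E}
    (hθ : ∀ g Y, (∃ i, Y i ∈ 𝔨) → (θ Y : G → E) g = 0) (g : G) (I : Fin (p + 1) → Fin N) :
    laplacian X S T (fun g Y => B g ((θ Y : G → E) g)) g (fun a => X (Sum.inl (I a)))
      = B g ((lapForm (fun k => X (Sum.inl k)) D D' θ (fun a => X (Sum.inl (I a))) : G → E) g) := by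
  have hcov : ∀ {q : ℕ} (ψ : LForm n G E q) (ψ' : (Lie n G) [⋀^Fin q]→ₗ[ℝ] SmoothFun n G E),
      (∀ g Y, (∃ i, Y i ∈ 𝔨) → ψ g Y = 0) →
      (∀ g (I : Fin q → Fin N), ψ g (fun a => X (Sum.inl (I a)))
        = B g ((ψ' (fun a => X (Sum.inl (I a))) : G → E) g)) →
      ∀ g (I : Fin (q + 1) → Fin N), covDeriv X ψ g (fun a => X (Sum.inl (I a)))
        = B g ((dForm D ψ' (fun a => X (Sum.inl (I a))) : G → E) g) := by
    intro q ψ ψ' h1 h2 g I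
    rw [covDeriv_apply_of_horizontal hkp hX h1, dForm_apply]
    simp only [h2, hD, Submodule.coe_sum, Finset.sum_apply, map_sum, Submodule.coe_smul,
      Pi.smul_apply, map_smul]
    rfl
  unfold laplacian lapForm
  rw [AlternatingMap.add_apply, Submodule.coe_add]
  change covDeriv X _ g _ + codiff X S T _ g _ = B g (_ + _)
  rw [(B g).map_add]
  congr 1
  · exact hcov _ _ (fun g Y hY => codiff_eq_zero hkp hX S T _ g hY)
      (fun g I => codiff_apply hkp hX hsmooth hD' (fun _ _ => rfl) g I) g I
  · refine codiff_apply hkp hX hsmooth hD' (fun g I => ?_) g I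
    exact hcov _ _ (fun g Y hY => by rw [hθ g Y hY, map_zero]) (fun _ _ => rfl) g I

end Laplacian

/-! ### The two connections in the trivialization of `E(σ')`. -/

section RepresentationOperators

variable {n N m p : ℕ} {G : Type*} [TopologicalSpace G]
  [ChartedSpace (EuclideanSpace ℝ (Fin n)) G] [Group G]
  {F : Type*} [NormedAddCommGroup F] [InnerProductSpace ℝ F] [FiniteDimensional ℝ F]
  {H : Type*} [NormedAddCommGroup H] [InnerProductSpace ℝ H]

variable (F H) in
/-- `T ↦ T ⊗ Id` as a continuous linear map. -/
def rTensorL : (F →L[ℝ] F) →L[ℝ] F ⊗[ℝ] H →L[ℝ] F ⊗[ℝ] H :=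
  let T₀ : (F →L[ℝ] F) →+ (F ⊗[ℝ] H →L[ℝ] F ⊗[ℝ] H) :=
    AddMonoidHom.mk' (fun T => T.rTensor H) (ContinuousLinearMap.rTensor_add H)
  T₀.toRealLinearMap (AddMonoidHomClass.continuous_of_bound T₀ 1 fun T => by
    rw [one_mul]; exact ContinuousLinearMap.norm_rTensor_le H T)

theorem toContinuousLinearMap_eq_sum (T : F →ₗ[ℝ] F) :
    T.toContinuousLinearMap = ∑ i, ContinuousLinearMap.smulRightL ℝ F F
      ((Module.finBasis ℝ F).coord i).toContinuousLinearMap (T (Module.finBasis ℝ F i)) := by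
  ext u
  conv_lhs => rw [← (Module.finBasis ℝ F).sum_repr u]
  simp [-Basis.sum_repr]

/-- In finite dimension an operator is a finite sum of rank one operators determined by its values
on a basis, so smoothness on vectors gives smoothness in operator norm. -/
theorem contMDiff_toContinuousLinearMap {T : G → F →ₗ[ℝ] F}
    (hT : ∀ u, ContMDiff (𝓡 n) 𝓘(ℝ, F) ∞ (fun g => T g u)) :
    ContMDiff (𝓡 n) 𝓘(ℝ, F →L[ℝ] F) ∞ (fun g => (T g).toContinuousLinearMap) := by
  simp only [toContinuousLinearMap_eq_sum]
  exact ContMDiff.sum fun i _ => (ContinuousLinearMap.smulRightL ℝ F F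
      ((Module.finBasis ℝ F).coord i).toContinuousLinearMap).contMDiff.comp (hT _)

theorem lieDeriv_toContinuousLinearMap {T : G → F →ₗ[ℝ] F}
    (hT : ∀ u, ContMDiff (𝓡 n) 𝓘(ℝ, F) ∞ (fun g => T g u)) (Y : Lie n G) (g : G)
    {T' : F →ₗ[ℝ] F} (hT' : ∀ u, lieDeriv Y (fun x => T x u) g = T' u) :
    lieDeriv Y (fun x => (T x).toContinuousLinearMap) g = T'.toContinuousLinearMap := by
  ext u
  have := lieDeriv_clm_comp Y (ContinuousLinearMap.apply ℝ F u)
    ((contMDiff_toContinuousLinearMap hT).mdifferentiable (by simp) g)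
  exact this.symm.trans (hT' u)

theorem mdifferentiable_rTensor {T : G → F →ₗ[ℝ] F}
    (hT : ∀ u, ContMDiff (𝓡 n) 𝓘(ℝ, F) ∞ (fun g => T g u)) (f : SmoothFun n G (F ⊗[ℝ] H)) :
    MDifferentiable (𝓡 n) 𝓘(ℝ, F ⊗[ℝ] H)
      (fun g => LinearMap.rTensor H (T g) ((f : G → F ⊗[ℝ] H) g)) := by
  have h0 := ContinuousLinearMap.contDiff (n := ∞) (𝕜 := ℝ) (E := F →L[ℝ] F) (F := F ⊗[ℝ] H →L[ℝ] F ⊗[ℝ] H) (rTensorL F H)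
  have h := h0.contMDiff.comp (contMDiff_toContinuousLinearMap hT)
  exact (h.clm_apply (SmoothFun.contMDiff f)).mdifferentiable (by simp)

theorem lieDeriv_rTensor {T : G → F →ₗ[ℝ] F}
    (hT : ∀ u, ContMDiff (𝓡 n) 𝓘(ℝ, F) ∞ (fun g => T g u)) (Y : Lie n G) (g : G)
    {T' : F →ₗ[ℝ] F} (hT' : ∀ u, lieDeriv Y (fun x => T x u) g = T' u)
    (f : SmoothFun n G (F ⊗[ℝ] H)) :
    lieDeriv Y (fun x => LinearMap.rTensor H (T x) ((f : G → F ⊗[ℝ] H) x)) g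
      = LinearMap.rTensor H T' ((f : G → F ⊗[ℝ] H) g)
        + LinearMap.rTensor H (T g) (lieDeriv Y f g) := by
  have := lieDeriv_bilin Y (rTensorL F H)
    ((contMDiff_toContinuousLinearMap hT).mdifferentiable (by simp) g) (SmoothFun.mdiff f g)
  rw [lieDeriv_toContinuousLinearMap hT Y g hT'] at this
  exact this

variable [LieGroup (𝓡 n) ∞ G] {π₁ : Representation ℝ G F}

/-- The differential of a smooth representation, as a linear map. -/
def dRepₗ (hπ₁ : ∀ u : F, ContMDiff (𝓡 n) 𝓘(ℝ, F) ∞ (fun g => π₁ g u)) :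
    Lie n G →ₗ[ℝ] F →ₗ[ℝ] F :=
  LinearMap.mk₂ ℝ (dRep π₁) (dRep_add_left hπ₁) (dRep_smul_left hπ₁) (dRep_add_right hπ₁)
    (fun c Y u => dRep_smul_right hπ₁ Y c u)

theorem dRepₗ_apply (hπ₁ : ∀ u : F, ContMDiff (𝓡 n) 𝓘(ℝ, F) ∞ (fun g => π₁ g u)) (Y : Lie n G)
    (u : F) : dRepₗ hπ₁ Y u = dRep π₁ Y u := rfl

variable (H) in
/-- The operators `ρ_Y = dπ₁(Y) ⊗ Id` on smooth functions. -/
def repOp (hπ₁ : ∀ u : F, ContMDiff (𝓡 n) 𝓘(ℝ, F) ∞ (fun g => π₁ g u)) :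
    Lie n G →ₗ[ℝ] Module.End ℝ (SmoothFun n G (F ⊗[ℝ] H)) :=
  postcomp n G ∘ₗ (rTensorL F H).toLinearMap ∘ₗ
    (LinearMap.toContinuousLinearMap : (F →ₗ[ℝ] F) ≃ₗ[ℝ] F →L[ℝ] F).toLinearMap ∘ₗ dRepₗ hπ₁

variable (hπ₁ : ∀ u : F, ContMDiff (𝓡 n) 𝓘(ℝ, F) ∞ (fun g => π₁ g u))

/-- The operators dπ₁(Z) ⊗ Id have constant coefficients. -/
theorem lieDerivₗ_repOp (Y Z : Lie n G) (f : SmoothFun n G (F ⊗[ℝ] H)) :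
    lieDerivₗ n G (F ⊗[ℝ] H) Y (repOp H hπ₁ Z f) = repOp H hπ₁ Z (lieDerivₗ n G (F ⊗[ℝ] H) Y f) :=
  Subtype.ext (funext fun g => lieDeriv_clm_comp Y
    (rTensorL F H (dRepₗ hπ₁ Z).toContinuousLinearMap) (SmoothFun.mdiff f g))

/-- The representation contragredient to `π₁`, on `F` itself. -/
def contragredient (π₁ : Representation ℝ G F) : Representation ℝ G F where
  toFun g := LinearMap.adjoint (π₁ g⁻¹)
  map_one' := by simp [Module.End.one_eq_id]
  map_mul' g h := by rw [mul_inv_rev, map_mul]; exact LinearMap.adjoint_comp _ _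

theorem contragredient_apply (g : G) : contragredient π₁ g = LinearMap.adjoint (π₁ g⁻¹) := rfl

theorem inner_contragredient (g : G) (u w : F) :
    inner ℝ (contragredient π₁ g u) (π₁ g w) = inner ℝ u w := by
  rw [contragredient_apply, LinearMap.adjoint_inner_left, ← Module.End.mul_apply, ← map_mul]
  simp

include hπ₁ in
theorem contMDiff_contragredient (u : F) :
    ContMDiff (𝓡 n) 𝓘(ℝ, F) ∞ (fun g => contragredient π₁ g u) := by
  have h : ∀ g, contragredient π₁ g u = ∑ i, (innerSL ℝ u (π₁ g⁻¹ (stdOrthonormalBasis ℝ F i))) •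
      stdOrthonormalBasis ℝ F i := fun g => by
    rw [← (stdOrthonormalBasis ℝ F).sum_repr' (contragredient π₁ g u)]
    refine Finset.sum_congr rfl fun i _ => ?_
    rw [contragredient_apply, LinearMap.adjoint_inner_right, innerSL_apply_apply, real_inner_comm]
  simp only [h]
  refine ContMDiff.sum fun i _ => ?_
  exact (((innerSL ℝ u).smulRight (stdOrthonormalBasis ℝ F i)).contMDiff (n := ∞)).comp
    ((hπ₁ _).comp (contMDiff_inv (𝓡 n) ∞))

/-- Differentiate the constant pairing of the contragredient orbit of u with the orbit of w.
Symmetry on 𝔭 turns the adjoint into dπ₁(Y) itself; this is the source of the minus sign in L - R.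
-/
theorem dRep_contragredient {K : Subgroup G} {𝔨 𝔭 : Submodule ℝ (Lie n G)}
    (hF : IsAdmissible π₁ K 𝔨 𝔭) {Y : Lie n G} (hY : Y ∈ 𝔭) (u : F) :
    dRep (contragredient π₁) Y u = -dRepₗ hπ₁ Y u := by
  refine ext_inner_right ℝ fun w => ?_
  have h := lieDeriv_bilin Y (innerSL ℝ)
    ((contMDiff_contragredient hπ₁ u).mdifferentiable (by simp) 1)
    ((hπ₁ w).mdifferentiable (by simp) 1)
  rw [lieDeriv_rep_one hπ₁, lieDeriv_rep_one (contMDiff_contragredient hπ₁)] at h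
  have e : (fun x => innerSL ℝ (contragredient π₁ x u) (π₁ x w)) = fun _ => inner ℝ u w :=
    funext fun x => inner_contragredient x u w
  rw [e, lieDeriv_const] at h
  simp only [map_one, Module.End.one_apply] at h
  change 0 = inner ℝ _ _ + inner ℝ _ _ at h
  rw [inner_neg_left, dRepₗ_apply, hF.symm Y hY]
  linarith

theorem toFlat_lieDeriv (Y : Lie n G) (f : SmoothFun n G (F ⊗[ℝ] H)) (g : G) :
    lieDeriv Y (fun x => toFlat H π₁ x ((f : G → F ⊗[ℝ] H) x)) g
      = toFlat H π₁ g (((lieDerivₗ n G (F ⊗[ℝ] H) + repOp H hπ₁) Y f : G → F ⊗[ℝ] H) g) := by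
  refine (lieDeriv_rTensor hπ₁ Y g (T' := π₁ g ∘ₗ dRepₗ hπ₁ Y)
    (fun u => lieDeriv_rep hπ₁ Y u g) f).trans ?_
  rw [LinearMap.rTensor_comp, add_comm]
  exact ((toFlat H π₁ g).map_add _ _).symm

theorem flatSharp_toFlat (g : G) (e : F ⊗[ℝ] H) :
    flatSharp H π₁ g (toFlat H π₁ g e) = LinearMap.rTensor H (contragredient π₁ g) e := by
  rw [flatSharp, toFlat, ← LinearMap.rTensor_comp_apply, LinearMap.comp_assoc]
  congr 2
  rw [← Module.End.mul_eq_comp (π₁ g⁻¹), ← map_mul]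
  simp [contragredient_apply, Module.End.one_eq_id]

theorem flatSharpInv_rTensor_contragredient (g : G) (e : F ⊗[ℝ] H) :
    flatSharpInv H π₁ g (LinearMap.rTensor H (contragredient π₁ g) e) = toFlat H π₁ g e := by
  rw [flatSharpInv, toFlat, ← LinearMap.rTensor_comp_apply, LinearMap.comp_assoc]
  congr 2
  rw [contragredient_apply, ← LinearMap.adjoint_comp, ← Module.End.mul_eq_comp (π₁ g⁻¹), ← map_mul]
  simp [Module.End.one_eq_id]

/-- The composite # A⁻¹ is the contragredient representation tensored with Id, so the product rule
brings in the negated differential. -/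
theorem flatSharpInv_lieDeriv {K : Subgroup G} {𝔨 𝔭 : Submodule ℝ (Lie n G)}
    (hF : IsAdmissible π₁ K 𝔨 𝔭) {Y : Lie n G} (hY : Y ∈ 𝔭) (f : SmoothFun n G (F ⊗[ℝ] H))
    (g : G) :
    flatSharpInv H π₁ g
      (lieDeriv Y (fun x => flatSharp H π₁ x (toFlat H π₁ x ((f : G → F ⊗[ℝ] H) x))) g)
      = toFlat H π₁ g (((lieDerivₗ n G (F ⊗[ℝ] H) + (-1 : ℝ) • repOp H hπ₁) Y f : G → F ⊗[ℝ] H) g) := by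
  simp only [flatSharp_toFlat]
  rw [lieDeriv_rTensor (contMDiff_contragredient hπ₁) Y g
    (T' := contragredient π₁ g ∘ₗ (-dRepₗ hπ₁ Y))
    (fun u => (lieDeriv_rep (contMDiff_contragredient hπ₁) Y u g).trans
      (by rw [dRep_contragredient hπ₁ hF hY]; rfl)) f,
    LinearMap.rTensor_comp, LinearMap.comp_apply, ← map_add, flatSharpInv_rTensor_contragredient,
    LinearMap.rTensor_neg, add_comm, LinearMap.neg_apply,
    ← neg_one_smul ℝ]
  rfl

theorem toK_toFlat (g : G) (e : F ⊗[ℝ] H) : toK H π₁ g (toFlat H π₁ g e) = e := by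
  rw [toK, toFlat, ← LinearMap.rTensor_comp_apply, ← Module.End.mul_eq_comp, ← map_mul]
  simp [Module.End.one_eq_id]

variable {K : Subgroup G} {𝔨 𝔭 : Submodule ℝ (Lie n G)} {X : Basis (Fin N ⊕ Fin m) ℝ (Lie n G)}

theorem flatLaplacian_apply (hkp : IsCartanDecomposition 𝔨 𝔭) (hX : IsCartanBasis 𝔨 𝔭 X)
    (hF : IsAdmissible π₁ K 𝔨 𝔭)
    {θ : (Lie n G) [⋀^Fin (p + 1)]→ₗ[ℝ] SmoothFun n G (F ⊗[ℝ] H)}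
    (hθ : ∀ g Y, (∃ i, Y i ∈ 𝔨) → (θ Y : G → F ⊗[ℝ] H) g = 0) (g : G)
    (I : Fin (p + 1) → Fin N) :
    flatLaplacian π₁ X (fun g Y => (θ Y : G → F ⊗[ℝ] H) g) g (fun a => X (Sum.inl (I a)))
      = (lapForm (fun k => X (Sum.inl k)) (lieDerivₗ n G (F ⊗[ℝ] H) + repOp H hπ₁)
          (lieDerivₗ n G (F ⊗[ℝ] H) + (-1 : ℝ) • repOp H hπ₁) θ (fun a => X (Sum.inl (I a))) :
          G → F ⊗[ℝ] H) g := by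
  unfold flatLaplacian
  rw [laplacian_apply hkp hX (B := toFlat H π₁) (fun f => ?_)
    (fun k f g => toFlat_lieDeriv hπ₁ _ f g)
    (fun k f g => flatSharpInv_lieDeriv hπ₁ hF (hX.mem_p k) f g) hθ, toK_toFlat]
  simp only [flatSharp_toFlat]
  exact mdifferentiable_rTensor (contMDiff_contragredient hπ₁) f

theorem kLaplacian_apply (hkp : IsCartanDecomposition 𝔨 𝔭) (hX : IsCartanBasis 𝔨 𝔭 X)
    {θ : (Lie n G) [⋀^Fin (p + 1)]→ₗ[ℝ] SmoothFun n G (F ⊗[ℝ] H)}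
    (hθ : ∀ g Y, (∃ i, Y i ∈ 𝔨) → (θ Y : G → F ⊗[ℝ] H) g = 0) (g : G)
    (I : Fin (p + 1) → Fin N) :
    kLaplacian X (fun g Y => (θ Y : G → F ⊗[ℝ] H) g) g (fun a => X (Sum.inl (I a)))
      = (lapForm (fun k => X (Sum.inl k)) (lieDerivₗ n G (F ⊗[ℝ] H))
          (lieDerivₗ n G (F ⊗[ℝ] H)) θ (fun a => X (Sum.inl (I a))) : G → F ⊗[ℝ] H) g :=
  laplacian_apply hkp hX (B := fun _ => LinearMap.id) (fun f => SmoothFun.mdiff f)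
    (fun _ _ _ => rfl) (fun _ _ _ => rfl) hθ g I

end RepresentationOperators

/-! ### Parseval for the coefficients along the Hilbert basis, and its integrated form. -/

section Coefficients

variable {F : Type*} [NormedAddCommGroup F] [InnerProductSpace ℝ F] [FiniteDimensional ℝ F]
  {H : Type*} [NormedAddCommGroup H] [InnerProductSpace ℝ H]

theorem coeff_tmul (w : H) (u : F) (x : H) : coeff w (u ⊗ₜ[ℝ] x) = inner ℝ w x • u := by
  simp [coeff]

theorem coeff_add (w : H) (e e' : F ⊗[ℝ] H) : coeff w (e + e') = coeff w e + coeff w e' := by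
  simp [coeff]

theorem coeff_zero (w : H) : coeff w (0 : F ⊗[ℝ] H) = 0 := by simp [coeff]

/-- Taking coefficients is adjoint to u ↦ u ⊗ w; testing against the coefficient itself then yields
its norm bound. -/
theorem inner_coeff (w : H) (e : F ⊗[ℝ] H) (u : F) :
    inner ℝ (coeff w e) u = inner ℝ e (u ⊗ₜ[ℝ] w) := by
  induction e with
  | zero => simp [coeff_zero]
  | add x y hx hy => rw [coeff_add, inner_add_left, inner_add_left, hx, hy]
  | tmul a b =>
    rw [coeff_tmul, inner_smul_left, TensorProduct.inner_tmul, real_inner_comm b w, mul_comm]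
    rfl

theorem norm_coeff_le (w : H) (e : F ⊗[ℝ] H) : ‖coeff w e‖ ≤ ‖w‖ * ‖e‖ := by
  rcases eq_or_ne (coeff w e) 0 with h | h
  · rw [h, norm_zero]; positivity
  · refine le_of_mul_le_mul_right ?_ (norm_pos_iff.mpr h)
    rw [← real_inner_self_eq_norm_mul_norm, inner_coeff]
    refine (real_inner_le_norm e (coeff w e ⊗ₜ[ℝ] w)).trans_eq ?_
    rw [TensorProduct.norm_tmul (𝕜 := ℝ) (coeff w e) w]; ring

theorem continuous_coeff (w : H) : Continuous (coeff w : F ⊗[ℝ] H → F) :=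
  AddMonoidHomClass.continuous_of_bound
    (AddMonoidHom.mk' (coeff w : F ⊗[ℝ] H → F) (coeff_add w)) ‖w‖ (norm_coeff_le w)

theorem coeff_rTensor (w : H) (T : F →ₗ[ℝ] F) (e : F ⊗[ℝ] H) :
    coeff w (LinearMap.rTensor H T e) = T (coeff w e) := by
  induction e with
  | zero => simp [coeff_zero]
  | add x y hx hy => rw [map_add, coeff_add, coeff_add, map_add, hx, hy]
  | tmul a b => rw [LinearMap.rTensor_tmul, coeff_tmul, coeff_tmul, map_smul]

variable {A : Type*} [CompleteSpace H] (v : HilbertBasis A ℝ H)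

/-- Elements of the algebraic tensor product are finite sums of pure tensors, for which this is
Parseval in H. -/
theorem hasSum_inner_coeff (e e' : F ⊗[ℝ] H) :
    HasSum (fun α => inner ℝ (coeff (v α) e) (coeff (v α) e')) (inner ℝ e e') := by
  induction e with
  | zero => simp [coeff_zero]
  | add x y hx hy => simpa only [coeff_add, inner_add_left] using hx.add hy
  | tmul a b =>
    induction e' with
    | zero => simp [coeff_zero]
    | add x y hx hy => simpa only [coeff_add, inner_add_right] using hx.add hy
    | tmul c d =>
      have := (v.hasSum_inner_mul_inner b d).mul_left (inner ℝ a c)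
      simpa only [coeff_tmul, inner_smul_left, inner_smul_right, TensorProduct.inner_tmul,
        real_inner_comm, RCLike.conj_to_real, mul_comm, mul_left_comm, mul_assoc] using this

theorem hasSum_inner_rTensor_coeff (T : F →ₗ[ℝ] F) (e e' : F ⊗[ℝ] H) :
    HasSum (fun α => inner ℝ (T (coeff (v α) e)) (coeff (v α) e'))
      (inner ℝ (LinearMap.rTensor H T e) e') := by
  simpa only [coeff_rTensor] using hasSum_inner_coeff v (LinearMap.rTensor H T e) e'

variable {G : Type*} [TopologicalSpace G] [MeasurableSpace G] [BorelSpace G]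
  {μ : Measure G} [IsFiniteMeasure μ]

theorem integrable_inner_coeff (w : H) (T : F →ₗ[ℝ] F) {e e' : G → F ⊗[ℝ] H} (he : Continuous e)
    (he' : Continuous e') {C : ℝ} (hC : ∀ g, ‖e g‖ ≤ C) (hC' : ∀ g, ‖e' g‖ ≤ C) :
    Integrable (fun g => inner ℝ (T (coeff w (e g))) (coeff w (e' g))) μ := by
  have hc : Continuous (fun g => inner ℝ (T (coeff w (e g))) (coeff w (e' g))) :=
    ((T.continuous_of_finiteDimensional.comp ((continuous_coeff w).comp he))).inner
      ((continuous_coeff w).comp he')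
  refine Integrable.of_bound hc.measurable.aestronglyMeasurable
    (‖T.toContinuousLinearMap‖ * (‖w‖ * C) * (‖w‖ * C)) (ae_of_all _ fun g => ?_)
  refine (norm_inner_le_norm _ _).trans ?_
  have h1 : ‖T (coeff w (e g))‖ ≤ ‖T.toContinuousLinearMap‖ * (‖w‖ * C) :=
    (T.toContinuousLinearMap.le_opNorm _).trans (by
      gcongr; exact (norm_coeff_le w _).trans (by gcongr; exact hC g))
  have h2 : ‖coeff w (e' g)‖ ≤ ‖w‖ * C := (norm_coeff_le w _).trans (by gcongr; exact hC' g)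
  exact mul_le_mul h1 h2 (norm_nonneg _) ((norm_nonneg _).trans h1)

theorem hasSum_integral_inner_coeff [Countable A] (T : F →ₗ[ℝ] F) {e e' : G → F ⊗[ℝ] H}
    (he : Continuous e) (he' : Continuous e') {C : ℝ} (hC : ∀ g, ‖e g‖ ≤ C)
    (hC' : ∀ g, ‖e' g‖ ≤ C) :
    HasSum (fun α => ∫ g, inner ℝ (T (coeff (v α) (e g))) (coeff (v α) (e' g)) ∂μ)
      (∫ g, inner ℝ (LinearMap.rTensor H T (e g)) (e' g) ∂μ) := by
  -- The dominating series ‖T‖(‖e_α‖² + ‖e'_α‖²), from ab ≤ a² + b², is summed by Parseval to a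
  -- bounded function.
  have hb : ∀ g, HasSum (fun α => ‖T.toContinuousLinearMap‖ *
      (inner ℝ (coeff (v α) (e g)) (coeff (v α) (e g))
        + inner ℝ (coeff (v α) (e' g)) (coeff (v α) (e' g))))
      (‖T.toContinuousLinearMap‖ * (inner ℝ (e g) (e g) + inner ℝ (e' g) (e' g))) := fun g =>
    ((hasSum_inner_coeff v (e g) (e g)).add (hasSum_inner_coeff v (e' g) (e' g))).mul_left _
  refine hasSum_integral_of_dominated_convergence _
    (fun α => (integrable_inner_coeff (v α) T he he' hC hC').aestronglyMeasurable)
    (fun α => ae_of_all _ fun g => ?_) (ae_of_all _ fun g => (hb g).summable) ?_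
    (ae_of_all _ fun g => hasSum_inner_rTensor_coeff v T (e g) (e' g))
  · refine (norm_inner_le_norm _ _).trans ?_
    have h1 : ‖T (coeff (v α) (e g))‖ ≤ ‖T.toContinuousLinearMap‖ * ‖coeff (v α) (e g)‖ :=
      T.toContinuousLinearMap.le_opNorm _
    refine (mul_le_mul_of_nonneg_right h1 (norm_nonneg _)).trans ?_
    rw [mul_assoc]
    refine mul_le_mul_of_nonneg_left ?_ (norm_nonneg _)
    rw [real_inner_self_eq_norm_sq, real_inner_self_eq_norm_sq]
    nlinarith [sq_nonneg (‖coeff (v α) (e g)‖ - ‖coeff (v α) (e' g)‖),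
      sq_nonneg ‖coeff (v α) (e g)‖, sq_nonneg ‖coeff (v α) (e' g)‖]
  · simp only [(hb _).tsum_eq]
    have hi : ∀ {f : G → F ⊗[ℝ] H}, Continuous f → (∀ g, ‖f g‖ ≤ C) →
        Integrable (fun g => (inner ℝ (f g) (f g) : ℝ)) μ := fun {f} hf hfC => by
      refine Integrable.of_bound (hf.inner hf).measurable.aestronglyMeasurable (C * C)
        (ae_of_all _ fun g => (norm_inner_le_norm (𝕜 := ℝ) (f g) (f g)).trans ?_)
      exact mul_le_mul (hfC g) (hfC g) (norm_nonneg _) ((norm_nonneg _).trans (hfC g))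
    exact ((hi he hC).add (hi he' hC')).const_mul _

end Coefficients

/-! ### Pointwise inner products as sums over all index tuples. -/

theorem IsAlt.insertNth {r N : ℕ} {E : Type*} [AddCommGroup E] [Module ℝ E]
    {w : (Fin (r + 1) → Fin N) → E} (hw : IsAlt w) (i : Fin (r + 1)) (j : Fin N)
    (I : Fin r → Fin N) : w (i.insertNth j I) = (-1 : ℝ) ^ (i : ℕ) • w (Fin.cons j I) := by
  have := hw.perm (Fin.cons j I) (Fin.cycleRange i)
  rw [Fin.cons_comp_cycleRange] at this
  rw [this, ← Int.cast_smul_eq_zsmul ℝ]; simp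

section Frame

variable {n N m p : ℕ} {G : Type*} [TopologicalSpace G]
  [ChartedSpace (EuclideanSpace ℝ (Fin n)) G] [Group G]
  {E : Type*} [NormedAddCommGroup E] [InnerProductSpace ℝ E]
  {X : Basis (Fin N ⊕ Fin m) ℝ (Lie n G)}

theorem IsAlt.inner_perm {u w : (Fin p → Fin N) → E} (hu : IsAlt u) (hw : IsAlt w)
    (I : Fin p → Fin N) (σ : Equiv.Perm (Fin p)) :
    inner ℝ (u (I ∘ σ)) (w (I ∘ σ)) = inner ℝ (u I) (w I) := by
  rw [hu.perm, hw.perm, ← Int.cast_smul_eq_zsmul ℝ, ← Int.cast_smul_eq_zsmul ℝ,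
    real_inner_smul_left, real_inner_smul_right, ← mul_assoc, sign_mul_self, one_mul]

theorem pointwiseInner_eq {β θ : LForm n G E p} {u w : (Fin p → Fin N) → E} (hu : IsAlt u)
    (hw : IsAlt w) {g : G} (hβ : ∀ I : Fin p → Fin N, β g (fun a => X (Sum.inl (I a))) = u I)
    (hθ : ∀ I : Fin p → Fin N, θ g (fun a => X (Sum.inl (I a))) = w I) :
    pointwiseInner X β θ g = (1 / (p ! : ℝ)) * ∑ I, inner ℝ (u I) (w I) := by
  rw [sum_fun_eq_factorial_mul_sum_orderEmbedding (hu.inner_perm hw)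
    (fun I hI => by rw [hu.zero I hI, inner_zero_left]), ← mul_assoc,
    one_div_mul_cancel (by positivity), one_mul, pointwiseInner]
  exact Finset.sum_congr rfl fun I _ => by rw [hβ, hθ]

variable (n G E) in
/-- Evaluation at a point. -/
def SmoothFun.eval (g : G) : SmoothFun n G E →ₗ[ℝ] E :=
  LinearMap.proj g ∘ₗ (SmoothFun n G E).subtype

theorem SmoothFun.isAlt (θ : (Lie n G) [⋀^Fin p]→ₗ[ℝ] SmoothFun n G E) (g : G) :
    IsAlt (fun I : Fin p → Fin N => (θ (fun a => X (Sum.inl (I a))) : G → E) g) :=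
  AlternatingMap.isAlt ((SmoothFun.eval n G E g).compAlternatingMap θ) (fun k => X (Sum.inl k))

/-- A smooth form as an alternating map with values in the smooth functions. -/
def smoothForm (β : G → (Lie n G) [⋀^Fin p]→ₗ[ℝ] E)
    (hβ : ∀ Y : Fin p → Lie n G, ContMDiff (𝓡 n) 𝓘(ℝ, E) ∞ (fun g => β g Y)) :
    (Lie n G) [⋀^Fin p]→ₗ[ℝ] SmoothFun n G E where
  toFun Y := ⟨fun g => β g Y, hβ Y⟩
  map_update_add' Y i a b := Subtype.ext (funext fun g => (β g).map_update_add Y i a b)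
  map_update_smul' Y i c a := Subtype.ext (funext fun g => (β g).map_update_smul Y i c a)
  map_eq_zero_of_eq' Y _ _ h hij := Subtype.ext (funext fun g => (β g).map_eq_zero_of_eq Y h hij)

theorem smoothForm_apply (β : G → (Lie n G) [⋀^Fin p]→ₗ[ℝ] E)
    (hβ : ∀ Y : Fin p → Lie n G, ContMDiff (𝓡 n) 𝓘(ℝ, E) ∞ (fun g => β g Y))
    (Y : Fin p → Lie n G) (g : G) : (smoothForm β hβ Y : G → E) g = β g Y := rfl

/-- The sum over frames of the second order term that comes from the commutators. -/
theorem sum_commutator_term (S : Fin N → Fin N → E →ₗ[ℝ] E)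
    {w : (Fin (p + 1) → Fin N) → E} (hw : IsAlt w) :
    ∑ I : Fin (p + 1) → Fin N, inner ℝ (∑ i : Fin (p + 1), ∑ k, (-1 : ℝ) ^ (i : ℕ) •
        S (I i) k (w (Fin.cons k (i.removeNth I)))) (w I)
      = ((p + 1 : ℕ) : ℝ) * ∑ h, ∑ I : Fin p → Fin N, ∑ k,
        inner ℝ (S h k (w (Fin.cons k I))) (w (Fin.cons h I)) := by
  simp only [sum_inner]
  rw [Finset.sum_comm]
  -- Bringing the index in slot i to the front produces a second (-1)^i, so every slot contributes
  -- the same sum.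
  have : ∀ i : Fin (p + 1), ∑ I : Fin (p + 1) → Fin N, ∑ k, inner ℝ ((-1 : ℝ) ^ (i : ℕ) •
        S (I i) k (w (Fin.cons k (i.removeNth I)))) (w I)
      = ∑ h, ∑ I : Fin p → Fin N, ∑ k, inner ℝ (S h k (w (Fin.cons k I))) (w (Fin.cons h I)) := by
    intro i
    rw [← (Fin.insertNthEquiv (fun _ => Fin N) i).sum_comp, Fintype.sum_prod_type]
    refine Finset.sum_congr rfl fun h _ => Finset.sum_congr rfl fun I _ =>
      Finset.sum_congr rfl fun k _ => ?_
    simp only [Fin.insertNthEquiv, Equiv.coe_fn_mk, Fin.removeNth_insertNth,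
      Fin.insertNth_apply_same, hw.insertNth]
    rw [real_inner_smul_left, real_inner_smul_right, ← mul_assoc, ← pow_add, ← two_mul, pow_mul]
    simp
  rw [Finset.sum_congr rfl fun i _ => this i]
  simp

end Frame

/-! ### The pointwise formula for the difference of the Laplacians. -/

section Pointwise

variable {n N m p : ℕ} {G : Type*} [TopologicalSpace G]
  [ChartedSpace (EuclideanSpace ℝ (Fin n)) G] [Group G] [LieGroup (𝓡 n) ∞ G]
  {F : Type*} [NormedAddCommGroup F] [InnerProductSpace ℝ F] [FiniteDimensional ℝ F]
  {H : Type*} [NormedAddCommGroup H] [InnerProductSpace ℝ H]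
  {π₁ : Representation ℝ G F} (hπ₁ : ∀ u : F, ContMDiff (𝓡 n) 𝓘(ℝ, F) ∞ (fun g => π₁ g u))
  {K : Subgroup G} {𝔨 𝔭 : Submodule ℝ (Lie n G)} {X : Basis (Fin N ⊕ Fin m) ℝ (Lie n G)}

theorem rTensor_dRepₗ_lie (Y Z : Lie n G) (e : F ⊗[ℝ] H) :
    LinearMap.rTensor H (dRepₗ hπ₁ Y) (LinearMap.rTensor H (dRepₗ hπ₁ Z) e)
      - LinearMap.rTensor H (dRepₗ hπ₁ Z) (LinearMap.rTensor H (dRepₗ hπ₁ Y) e)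
      = LinearMap.rTensor H (dRepₗ hπ₁ ⁅Y, Z⁆) e := by
  have : dRepₗ hπ₁ ⁅Y, Z⁆ = dRepₗ hπ₁ Y ∘ₗ dRepₗ hπ₁ Z - dRepₗ hπ₁ Z ∘ₗ dRepₗ hπ₁ Y :=
    LinearMap.ext fun u => dRep_lie hπ₁ Y Z u
  rw [this, LinearMap.rTensor_sub, LinearMap.rTensor_comp, LinearMap.rTensor_comp]
  rfl

/-- The pointwise form of the difference of the two Laplacians. -/
theorem pointwiseInner_flatLaplacian_sub (hkp : IsCartanDecomposition 𝔨 𝔭)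
    (hX : IsCartanBasis 𝔨 𝔭 X) (hF : IsAdmissible π₁ K 𝔨 𝔭)
    {θ : (Lie n G) [⋀^Fin (p + 1)]→ₗ[ℝ] SmoothFun n G (F ⊗[ℝ] H)}
    (hθ : ∀ g Y, (∃ i, Y i ∈ 𝔨) → (θ Y : G → F ⊗[ℝ] H) g = 0) (g : G) :
    let β : LForm n G (F ⊗[ℝ] H) (p + 1) := fun g Y => (θ Y : G → F ⊗[ℝ] H) g
    let w : (Fin (p + 1) → Fin N) → F ⊗[ℝ] H := fun I => β g (fun a => X (Sum.inl (I a)))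
    pointwiseInner X (flatLaplacian π₁ X β) β g - pointwiseInner X (kLaplacian X β) β g
      = 1 / ((p + 1)! : ℝ) * ∑ I : Fin (p + 1) → Fin N,
          inner ℝ (LinearMap.rTensor H
            (∑ k, dRepₗ hπ₁ (X (Sum.inl k)) ∘ₗ dRepₗ hπ₁ (X (Sum.inl k))) (w I)) (w I)
        + 1 / (p ! : ℝ) * ∑ h, ∑ I : Fin p → Fin N, ∑ k,
          inner ℝ (LinearMap.rTensor H (dRepₗ hπ₁ ⁅X (Sum.inl h), X (Sum.inl k)⁆)
            (w (Fin.cons k I))) (w (Fin.cons h I)) := by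
  intro β w
  have hw : IsAlt w := SmoothFun.isAlt θ g
  rw [pointwiseInner_eq (SmoothFun.isAlt _ g) hw
      (fun I => flatLaplacian_apply hπ₁ hkp hX hF hθ g I) (fun _ => rfl),
    pointwiseInner_eq (SmoothFun.isAlt _ g) hw
      (fun I => kLaplacian_apply hkp hX hθ g I) (fun _ => rfl),
    ← mul_sub, ← Finset.sum_sub_distrib]
  have hcons : ∀ (I : Fin (p + 1) → Fin N) (i : Fin (p + 1)) k,
      (Fin.cons (X (Sum.inl k)) (i.removeNth fun a => X (Sum.inl (I a))) :
        Fin (p + 1) → Lie n G)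
      = fun a => X (Sum.inl ((Fin.cons k (i.removeNth I) : Fin (p + 1) → Fin N) a)) := by
    intro I i k
    ext1 a; refine Fin.cases ?_ (fun a => ?_) a <;> simp [Fin.removeNth]
  have hdiff : ∀ I : Fin (p + 1) → Fin N,
      (lapForm (fun k => X (Sum.inl k)) (lieDerivₗ n G (F ⊗[ℝ] H) + repOp H hπ₁)
          (lieDerivₗ n G (F ⊗[ℝ] H) + (-1 : ℝ) • repOp H hπ₁) θ (fun a => X (Sum.inl (I a))) :
          G → F ⊗[ℝ] H) g
        - (lapForm (fun k => X (Sum.inl k)) (lieDerivₗ n G (F ⊗[ℝ] H))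
          (lieDerivₗ n G (F ⊗[ℝ] H)) θ (fun a => X (Sum.inl (I a))) : G → F ⊗[ℝ] H) g
      = LinearMap.rTensor H
            (∑ k, dRepₗ hπ₁ (X (Sum.inl k)) ∘ₗ dRepₗ hπ₁ (X (Sum.inl k))) (w I)
        + ∑ i : Fin (p + 1), ∑ k, (-1 : ℝ) ^ (i : ℕ) • LinearMap.rTensor H
          (dRepₗ hπ₁ ⁅X (Sum.inl (I i)), X (Sum.inl k)⁆) (w (Fin.cons k (i.removeNth I))) := by
    intro I
    have h := congrArg (SmoothFun.eval n G (F ⊗[ℝ] H) g)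
      (lapForm_sub (fun k => X (Sum.inl k)) (lieDerivₗ n G (F ⊗[ℝ] H)) (repOp H hπ₁)
        (lieDerivₗ_repOp hπ₁) θ (fun a => X (Sum.inl (I a))))
    rw [map_sub, map_add, map_sum, map_sum] at h
    refine h.trans ?_
    congr 1
    · rw [← LinearMap.coe_rTensorHom, map_sum, LinearMap.sum_apply]
      refine Finset.sum_congr rfl fun k _ => ?_
      rw [LinearMap.coe_rTensorHom, LinearMap.rTensor_comp]
      rfl
    · refine Finset.sum_congr rfl fun i _ => ?_
      rw [map_sum]
      refine Finset.sum_congr rfl fun k _ => ?_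
      rw [map_smul, map_sub, hcons, ← rTensor_dRepₗ_lie]
      rfl
  simp only [← inner_sub_left, hdiff, inner_add_left, Finset.sum_add_distrib, mul_add]
  congr 1
  rw [sum_commutator_term
    (fun h k => LinearMap.rTensor H (dRepₗ hπ₁ ⁅X (Sum.inl h), X (Sum.inl k)⁆)) hw, ← mul_assoc]
  congr 1
  -- The p + 1 equal slots turn 1/(p+1)! into 1/p!.
  rw [Nat.factorial_succ]
  push_cast
  field_simp

end Pointwise

/-! ### Equivariance under the structure group. -/

section Translate

variable {n N m p : ℕ} {G : Type*} [TopologicalSpace G]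
  [ChartedSpace (EuclideanSpace ℝ (Fin n)) G] [Group G] [LieGroup (𝓡 n) ∞ G]
  {E : Type*} [NormedAddCommGroup E] [InnerProductSpace ℝ E]

theorem contMDiff_mul_mul (a b : G) : ContMDiff (𝓡 n) (𝓡 n) ∞ (fun x : G => a * x * b) :=
  (contMDiff_mul_right (n := ∞)).comp (contMDiff_mul_left (n := ∞))

/-- The operator `f ↦ T ∘ f ∘ (g ↦ a g b)` on smooth functions. -/
def translate (a b : G) (T : E →L[ℝ] E) : Module.End ℝ (SmoothFun n G E) where
  toFun f := ⟨fun g => T ((f : G → E) (a * g * b)),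
    T.contMDiff.comp (f.2.comp (contMDiff_mul_mul a b))⟩
  map_add' _ _ := Subtype.ext (funext fun _ => T.map_add _ _)
  map_smul' _ _ := Subtype.ext (funext fun _ => T.map_smul _ _)

theorem translate_apply (a b : G) (T : E →L[ℝ] E) (f : SmoothFun n G E) (g : G) :
    (translate a b T f : G → E) g = T ((f : G → E) (a * g * b)) := rfl

theorem Ad_inv_Ad (k : G) (Y : Lie n G) : Ad k⁻¹ (Ad k Y) = Y := by
  rw [← Ad_mul, inv_mul_cancel, Ad_one]

theorem translate_lieDerivₗ (a k : G) (T : E →L[ℝ] E) (Y : Lie n G) (f : SmoothFun n G E) :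
    translate a k T (lieDerivₗ n G E Y f) = lieDerivₗ n G E (Ad k Y) (translate a k T f) := by
  refine Subtype.ext (funext fun g => ?_)
  have h1 : MDifferentiable (𝓡 n) 𝓘(ℝ, E) (fun x => (f : G → E) (a * x * k)) :=
    (f.2.comp (contMDiff_mul_mul a k)).mdifferentiable (by simp)
  have h2 := lieDeriv_clm_comp (Ad k Y) T (h1 g)
  rw [← lieDeriv_comp_mul (Ad k Y) a k g (SmoothFun.mdiff f), Ad_inv_Ad] at h2
  exact h2.symm

/-- The form `θ` is the lift of a form on the base: translating by `(a, k)` is the same as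
rotating the arguments by `Ad k`. -/
def IsEquivariantAt (a k : G) (T : E →L[ℝ] E)
    (θ : (Lie n G) [⋀^Fin p]→ₗ[ℝ] SmoothFun n G E) : Prop :=
  ∀ Y : Fin p → Lie n G, translate a k T (θ Y) = θ (Ad k ∘ Y)

/-- Translation becomes an isometry of E together with an orthogonal change of frame, and neither
changes the sum over frames. -/
theorem IsEquivariantAt.sum_inner {X : Fin N → Lie n G} {a k : G} {T : E →L[ℝ] E}
    {ψ θ : (Lie n G) [⋀^Fin p]→ₗ[ℝ] SmoothFun n G E} (hψ : IsEquivariantAt a k T ψ)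
    (hθ : IsEquivariantAt a k T θ) (hT : ∀ e e', inner ℝ (T e) (T e') = inner ℝ e e')
    {O : Matrix (Fin N) (Fin N) ℝ} (hO : O.transpose * O = 1)
    (hX : ∀ i, Ad k (X i) = ∑ j, O i j • X j) (g : G) :
    ∑ I : Fin p → Fin N, inner ℝ ((ψ (fun i => X (I i)) : G → E) (a * g * k))
        ((θ (fun i => X (I i)) : G → E) (a * g * k))
      = ∑ I : Fin p → Fin N, inner ℝ ((ψ (fun i => X (I i)) : G → E) g)
        ((θ (fun i => X (I i)) : G → E) g) := by
  have h : ∀ I : Fin p → Fin N, inner ℝ ((ψ (fun i => X (I i)) : G → E) (a * g * k))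
        ((θ (fun i => X (I i)) : G → E) (a * g * k))
      = inner ℝ ((ψ ((Ad k ∘ X) ∘ I) : G → E) g) ((θ ((Ad k ∘ X) ∘ I) : G → E) g) := fun I => by
    rw [← hT, ← translate_apply, ← translate_apply, hψ, hθ]
    rfl
  rw [Finset.sum_congr rfl fun I _ => h I]
  exact sum_inner_orthogonal
    ((SmoothFun.eval n G E g).compMultilinearMap ψ.toMultilinearMap)
    ((SmoothFun.eval n G E g).compMultilinearMap θ.toMultilinearMap) X (Ad k ∘ X) O hO hX

/-- By naturality, translation replaces the frame by its Ad k-image, on which the Laplacian does not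
depend. -/
theorem IsEquivariantAt.lapForm {X : Fin N → Lie n G} {a k : G} {T : E →L[ℝ] E}
    {θ : (Lie n G) [⋀^Fin (p + 1)]→ₗ[ℝ] SmoothFun n G E} (hθ : IsEquivariantAt a k T θ)
    {D D' : Lie n G →ₗ[ℝ] Module.End ℝ (SmoothFun n G E)}
    (hD : ∀ Y f, translate a k T (D Y f) = D (Ad k Y) (translate a k T f))
    (hD' : ∀ Y f, translate a k T (D' Y f) = D' (Ad k Y) (translate a k T f))
    {O : Matrix (Fin N) (Fin N) ℝ} (hO : O.transpose * O = 1)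
    (hX : ∀ i, Ad k (X i) = ∑ j, O i j • X j) :
    IsEquivariantAt a k T (BochnerFormula.lapForm X D D' θ) := fun Y => by
  rw [lapForm_natural X (Ad k ∘ X) D D' θ (Ad k) (translate a k T) (fun _ => rfl) hD hD' hθ,
    lapForm_orthogonal X (Ad k ∘ X) D D' θ O hO hX]

end Translate

/-! ### Γ × K-invariance of the pointwise products. -/

section Bundle

variable {n N m p : ℕ} {G : Type*} [TopologicalSpace G]
  [ChartedSpace (EuclideanSpace ℝ (Fin n)) G] [Group G] [LieGroup (𝓡 n) ∞ G]
  {F : Type*} [NormedAddCommGroup F] [InnerProductSpace ℝ F] [FiniteDimensional ℝ F]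
  {H : Type*} [NormedAddCommGroup H] [InnerProductSpace ℝ H]
  {π₁ : Representation ℝ G F} (hπ₁ : ∀ u : F, ContMDiff (𝓡 n) 𝓘(ℝ, F) ∞ (fun g => π₁ g u))
  {Γ K : Subgroup G} {𝔨 𝔭 : Submodule ℝ (Lie n G)} {X : Basis (Fin N ⊕ Fin m) ℝ (Lie n G)}
  {π₂ : Representation ℝ Γ H}

/-- The operators `σ'(γ, k)` are isometries. -/
def sigmaIsometry (hF : IsAdmissible π₁ K 𝔨 𝔭) (hπ₂ : ∀ γ w, ‖π₂ γ w‖ = ‖w‖) (γ : Γ) (k : K) :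
    F ⊗[ℝ] H →ₗᵢ[ℝ] F ⊗[ℝ] H :=
  TensorProduct.mapIsometry ⟨π₁ k, fun u => by
    rw [norm_eq_sqrt_real_inner, hF.invariant k k.2, ← norm_eq_sqrt_real_inner]⟩ ⟨π₂ γ, hπ₂ γ⟩

/-- On F this is π₁(k) dπ₁(Y) = dπ₁(Ad k Y) π₁(k); the factor π₂(γ) acts on H and commutes with
everything in sight. -/
theorem translate_repOp (hF : IsAdmissible π₁ K 𝔨 𝔭) (hπ₂ : ∀ γ w, ‖π₂ γ w‖ = ‖w‖) (γ : Γ)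
    (k : K) (a : G) (Y : Lie n G) (f : SmoothFun n G (F ⊗[ℝ] H)) :
    translate a (k : G) (sigmaIsometry hF hπ₂ γ k).toContinuousLinearMap (repOp H hπ₁ Y f)
      = repOp H hπ₁ (Ad (k : G) Y)
        (translate a (k : G) (sigmaIsometry hF hπ₂ γ k).toContinuousLinearMap f) := by
  refine Subtype.ext (funext fun g => ?_)
  change TensorProduct.map (π₁ k) (π₂ γ) (LinearMap.rTensor H (dRepₗ hπ₁ Y) _)
    = LinearMap.rTensor H (dRepₗ hπ₁ (Ad (k : G) Y)) (TensorProduct.map (π₁ k) (π₂ γ) _)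
  rw [← LinearMap.comp_apply, ← LinearMap.comp_apply, LinearMap.map_comp_rTensor,
    LinearMap.rTensor_comp_map]
  congr 2
  refine LinearMap.ext fun u => ?_
  have h := dRep_Ad hπ₁ (k : G)⁻¹ Y u
  rw [inv_inv] at h
  exact h.symm

theorem isEquivariantAt_smoothForm (hF : IsAdmissible π₁ K 𝔨 𝔭) (hπ₂ : ∀ γ w, ‖π₂ γ w‖ = ‖w‖)
    {η : G → (Lie n G) [⋀^Fin p]→ₗ[ℝ] (F ⊗[ℝ] H)} (hη : IsLift 𝔨 (sigma' K π₁ π₂) η) (γ : Γ)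
    (k : K) : IsEquivariantAt (γ : G)⁻¹ (k : G)
      (sigmaIsometry hF hπ₂ γ k).toContinuousLinearMap (smoothForm η hη.smooth) := fun Y => by
  refine Subtype.ext (funext fun g => ?_)
  have h := hη.equivariant γ k g (Ad (k : G) ∘ Y)
  simp only [Function.comp_apply, Ad_inv_Ad] at h
  rw [translate_apply, smoothForm_apply, h]
  change sigma' K π₁ π₂ (γ, k) _ = _
  rw [← Module.End.mul_apply, ← map_mul, mul_inv_cancel, map_one]
  rfl

variable (hX : IsCartanBasis 𝔨 𝔭 X) (hK : IsLieAlgebraOf 𝔨 K) (hkp : IsCartanDecomposition 𝔨 𝔭)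
include hX hK hkp

theorem pointwiseInner_invariant (hF : IsAdmissible π₁ K 𝔨 𝔭) (hπ₂ : ∀ γ w, ‖π₂ γ w‖ = ‖w‖)
    {η : G → (Lie n G) [⋀^Fin (p + 1)]→ₗ[ℝ] (F ⊗[ℝ] H)} (hη : IsLift 𝔨 (sigma' K π₁ π₂) η)
    {D D' : Lie n G →ₗ[ℝ] Module.End ℝ (SmoothFun n G (F ⊗[ℝ] H))}
    (hD : ∀ (γ : Γ) (k : K) Y f,
      translate (γ : G)⁻¹ (k : G) (sigmaIsometry hF hπ₂ γ k).toContinuousLinearMap (D Y f)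
      = D (Ad (k : G) Y)
        (translate (γ : G)⁻¹ (k : G) (sigmaIsometry hF hπ₂ γ k).toContinuousLinearMap f))
    (hD' : ∀ (γ : Γ) (k : K) Y f,
      translate (γ : G)⁻¹ (k : G) (sigmaIsometry hF hπ₂ γ k).toContinuousLinearMap (D' Y f)
      = D' (Ad (k : G) Y)
        (translate (γ : G)⁻¹ (k : G) (sigmaIsometry hF hπ₂ γ k).toContinuousLinearMap f))
    {Δη : LForm n G (F ⊗[ℝ] H) (p + 1)}
    (hΔ : ∀ g (I : Fin (p + 1) → Fin N), Δη g (fun a => X (Sum.inl (I a)))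
      = (lapForm (fun k => X (Sum.inl k)) D D' (smoothForm η hη.smooth)
          (fun a => X (Sum.inl (I a))) : G → F ⊗[ℝ] H) g) :
    Continuous (fun g => pointwiseInner X Δη (fun g Y => η g Y) g) ∧
      ∀ (γ : Γ) (k : K) g, pointwiseInner X Δη (fun g Y => η g Y) (γ * g * k)
        = pointwiseInner X Δη (fun g Y => η g Y) g := by
  set θ := smoothForm η hη.smooth with hθ
  have key : ∀ g, pointwiseInner X Δη (fun g Y => η g Y) g = (1 / ((p + 1)! : ℝ)) *
      ∑ I : Fin (p + 1) → Fin N, inner ℝ ((lapForm (fun k => X (Sum.inl k)) D D' θ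
          (fun a => X (Sum.inl (I a))) : G → F ⊗[ℝ] H) g)
        ((θ (fun a => X (Sum.inl (I a))) : G → F ⊗[ℝ] H) g) := fun g =>
    pointwiseInner_eq (SmoothFun.isAlt _ g) (SmoothFun.isAlt θ g) (hΔ g) (fun _ => rfl)
  refine ⟨?_, fun γ k g => ?_⟩
  · simp only [key]
    refine continuous_const.mul (continuous_finsetSum _ fun I _ => ?_)
    exact (SmoothFun.contMDiff _).continuous.inner (SmoothFun.contMDiff _).continuous
  · obtain ⟨O, hO, hOX⟩ := hX.exists_orthogonal hK hkp k.2
    rw [key, key]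
    congr 1
    -- Equivariance is phrased with translation by γ⁻¹, hence the inverse here.
    have he := isEquivariantAt_smoothForm hF hπ₂ hη γ⁻¹ k
    have h := IsEquivariantAt.sum_inner
      (he.lapForm (hD γ⁻¹ k) (hD' γ⁻¹ k) hO hOX) he
      (sigmaIsometry hF hπ₂ γ⁻¹ k).inner_map_map hO hOX g
    simpa using h

theorem flatLaplacian_invariant (hF : IsAdmissible π₁ K 𝔨 𝔭) (hπ₂ : ∀ γ w, ‖π₂ γ w‖ = ‖w‖)
    (hπ₁ : ∀ u : F, ContMDiff (𝓡 n) 𝓘(ℝ, F) ∞ (fun g => π₁ g u))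
    {η : G → (Lie n G) [⋀^Fin (p + 1)]→ₗ[ℝ] (F ⊗[ℝ] H)} (hη : IsLift 𝔨 (sigma' K π₁ π₂) η) :
    let β : LForm n G (F ⊗[ℝ] H) (p + 1) := fun g Y => η g Y
    Continuous (fun g => pointwiseInner X (flatLaplacian π₁ X β) β g) ∧
      ∀ (γ : Γ) (k : K) g, pointwiseInner X (flatLaplacian π₁ X β) β (γ * g * k)
        = pointwiseInner X (flatLaplacian π₁ X β) β g := by
  have h1 : ∀ (c : ℝ) (γ : Γ) (k : K) Y f,
      translate (γ : G)⁻¹ (k : G) (sigmaIsometry hF hπ₂ γ k).toContinuousLinearMap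
        ((lieDerivₗ n G (F ⊗[ℝ] H) + c • repOp H hπ₁) Y f)
      = (lieDerivₗ n G (F ⊗[ℝ] H) + c • repOp H hπ₁) (Ad (k : G) Y)
        (translate (γ : G)⁻¹ (k : G) (sigmaIsometry hF hπ₂ γ k).toContinuousLinearMap f) := by
    intro c γ k Y f
    rw [LinearMap.add_apply, LinearMap.add_apply, LinearMap.add_apply, LinearMap.add_apply,
      map_add, LinearMap.smul_apply, LinearMap.smul_apply, LinearMap.smul_apply,
      LinearMap.smul_apply, map_smul, translate_lieDerivₗ, translate_repOp]
  have h2 := h1 1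
  simp only [one_smul] at h2
  exact pointwiseInner_invariant hX hK hkp hF hπ₂ hη h2 (h1 (-1))
    (fun g I => flatLaplacian_apply (θ := smoothForm η hη.smooth) hπ₁ hkp hX hF hη.horizontal g I)

theorem kLaplacian_invariant (hF : IsAdmissible π₁ K 𝔨 𝔭) (hπ₂ : ∀ γ w, ‖π₂ γ w‖ = ‖w‖)
    {η : G → (Lie n G) [⋀^Fin (p + 1)]→ₗ[ℝ] (F ⊗[ℝ] H)} (hη : IsLift 𝔨 (sigma' K π₁ π₂) η) :
    let β : LForm n G (F ⊗[ℝ] H) (p + 1) := fun g Y => η g Y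
    Continuous (fun g => pointwiseInner X (kLaplacian X β) β g) ∧
      ∀ (γ : Γ) (k : K) g, pointwiseInner X (kLaplacian X β) β (γ * g * k)
        = pointwiseInner X (kLaplacian X β) β g :=
  pointwiseInner_invariant hX hK hkp hF hπ₂ hη
    (fun _ _ _ _ => translate_lieDerivₗ _ _ _ _ _) (fun _ _ _ _ => translate_lieDerivₗ _ _ _ _ _)
    (fun g I => kLaplacian_apply (θ := smoothForm η hη.smooth) hkp hX hη.horizontal g I)

omit hX hK hkp in
theorem norm_lift_invariant (hF : IsAdmissible π₁ K 𝔨 𝔭) (hπ₂ : ∀ γ w, ‖π₂ γ w‖ = ‖w‖)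
    {η : G → (Lie n G) [⋀^Fin p]→ₗ[ℝ] (F ⊗[ℝ] H)} (hη : IsLift 𝔨 (sigma' K π₁ π₂) η)
    (γ : Γ) (g : G) (Y : Fin p → Lie n G) : ‖η (γ * g) Y‖ = ‖η g Y‖ := by
  have h := congrArg (fun f : SmoothFun n G (F ⊗[ℝ] H) => ‖(f : G → F ⊗[ℝ] H) g‖)
    (isEquivariantAt_smoothForm hF hπ₂ hη γ⁻¹ 1 Y)
  have e : Ad ((1 : K) : G) ∘ Y = Y := funext fun i => Ad_one (Y i)
  simp only [e, translate_apply, smoothForm_apply] at h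
  rw [← h]
  simp

end Bundle

/-! ### Comparing integrals over D and over M. -/

section QuotientMeasure

variable {G : Type*} [TopologicalSpace G] [Group G] [IsTopologicalGroup G] {Γ K : Subgroup G}

/-- The projection to the orbit space is open, so finitely many images of interiors of compact
neighbourhoods cover it. -/
theorem exists_compact_cover [LocallyCompactSpace G]
    [CompactSpace (MulAction.orbitRel.Quotient Γ G)] :
    ∃ C : Set G, IsCompact C ∧ ∀ g : G, ∃ γ : Γ, (γ : G) * g ∈ C := by
  have hq : IsOpenMap (Quotient.mk _ : G → MulAction.orbitRel.Quotient Γ G) :=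
    isOpenMap_quotient_mk'_mul
  choose V hV hV' using fun g : G => exists_compact_mem_nhds g
  obtain ⟨t, ht⟩ := isCompact_univ.elim_finite_subcover
    (fun g : G => (Quotient.mk _ : G → MulAction.orbitRel.Quotient Γ G) '' interior (V g))
    (fun g => hq _ isOpen_interior) (fun x _ => by
      obtain ⟨g, rfl⟩ := Quotient.mk_surjective x
      exact Set.mem_iUnion.mpr ⟨g, g, mem_interior_iff_mem_nhds.mpr (hV' g), rfl⟩)
  refine ⟨⋃ g ∈ t, V g, t.isCompact_biUnion fun g _ => hV g, fun g => ?_⟩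
  have hg := ht (Set.mem_univ (Quotient.mk _ g))
  simp only [Set.mem_iUnion] at hg
  obtain ⟨a, ha, b, hb, hbg⟩ := hg
  obtain ⟨γ, hγ⟩ : MulAction.orbitRel Γ G b g := Quotient.exact hbg
  refine ⟨γ, Set.mem_biUnion ha ?_⟩
  have : (γ : G) * g = b := hγ
  rw [this]
  exact interior_subset hb

theorem exists_bound_of_invariant [LocallyCompactSpace G]
    [CompactSpace (MulAction.orbitRel.Quotient Γ G)] {f : G → ℝ} (hf : Continuous f)
    (hinv : ∀ (γ : Γ) g, f (γ * g) = f g) : ∃ c, ∀ g, ‖f g‖ ≤ c := by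
  obtain ⟨C, hC, hcov⟩ := exists_compact_cover (Γ := Γ)
  obtain ⟨c, hc⟩ := hC.exists_bound_of_continuousOn hf.continuousOn
  refine ⟨c, fun g => ?_⟩
  obtain ⟨γ, hγ⟩ := hcov g
  rw [← hinv γ]
  exact hc _ hγ

variable [MeasurableSpace G] [BorelSpace G] [T2Space G] [SecondCountableTopology G]
  [LocallyCompactSpace G] [DiscreteTopology Γ]

variable (Γ) in
/-- A measurable partition of unity for the action of a cocompact lattice. -/
theorem exists_partition_of_unity [CompactSpace (MulAction.orbitRel.Quotient Γ G)]
    (μG : Measure G) [IsFiniteMeasureOnCompacts μG] :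
    ∃ ψ : G → ℝ≥0∞, Measurable ψ ∧ (∀ g, ∑' γ : Γ, ψ (γ * g) = 1) ∧ ∫⁻ g, ψ g ∂μG < ⊤ := by
  have hΓc : Countable Γ := countable_of_Lindelof_of_discrete
  obtain ⟨C, hC, hcov⟩ := exists_compact_cover (Γ := Γ)
  -- Let C be compact with ΓC = G. The multiplicity s is at least 1 by covering and finite by
  -- discreteness, so u / s is normalized and has integral at most the measure of C.
  let u : G → ℝ≥0∞ := C.indicator 1
  have hu : Measurable u := measurable_one.indicator hC.isClosed.measurableSet
  let s : G → ℝ≥0∞ := fun g => ∑' γ : Γ, u (γ * g)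
  have hs : Measurable s := Measurable.tsum fun γ => hu.comp (measurable_const_mul _)
  have hs1 : ∀ g, 1 ≤ s g := fun g => by
    obtain ⟨γ, hγ⟩ := hcov g
    calc (1 : ℝ≥0∞) = u (γ * g) := by simp [u, hγ]
      _ ≤ s g := ENNReal.le_tsum γ
  have hst : ∀ g, s g ≠ ⊤ := fun g => by
    have hfin : {γ : Γ | (γ : G) * g ∈ C}.Finite := by
      have h := Subgroup.tendsto_coe_cofinite_of_discrete Γ
        (isDiscrete_iff_discreteTopology.mpr inferInstance)
        ((hC.image (continuous_mul_const g⁻¹)).compl_mem_cocompact)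
      rw [Filter.mem_map, Filter.mem_cofinite] at h
      refine h.subset fun γ hγ => ?_
      simp only [Set.mem_compl_iff, Set.mem_preimage, not_not]
      exact ⟨γ * g, hγ, by simp⟩
    change ∑' γ : Γ, u (γ * g) ≠ ⊤
    rw [tsum_eq_sum (s := hfin.toFinset) (fun γ hγ => by
      simp only [Set.Finite.mem_toFinset, Set.mem_ofPred_eq] at hγ
      simp [u, hγ])]
    refine (ENNReal.sum_lt_top.mpr fun γ _ => ?_).ne
    exact (Set.indicator_le_self' (fun _ _ => zero_le_one) _).trans_lt ENNReal.one_lt_top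
  have hsinv : ∀ (γ : Γ) g, s (γ * g) = s g := fun γ g => by
    change ∑' γ' : Γ, u (γ' * (γ * g)) = ∑' γ' : Γ, u (γ' * g)
    rw [← (Equiv.mulRight γ).tsum_eq (fun γ' : Γ => u (γ' * g))]
    simp [mul_assoc]
  refine ⟨fun g => u g / s g, hu.div hs, fun g => ?_, ?_⟩
  · simp only [hsinv, div_eq_mul_inv]
    rw [ENNReal.tsum_mul_right]
    exact ENNReal.mul_inv_cancel (one_pos.trans_le (hs1 g)).ne' (hst g)
  · calc ∫⁻ g, u g / s g ∂μG ≤ ∫⁻ g, u g ∂μG :=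
          lintegral_mono fun g => ENNReal.div_le_of_le_mul (le_mul_of_one_le_right' (hs1 g))
      _ = μG C := by rw [lintegral_indicator_one hC.isClosed.measurableSet]
      _ < ⊤ := hC.measure_lt_top

theorem out_eq_of_invariant {β : Type*} {f : G → β}
    (hinv : ∀ (γ : Γ) (k : K) g, f (γ * g * k) = f g) (g : G) :
    f (Quotient.mk'' g : DoubleQuotient Γ K).out = f g := by
  have h : DoubleCoset.setoid (Γ : Set G) (K : Set G) g (Quotient.mk'' g : DoubleQuotient Γ K).out :=
    (DoubleCoset.setoid (Γ : Set G) (K : Set G)).symm (Quotient.exact (Quotient.out_eq _))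
  obtain ⟨a, ha, b, hb, hab⟩ := DoubleCoset.rel_iff.mp h
  rw [hab]
  exact hinv ⟨a, ha⟩ ⟨b, hb⟩ g

theorem measurable_out {β : Type*} [MeasurableSpace β] {f : G → β} (hf : Measurable f)
    (hinv : ∀ (γ : Γ) (k : K) g, f (γ * g * k) = f g) :
    Measurable (fun x : DoubleQuotient Γ K => f x.out) := by
  rw [measurable_from_quotient]
  have : (fun x : DoubleQuotient Γ K => f x.out) ∘ Quotient.mk'' = f :=
    funext (out_eq_of_invariant hinv)
  rwa [this]

variable {μG : Measure G} {μK : Measure K} {ν : Measure (DoubleQuotient Γ K)} {D : Set G}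

theorem lintegral_fundamentalDomain_mul [μG.IsMulLeftInvariant] (hD : IsFundamentalDomain Γ D μG)
    {ψ : G → ℝ≥0∞} (hψ : Measurable ψ) (hψ1 : ∀ g, ∑' γ : Γ, ψ (γ * g) = 1) {f : G → ℝ≥0∞}
    (hf : Measurable f) (hinv : ∀ (γ : Γ) g, f (γ * g) = f g) :
    ∫⁻ g, f g * ψ g ∂μG = ∫⁻ g in D, f g ∂μG := by
  have hΓc : Countable Γ := countable_of_Lindelof_of_discrete
  rw [hD.lintegral_eq_tsum'', ← lintegral_tsum]
  · refine lintegral_congr fun g => ?_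
    simp only [Subgroup.smul_def, smul_eq_mul, hinv]
    rw [ENNReal.tsum_mul_left, hψ1, mul_one]
  · exact fun γ => ((hf.mul hψ).comp (measurable_const_mul (γ : G))).aemeasurable

/-- On a fibre f is constant, and for each k the Γ-translates of ψ sum to 1, so the fibre integral
is f times the volume of K. -/
theorem lintegral_quotientVolume_mul (hν : IsQuotientVolume Γ K μG μK ν)
    {ψ : G → ℝ≥0∞} (hψ : Measurable ψ) (hψ1 : ∀ g, ∑' γ : Γ, ψ (γ * g) = 1) {f : G → ℝ≥0∞}
    (hf : Measurable f) (hinv : ∀ (γ : Γ) (k : K) g, f (γ * g * k) = f g) :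
    ∫⁻ g, f g * ψ g ∂μG = μK Set.univ * ∫⁻ x, f x.out ∂ν := by
  have hΓc : Countable Γ := countable_of_Lindelof_of_discrete
  have hm : ∀ (γ : Γ) (g : G), Measurable fun k : K => ψ (γ * g * k) := fun γ g =>
    hψ.comp ((measurable_const_mul _).comp measurable_subtype_coe)
  have h := hν _ (hf.mul hψ)
  simp only [Pi.mul_apply] at h
  rw [h, mul_comm, ← lintegral_mul_const _ (measurable_out hf hinv)]
  refine lintegral_congr fun x => ?_
  simp only [hinv]
  simp only [lintegral_const_mul _ (hm _ _)]
  rw [ENNReal.tsum_mul_left, ← lintegral_tsum fun γ => (hm γ _).aemeasurable]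
  simp only [mul_assoc, hψ1]
  simp

variable [CompactSpace (MulAction.orbitRel.Quotient Γ G)] [μG.IsHaarMeasure]

/-- Both sides equal the integral of fψ over G. The function ψ replaces the indicator of D, which is
only null-measurable and whose translates cover only almost everywhere. -/
theorem lintegral_fundamentalDomain (hν : IsQuotientVolume Γ K μG μK ν)
    (hD : IsFundamentalDomain Γ D μG) {f : G → ℝ≥0∞}
    (hf : Measurable f) (hinv : ∀ (γ : Γ) (k : K) g, f (γ * g * k) = f g) :
    ∫⁻ g in D, f g ∂μG = μK Set.univ * ∫⁻ x, f x.out ∂ν := by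
  obtain ⟨ψ, hψ, hψ1, -⟩ := exists_partition_of_unity Γ μG
  rw [← lintegral_quotientVolume_mul hν hψ hψ1 hf hinv,
    lintegral_fundamentalDomain_mul hD hψ hψ1 hf fun γ g => by simpa using hinv γ 1 g]

theorem measure_fundamentalDomain_lt_top (hD : IsFundamentalDomain Γ D μG) : μG D < ⊤ := by
  obtain ⟨ψ, hψ, hψ1, hψt⟩ := exists_partition_of_unity Γ μG
  have := lintegral_fundamentalDomain_mul hD hψ hψ1 (measurable_one (α := ℝ≥0∞)) (fun _ _ => rfl)
  simp only [Pi.one_apply, one_mul, lintegral_one, Measure.restrict_apply_univ] at this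
  exact this ▸ hψt

/-- As K has nonzero volume, infinite volume of M would force infinite volume of D. -/
theorem isFiniteMeasure_quotientVolume [CompactSpace K] [μK.IsHaarMeasure]
    (hν : IsQuotientVolume Γ K μG μK ν) (hD : IsFundamentalDomain Γ D μG) :
    IsFiniteMeasure ν := by
  have h := lintegral_fundamentalDomain hν hD (measurable_one (α := ℝ≥0∞)) (fun _ _ _ => rfl)
  simp only [Pi.one_apply, lintegral_one, Measure.restrict_apply_univ] at h
  refine ⟨?_⟩
  by_contra htop
  rw [not_lt, top_le_iff] at htop
  rw [htop, ENNReal.mul_top (NeZero.ne _)] at h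
  exact (measure_fundamentalDomain_lt_top hD).ne h

theorem integrable_out [IsFiniteMeasure ν] {f : G → ℝ} (hf : Continuous f)
    (hinv : ∀ (γ : Γ) (k : K) g, f (γ * g * k) = f g) :
    Integrable (fun x : DoubleQuotient Γ K => f x.out) ν := by
  obtain ⟨c, hc⟩ := exists_bound_of_invariant (Γ := Γ) hf fun γ g => by simpa using hinv γ 1 g
  exact Integrable.of_bound (measurable_out hf.measurable hinv).aestronglyMeasurable c
    (ae_of_all _ fun x => hc _)

theorem integral_fundamentalDomain [CompactSpace K] [μK.IsHaarMeasure]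
    (hν : IsQuotientVolume Γ K μG μK ν) (hD : IsFundamentalDomain Γ D μG) {f : G → ℝ}
    (hf : Continuous f) (hinv : ∀ (γ : Γ) (k : K) g, f (γ * g * k) = f g) :
    ∫ g in D, f g ∂μG = μK.real Set.univ * ∫ x : DoubleQuotient Γ K, f x.out ∂ν := by
  have := isFiniteMeasure_quotientVolume hν hD
  have : IsFiniteMeasure (μG.restrict D) :=
    ⟨by rw [Measure.restrict_apply_univ]; exact measure_fundamentalDomain_lt_top hD⟩
  obtain ⟨c, hc⟩ := exists_bound_of_invariant (Γ := Γ) hf fun γ g => by simpa using hinv γ 1 g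
  have hint : Integrable f (μG.restrict D) :=
    Integrable.of_bound hf.measurable.aestronglyMeasurable c (ae_of_all _ hc)
  rw [integral_eq_lintegral_pos_part_sub_lintegral_neg_part hint,
    integral_eq_lintegral_pos_part_sub_lintegral_neg_part (integrable_out hf hinv),
    lintegral_fundamentalDomain hν hD hf.measurable.ennreal_ofReal
      (fun γ k g => by rw [hinv]),
    lintegral_fundamentalDomain (f := fun g => ENNReal.ofReal (-f g)) hν hD
      hf.neg.measurable.ennreal_ofReal (fun γ k g => by rw [hinv]), ENNReal.toReal_mul,
    ENNReal.toReal_mul, mul_sub]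
  rfl

end QuotientMeasure

theorem integrable_inner_rTensor {F : Type*} [NormedAddCommGroup F] [InnerProductSpace ℝ F]
    [FiniteDimensional ℝ F] {H : Type*} [NormedAddCommGroup H] [InnerProductSpace ℝ H]
    {G : Type*} [TopologicalSpace G] [MeasurableSpace G] [BorelSpace G]
    {μ : Measure G} [IsFiniteMeasure μ] (T : F →ₗ[ℝ] F) {e e' : G → F ⊗[ℝ] H}
    (he : Continuous e) (he' : Continuous e') {C : ℝ} (hC : ∀ g, ‖e g‖ ≤ C)
    (hC' : ∀ g, ‖e' g‖ ≤ C) :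
    Integrable (fun g => (inner ℝ (LinearMap.rTensor H T (e g)) (e' g) : ℝ)) μ := by
  let T' : F ⊗[ℝ] H →L[ℝ] F ⊗[ℝ] H := rTensorL F H T.toContinuousLinearMap
  refine Integrable.of_bound ((T'.continuous.comp he).inner he').measurable.aestronglyMeasurable
    (‖T'‖ * C * C) (ae_of_all _ fun g => ?_)
  refine (norm_inner_le_norm (𝕜 := ℝ) (T' (e g)) (e' g)).trans ?_
  have h : ‖T' (e g)‖ ≤ ‖T'‖ * C :=
    (T'.le_opNorm _).trans (mul_le_mul_of_nonneg_left (hC g) (norm_nonneg _))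
  exact mul_le_mul h (hC' g) (norm_nonneg _) ((norm_nonneg _).trans h)

end BochnerFormula

end

/-! ### The integrated formula. -/

open BochnerFormula in
theorem mainTheorem7
    {n N m : ℕ} {G : Type*} [TopologicalSpace G] [ChartedSpace (EuclideanSpace ℝ (Fin n)) G]
    [Group G] [LieGroup (𝓡 n) ∞ G] [T2Space G] [SecondCountableTopology G]
    [MeasurableSpace G] [BorelSpace G]
    -- the torsion-free cocompact lattice and the compact subgroup
    (Γ K : Subgroup G) [DiscreteTopology Γ] (hΓ : ∀ γ : Γ, γ ≠ 1 → ¬ IsOfFinOrder γ)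
    [CompactSpace (MulAction.orbitRel.Quotient Γ G)] [CompactSpace K]
    -- the Cartan decomposition relative to `K` and the adapted basis
    (𝔨 𝔭 : Submodule ℝ (Lie n G)) (hK : IsLieAlgebraOf 𝔨 K) (hkp : IsCartanDecomposition 𝔨 𝔭)
    (X : Module.Basis (Fin N ⊕ Fin m) ℝ (Lie n G)) (hX : IsCartanBasis 𝔨 𝔭 X)
    -- the volumes of `G`, `K` and `M`, and a fundamental domain of `Γ` in `G`
    (μG : Measure G) [μG.IsHaarMeasure] (μK : Measure K) [μK.IsHaarMeasure]
    (ν : Measure (DoubleQuotient Γ K)) (hν : IsQuotientVolume Γ K μG μK ν)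
    (D : Set G) (hD : IsFundamentalDomain Γ D μG)
    -- the representation `π₁` of `G` on `F`, with an admissible inner product
    {F : Type*} [NormedAddCommGroup F] [InnerProductSpace ℝ F] [FiniteDimensional ℝ F]
    (π₁ : Representation ℝ G F)
    (hπ₁ : ∀ u : F, ContMDiff (𝓡 n) 𝓘(ℝ, F) ∞ (fun g => π₁ g u))
    (hF : IsAdmissible π₁ K 𝔨 𝔭)
    -- the unitary representation `π₂` of `Γ` on the separable Hilbert space `H`
    {H : Type*} [NormedAddCommGroup H] [InnerProductSpace ℝ H] [CompleteSpace H]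
    (π₂ : Representation ℝ Γ H) (hπ₂ : ∀ γ w, ‖π₂ γ w‖ = ‖w‖)
    {A : Type*} [Countable A] (v : HilbertBasis A ℝ H)
    -- an `ℰ(π)`-valued form of degree `p + 1`, given by its lift to `E(σ')`
    (p : ℕ) (η : G → (Lie n G) [⋀^Fin (p + 1)]→ₗ[ℝ] (F ⊗[ℝ] H))
    (hη : IsLift 𝔨 (sigma' K π₁ π₂) η) :
    let β : LForm n G (F ⊗[ℝ] H) (p + 1) := fun g Y => η g Y
    let c : ℝ := (μK.real Set.univ)⁻¹
    -- the function `η^α_{i₁, …, i_{p+1}}` on `G`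
    let ηc : A → (Fin (p + 1) → Fin N) → G → F :=
      fun α I g => coeff (v α) (η g fun a => X (Sum.inl (I a)))
    -- the two integrands
    let f₁ : A → (Fin (p + 1) → Fin N) → G → ℝ := fun α I g =>
      inner ℝ (∑ k : Fin N, dRep π₁ (X (Sum.inl k)) (dRep π₁ (X (Sum.inl k)) (ηc α I g)))
        (ηc α I g)
    let f₂ : A → Fin N → (Fin p → Fin N) → G → ℝ := fun α h I g =>
      inner ℝ (∑ k : Fin N, dRep π₁ ⁅X (Sum.inl h), X (Sum.inl k)⁆ (ηc α (Fin.cons k I) g))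
        (ηc α (Fin.cons h I) g)
    Integrable (fun x => innerOnM X (flatLaplacian π₁ X β) β x) ν ∧
    Integrable (fun x => innerOnM X (kLaplacian X β) β x) ν ∧
    (∀ α I, IntegrableOn (f₁ α I) D μG) ∧
    (∀ α h I, IntegrableOn (f₂ α h I) D μG) ∧
    (Summable fun α => ∑ I : Fin (p + 1) → Fin N, ∫ g in D, f₁ α I g ∂μG) ∧
    (Summable fun α => ∑ h : Fin N, ∑ I : Fin p → Fin N, ∫ g in D, f₂ α h I g ∂μG) ∧
    (∫ x, innerOnM X (flatLaplacian π₁ X β) β x ∂ν) - ∫ x, innerOnM X (kLaplacian X β) β x ∂ν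
      = c / ((p + 1)! : ℝ) * ∑' α, ∑ I : Fin (p + 1) → Fin N, ∫ g in D, f₁ α I g ∂μG
        + c / (p ! : ℝ) *
            ∑' α, ∑ h : Fin N, ∑ I : Fin p → Fin N, ∫ g in D, f₂ α h I g ∂μG := by
  intro β c ηc f₁ f₂
  have : IsTopologicalGroup G := topologicalGroup_of_lieGroup (𝓡 n) ∞
  have : LocallyCompactSpace G := Manifold.locallyCompact_of_finiteDimensional (𝓡 n)
  have hνf : IsFiniteMeasure ν := isFiniteMeasure_quotientVolume hν hD
  have hDf : IsFiniteMeasure (μG.restrict D) :=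
    ⟨by rw [Measure.restrict_apply_univ]; exact measure_fundamentalDomain_lt_top hD⟩
  obtain ⟨hc₁, hi₁⟩ := flatLaplacian_invariant hX hK hkp hF hπ₂ hπ₁ hη
  obtain ⟨hc₂, hi₂⟩ := kLaplacian_invariant hX hK hkp hF hπ₂ hη
  -- the components of the form are continuous and bounded
  let w : (Fin (p + 1) → Fin N) → G → F ⊗[ℝ] H := fun I g => η g fun a => X (Sum.inl (I a))
  have hw : ∀ I, Continuous (w I) := fun I => (hη.smooth _).continuous
  obtain ⟨C, hC⟩ : ∃ C, ∀ I g, ‖w I g‖ ≤ C := by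
    choose b hb using fun I => exists_bound_of_invariant (Γ := Γ) (hw I).norm
      (fun γ g => norm_lift_invariant hF hπ₂ hη γ g _)
    obtain ⟨C, hC⟩ := Finite.exists_le b
    exact ⟨C, fun I g => (norm_norm (w I g)).symm.le.trans ((hb I g).trans (hC I))⟩
  let T₁ : F →ₗ[ℝ] F := ∑ k, dRepₗ hπ₁ (X (Sum.inl k)) ∘ₗ dRepₗ hπ₁ (X (Sum.inl k))
  let T₂ : Fin N → Fin N → F →ₗ[ℝ] F := fun h k => dRepₗ hπ₁ ⁅X (Sum.inl h), X (Sum.inl k)⁆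
  have hf₁ : ∀ α I, f₁ α I = fun g => inner ℝ (T₁ (coeff (v α) (w I g))) (coeff (v α) (w I g)) := by
    intro α I
    funext g
    simp only [T₁, LinearMap.sum_apply]
    rfl
  have hf₂ : ∀ α h I, f₂ α h I = fun g => ∑ k, inner ℝ (T₂ h k (coeff (v α) (w (Fin.cons k I) g)))
      (coeff (v α) (w (Fin.cons h I) g)) := by
    intro α h I
    funext g
    simp only [f₂, sum_inner]
    rfl
  have hint₁ : ∀ α I, IntegrableOn (f₁ α I) D μG := fun α I => by
    rw [hf₁]; exact integrable_inner_coeff (v α) T₁ (hw I) (hw I) (hC I) (hC I)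
  have hint₂ : ∀ α h I k, Integrable (fun g => (inner ℝ (T₂ h k (coeff (v α) (w (Fin.cons k I) g)))
      (coeff (v α) (w (Fin.cons h I) g)) : ℝ)) (μG.restrict D) := fun α h I k =>
    integrable_inner_coeff (v α) (T₂ h k) (hw _) (hw _) (hC _) (hC _)
  have hsum₁ : HasSum (fun α => ∑ I : Fin (p + 1) → Fin N, ∫ g in D, f₁ α I g ∂μG)
      (∑ I, ∫ g in D, inner ℝ (LinearMap.rTensor H T₁ (w I g)) (w I g) ∂μG) := by
    simp only [hf₁]
    exact hasSum_sum fun I _ => hasSum_integral_inner_coeff v T₁ (hw I) (hw I) (hC I) (hC I)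
  have hsum₂ : HasSum (fun α => ∑ h : Fin N, ∑ I : Fin p → Fin N, ∫ g in D, f₂ α h I g ∂μG)
      (∑ h, ∑ I : Fin p → Fin N, ∑ k, ∫ g in D, inner ℝ
        (LinearMap.rTensor H (T₂ h k) (w (Fin.cons k I) g)) (w (Fin.cons h I) g) ∂μG) := by
    simp only [hf₂]
    refine hasSum_sum fun h _ => hasSum_sum fun I _ => ?_
    simp only [integral_finsetSum _ fun k _ => hint₂ _ h I k]
    exact hasSum_sum fun k _ => hasSum_integral_inner_coeff v (T₂ h k) (hw _) (hw _) (hC _) (hC _)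
  refine ⟨integrable_out hc₁ hi₁, integrable_out hc₂ hi₂, hint₁,
    fun α h I => ?_, hsum₁.summable, hsum₂.summable, ?_⟩
  · rw [hf₂]; exact integrable_finsetSum _ fun k _ => hint₂ α h I k
  have hμK : μK.real Set.univ ≠ 0 :=
    ENNReal.toReal_ne_zero.mpr ⟨NeZero.ne _, isCompact_univ.measure_lt_top.ne⟩
  -- Only the difference of the two integrands is unfolded to D, where the zeroth-order pointwise
  -- formula applies.
  have hM := integral_fundamentalDomain (f := fun g => pointwiseInner X (flatLaplacian π₁ X β) β g
      - pointwiseInner X (kLaplacian X β) β g) hν hD (hc₁.sub hc₂)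
    (fun γ k g => congrArg₂ (· - ·) (hi₁ γ k g) (hi₂ γ k g))
  have hsub : (∫ x, innerOnM X (flatLaplacian π₁ X β) β x ∂ν)
      - ∫ x, innerOnM X (kLaplacian X β) β x ∂ν
      = c * ∫ g in D, (pointwiseInner X (flatLaplacian π₁ X β) β g
        - pointwiseInner X (kLaplacian X β) β g) ∂μG := by
    rw [hM, inv_mul_cancel_left₀ hμK]
    exact (integral_sub (integrable_out hc₁ hi₁) (integrable_out hc₂ hi₂)).symm
  have hpt : ∀ g, pointwiseInner X (flatLaplacian π₁ X β) β g
        - pointwiseInner X (kLaplacian X β) β g = _ := fun g =>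
    pointwiseInner_flatLaplacian_sub (θ := smoothForm η hη.smooth) hπ₁ hkp hX hF hη.horizontal g
  have hA : ∀ I, Integrable (fun g => (inner ℝ (LinearMap.rTensor H T₁ (w I g)) (w I g) : ℝ))
      (μG.restrict D) := fun I => integrable_inner_rTensor T₁ (hw I) (hw I) (hC I) (hC I)
  have hB : ∀ h (I : Fin p → Fin N) k, Integrable (fun g => (inner ℝ
      (LinearMap.rTensor H (T₂ h k) (w (Fin.cons k I) g)) (w (Fin.cons h I) g) : ℝ))
      (μG.restrict D) := fun h I k =>
    integrable_inner_rTensor (T₂ h k) (hw _) (hw _) (hC _) (hC _)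
  have hint : ∫ g in D, (pointwiseInner X (flatLaplacian π₁ X β) β g
        - pointwiseInner X (kLaplacian X β) β g) ∂μG
      = 1 / ((p + 1)! : ℝ) * ∑ I, ∫ g in D, inner ℝ (LinearMap.rTensor H T₁ (w I g)) (w I g) ∂μG
        + 1 / (p ! : ℝ) * ∑ h, ∑ I : Fin p → Fin N, ∑ k, ∫ g in D, inner ℝ
        (LinearMap.rTensor H (T₂ h k) (w (Fin.cons k I) g)) (w (Fin.cons h I) g) ∂μG := by
    simp only [hpt]
    refine (integral_add ((integrable_finsetSum _ fun I _ => hA I).const_mul _)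
      ((integrable_finsetSum _ fun h _ => integrable_finsetSum _ fun I _ =>
        integrable_finsetSum _ fun k _ => hB h I k).const_mul _)).trans ?_
    rw [integral_const_mul, integral_const_mul, integral_finsetSum _ fun I _ => hA I,
      integral_finsetSum _ fun h _ => integrable_finsetSum _ fun I _ =>
        integrable_finsetSum _ fun k _ => hB h I k]
    congr 2
    refine Finset.sum_congr rfl fun h _ => ?_
    rw [integral_finsetSum _ fun I _ => integrable_finsetSum _ fun k _ => hB h I k]
    exact Finset.sum_congr rfl fun I _ => integral_finsetSum _ fun k _ => hB h I k
  rw [hsub, hint, hsum₁.tsum_eq, hsum₂.tsum_eq]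
  ring
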